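/- Let $D=\{z\in\mathbb C:|z|<1\}$. For $0<p<\infty$ and $w:D\to\mathbb C$ put $$\|w\|_{H^p(D)}=\Bigl(\sup_{0<r<1}\frac1{2\pi}\int_0^{2\pi}|w(re^{i\theta})|^p\,d\theta\Bigr)^{1/p},$$ and let $H^p(D)$ be the set of holomorphic $\Phi$ on $D$ with $\|\Phi\|_{H^p(D)}<\infty$. For an integer $n\ge 1$, $q>1$ (possibly $q=\infty$) and $f\in L^q(D)$, let $H^{n,p}_{f,q}(D)$ be the set of functions $w$ on $D$ that have generalized (distributional) derivatives $\partial^k w/\partial\bar z^k\in L^1_{\mathrm{loc}}(D)$, $0\le k\le n$, with $\partial^n w/\partial\bar z^n=f$ and $\|\partial^k w/\partial\bar z^k\|_{H^p(D)}<\infty$ for $0\le k\le n-1$ (for $k=0$ the given function $w$, and for $1\le k\le n-1$ some representative of the derivative). For $g\in L^1(D)$ let $$\widetilde T(g)(z)=-\frac1\pi\iint_D\left(\frac{g(\zeta)}{\zeta-z}+\frac{z\,\overline{g(\zeta)}}{1-\overline\zeta z}\right)d\xi\,d\eta,\qquad \zeta=\xi+i\eta ,$$ whenever the integral converges absolutely.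 A function $u$ on $D$ has the boundary value $u_b\in\mathcal D'(\partial D)$ in the sense of distributions if $\theta\mapsto u(re^{i\theta})$ is integrable for all $r<1$ close to $1$ and $\langle u_b,\varphi\rangle=\lim_{r\nearrow1}\int_0^{2\pi}u(re^{i\theta})\varphi(\theta)\,d\theta$ for all $\varphi\in C^\infty(\partial D)$; it has the essential boundary value $u_b$ if the same holds after a set of radii $r$ of measure zero is disregarded. A locally integrable function $w$ on $D$ is called precise if $w(z)=\lim_{\varepsilon\to0}|B(z,\varepsilon)|^{-1}\iint_{B(z,\varepsilon)}w$ at each $z\in D$ where this limit exists; every locally integrable function on $D$ agrees almost everywhere with a precise one. **Theorem.** Let $n\ge1$, $0<p\le1$, $q>1$, $f\in L^q(D)$, and suppose that $p>\frac12$ if $n\ge2$. For every $w\in H^{n,p}_{f,q}(D)$ there are $\Phi_0,\dots,\Phi_{n-1}\in H^p(D)$ such that, with $$\widetilde\Psi=\widetilde T\bigl(\Phi_1+\widetilde T(\Phi_2+\cdots+\widetilde T(\Phi_{n-1}+\widetilde T(f))\cdots)\bigr)$$ ($\widetilde\Psi=\widetilde T(f)$ for $n=1$), the following hold. 1. Each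 function to which $\widetilde T$ is applied here is integrable over $D$, and the integral that defines its image under $\widetilde T$ converges absolutely at almost every point of $D$. 2. $w=\Phi_0+\widetilde\Psi$ almost everywhere in $D$. If $w$ is precise, then $w(z)=\Phi_0(z)+\widetilde\Psi(z)$ at every $z\in D$ at which the integral that defines $\widetilde\Psi(z)$ (the outermost $\widetilde T$) converges absolutely. 3. $\Phi_0$ and $\widetilde\Psi$ have boundary values $\Phi_{0,b}$ and $\widetilde\Psi_b$ in the sense of distributions, and $w$ has the essential boundary value $w_b=\Phi_{0,b}+\widetilde\Psi_b$. If $w$ is precise, then this $w_b$ is the boundary value of $w$ in the sense of distributions. -/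

import Mathlib

open MeasureTheory Filter Topology Set
open scoped ENNReal

noncomputable section

namespace HardyDbar

/-- The open unit disk `D`. -/
def disk : Set ℂ := Metric.ball 0 1

/-- The point `r e^{iθ}`. -/
def polarPt (r θ : ℝ) : ℂ := (r : ℂ) * Complex.exp ((θ : ℂ) * Complex.I)

/-- The classical Cauchy-Riemann derivative `∂φ/∂z̄ = (∂φ/∂x + i ∂φ/∂y) / 2`
(used for smooth test functions only). -/
def dbar (φ : ℂ → ℂ) (z : ℂ) : ℂ :=
  (1 / 2 : ℂ) * (fderiv ℝ φ z 1 + Complex.I * fderiv ℝ φ z Complex.I)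

/-- `∂w/∂z̄ = g` in `D` in the generalized (distributional, Sobolev) sense: both functions are
locally integrable in `D`, and `∫ w ∂φ/∂z̄ = - ∫ g φ` for every smooth `φ` with compact support
in `D`. -/
def IsWeakDbar (w g : ℂ → ℂ) : Prop :=
  LocallyIntegrableOn w disk ∧ LocallyIntegrableOn g disk ∧
    ∀ φ : ℂ → ℂ, ContDiff ℝ (⊤ : ℕ∞) φ → HasCompactSupport φ → tsupport φ ⊆ disk →
      ∫ z in disk, w z * dbar φ z = -∫ z in disk, g z * φ z

/-- `‖w‖_{H^p(D)} = (sup_{0<r<1} (1/2π) ∫_0^{2π} |w(r e^{iθ})|^p dθ)^{1/p}`, as an element of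
`[0, ∞]`. -/
def hardyNorm (p : ℝ) (w : ℂ → ℂ) : ℝ≥0∞ :=
  (⨆ r ∈ Ioo (0 : ℝ) 1,
    ENNReal.ofReal (1 / (2 * Real.pi)) *
      ∫⁻ θ in Ioc (0 : ℝ) (2 * Real.pi), ‖w (polarPt r θ)‖ₑ ^ p) ^ (1 / p)

/-- The holomorphic Hardy space `H^p(D)`. -/
def holoHardy (p : ℝ) : Set (ℂ → ℂ) :=
  {Φ | DifferentiableOn ℂ Φ disk ∧ hardyNorm p Φ < ⊤}

/-- The class `H^{n,p}_f(D)`: functions `w` which have generalized derivatives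
`g k = ∂^k w/∂z̄^k`, `0 ≤ k ≤ n`, with `g 0 = w` and `g n = f`, such that
`‖∂^k w/∂z̄^k‖_{H^p(D)} < ⊤` for `0 ≤ k ≤ n - 1`. -/
def hardyClass (n : ℕ) (p : ℝ) (f : ℂ → ℂ) : Set (ℂ → ℂ) :=
  {w | ∃ g : ℕ → ℂ → ℂ, g 0 = w ∧ g n = f ∧
    ∀ k < n, IsWeakDbar (g k) (g (k + 1)) ∧ hardyNorm p (g k) < ⊤}

/-- The class `H^{n,p}_{f,q}(D)`: the class `H^{n,p}_f(D)` with the requirement `f ∈ L^q(D)`. -/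
def hardyClassLq (n : ℕ) (p : ℝ) (q : ℝ≥0∞) (f : ℂ → ℂ) : Set (ℂ → ℂ) :=
  {w | MemLp f q (volume.restrict disk) ∧ w ∈ hardyClass n p f}

/-- The integrand of the operator `T̃`. -/
def kernelT (f : ℂ → ℂ) (z ζ : ℂ) : ℂ :=
  f ζ / (ζ - z) + z * (starRingEnd ℂ) (f ζ) / (1 - (starRingEnd ℂ) ζ * z)

/-- The integral defining `T̃(f)(z)` converges absolutely. -/
def DefinedT (f : ℂ → ℂ) (z : ℂ) : Prop := IntegrableOn (kernelT f z) disk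

/-- The operator
`T̃(f)(z) = -(1/π) ∬_D ( f(ζ)/(ζ - z) + z conj(f(ζ)) / (1 - conj(ζ) z) ) dξ dη`. -/
def opT (f : ℂ → ℂ) (z : ℂ) : ℂ :=
  -(1 / (Real.pi : ℂ)) * ∫ ζ in disk, kernelT f z ζ

/-- `nest f Φ k m = Φ_k + T̃(Φ_{k+1} + T̃(Φ_{k+2} + ⋯ + T̃(Φ_{k+m-1} + T̃(f)) ⋯ ))`, with `m`
functions `Φ_j`, beginning with `Φ_k`; for `m = 0` it is `f`. -/
def nest (f : ℂ → ℂ) (Φ : ℕ → ℂ → ℂ) : ℕ → ℕ → ℂ → ℂ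
  | _, 0 => f
  | k, m + 1 => fun z => Φ k z + opT (nest f Φ (k + 1) m) z

/-- `Ψ̃ = T̃(Φ_1 + T̃(Φ_2 + ⋯ + T̃(Φ_{n-1} + T̃(f)) ⋯ ))` for `n ≥ 1`. -/
def psiT (f : ℂ → ℂ) (Φ : ℕ → ℂ → ℂ) (n : ℕ) : ℂ → ℂ := opT (nest f Φ 1 (n - 1))

/-- `C^∞(∂D)`: the smooth `2π`-periodic functions of the angle. -/
def circleTest : Submodule ℂ (ℝ → ℂ) where
  carrier := {φ | ContDiff ℝ (⊤ : ℕ∞) φ ∧ Function.Periodic φ (2 * Real.pi)}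
  add_mem' := fun ha hb => ⟨ha.1.add hb.1, ha.2.add hb.2⟩
  zero_mem' := ⟨contDiff_const, fun _ => rfl⟩
  smul_mem' := fun c _ ha => ⟨contDiff_const.smul ha.1, fun x => by simp [ha.2 x]⟩

/-- `𝒟'(∂D)`: the linear functionals on `C^∞(∂D)` that are continuous for the `C^∞` topology,
that is, bounded by a multiple of finitely many of the seminorms `sup |φ^{(k)}|`. -/
def circleDistribution : Submodule ℂ (circleTest →ₗ[ℂ] ℂ) where
  carrier := {L | ∃ (N : ℕ) (C : ℝ), 0 ≤ C ∧ ∀ (φ : circleTest) (M : ℝ),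
    (∀ k ≤ N, ∀ θ : ℝ, ‖iteratedDeriv k (φ : ℝ → ℂ) θ‖ ≤ M) → ‖L φ‖ ≤ C * M}
  add_mem' := by
    rintro a b ⟨N₁, C₁, h₁, ha⟩ ⟨N₂, C₂, h₂, hb⟩
    refine ⟨max N₁ N₂, C₁ + C₂, add_nonneg h₁ h₂, fun φ M hM => ?_⟩
    have e₁ := ha φ M fun k hk => hM k (hk.trans (le_max_left _ _))
    have e₂ := hb φ M fun k hk => hM k (hk.trans (le_max_right _ _))
    calc ‖(a + b) φ‖ ≤ ‖a φ‖ + ‖b φ‖ := norm_add_le _ _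
      _ ≤ (C₁ + C₂) * M := by linarith
  zero_mem' := ⟨0, 0, le_rfl, fun φ M _ => by simp⟩
  smul_mem' := by
    rintro c a ⟨N, C, h, ha⟩
    refine ⟨N, ‖c‖ * C, mul_nonneg (norm_nonneg c) h, fun φ M hM => ?_⟩
    have e := mul_le_mul_of_nonneg_left (ha φ M hM) (norm_nonneg c)
    simpa [mul_assoc] using e

/-- Along the filter `l` of radii, `∫_0^{2π} w(r e^{iθ}) φ(θ) dθ → ⟨L, φ⟩` for every
`φ ∈ C^∞(∂D)`, the functions `θ ↦ w(r e^{iθ})` being integrable eventually along `l`. -/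
def HasBoundaryValueAlong (l : Filter ℝ) (w : ℂ → ℂ) (L : circleDistribution) : Prop :=
  (∀ᶠ r in l, IntervalIntegrable (fun θ => w (polarPt r θ)) volume 0 (2 * Real.pi)) ∧
    ∀ φ : circleTest,
      Tendsto (fun r => ∫ θ in (0 : ℝ)..(2 * Real.pi), w (polarPt r θ) * (φ : ℝ → ℂ) θ)
        l (𝓝 ((L : circleTest →ₗ[ℂ] ℂ) φ))

/-- `L` is the boundary value of `w` in the sense of distributions (limit as `r ↗ 1`). -/
def HasBoundaryValue (w : ℂ → ℂ) (L : circleDistribution) : Prop :=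
  HasBoundaryValueAlong (𝓝[<] 1) w L

/-- The same with the essential limit as `r ↗ 1`: a set of radii of measure zero is disregarded, so
that the notion does not change when `w` is modified on a subset of `D` of measure zero. -/
def HasEssBoundaryValue (w : ℂ → ℂ) (L : circleDistribution) : Prop :=
  HasBoundaryValueAlong (𝓝[<] 1 ⊓ ae volume) w L

/-- `w` is a precise representative in `D`: at each point of `D` at which the means of `w` over
small concentric disks have a limit, the value of `w` is this limit. Continuous functions have this
property, and every locally integrable function on `D` is almost everywhere equal to a function
with this property. -/
def IsPrecise (w : ℂ → ℂ) : Prop :=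
  ∀ z ∈ disk, ∀ c : ℂ,
    Tendsto (fun ε : ℝ => ⨍ ζ in Metric.ball z ε, w ζ) (𝓝[>] 0) (𝓝 c) → w z = c

end HardyDbar

end

open scoped Convolution

namespace HardyDbar

/-! Write `g k` for the `k`-th derivative, so that `g n = f`. The correction `(1/π) ∬ g (k+1) / (ζ -
z)` has weak `∂/∂z̄`-derivative `-g (k+1)`, so adding it to `g k` gives a weak solution of the
homogeneous equation, which is holomorphic by Weyl's lemma. The conjugated half of the kernel of
`T̃` produces a holomorphic function as well. Hence `g k = Φ_k + T̃ (g (k+1))` almost everywhere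
(`exists_holomorphic_add_opT`), and it remains to control both summands.

On the closed disk `|ζ - z| ≤ |1 - ζ̄ z|`, so the whole kernel is dominated by `2 |g(ζ)| / |ζ - z|`,
and all estimates of `T̃` reduce to the positive potential `absPotential`. For `g ∈ L^s(D)` with `1
< s < 2`, Hölder and Tonelli bound it in `L^s(D)` and, uniformly, in `L^s` of all circles of radius
in `[1/2, 1]`. Since `p ≤ 1`, subtracting `T̃ (g (k+1))` therefore preserves bounded `p`-means, and
`Φ_k ∈ H^p` (`holomorphic_part_mem_holoHardy`).

To pass from `g (k+1)` to `g k` the latter must lie in `L^s` again. A function of `H^p` grows at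
most like `(1 - |z|)^{-1/p}`, whence `H^p ⊆ L^s` for `p ≤ s < 2p`
(`lintegral_rpow_lt_top_of_holoHardy`). An exponent `s > 1` of this kind exists exactly if `p >
1/2`; for `n = 1` the step does not occur. Descending from `f` gives `inLs_chain`, and substituting
the representations into each other gives `nest_ae_eq`.

Boundary values: `T̃ g` on the circle of radius `r` converges in `L¹` to `T̃ g` on the unit circle
(`tendsto_lintegral_opT_sub`). The Taylor coefficients of `Φ_0` grow polynomially and define a
distribution to which `Φ_0` converges (`hasBoundaryValue_of_hasSum`). The representation holds
almost everywhere on almost every circle, which gives the essential boundary value of `w`.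

Precise `w`: where the integral converges absolutely, `T̃ g` is the limit of its means over small
disks (`tendsto_setAverage_opT`), so the representation holds at that point. For `g ∈ L^s`, `s > 1`,
such points fill almost all of every circle of radius in `[1/2, 1]`, so no radii have to be
discarded. -/

/-! ### Polar coordinates in the disk. -/

lemma measurable_polarPt : Measurable (Function.uncurry polarPt) := by
  unfold polarPt Function.uncurry
  fun_prop

lemma measurable_polarPt_right (r : ℝ) : Measurable (polarPt r) := by
  unfold polarPt
  fun_prop

lemma continuous_polarPt : Continuous (Function.uncurry polarPt) := by
  unfold polarPt Function.uncurry
  fun_prop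

lemma norm_polarPt {r : ℝ} (hr : 0 ≤ r) (θ : ℝ) : ‖polarPt r θ‖ = r := by
  simp [polarPt, Complex.norm_exp_ofReal_mul_I, abs_of_nonneg hr]

lemma polarPt_periodic (r : ℝ) : Function.Periodic (polarPt r) (2 * Real.pi) := by
  intro θ
  have : ((θ + 2 * Real.pi : ℝ) : ℂ) * Complex.I = θ * Complex.I + 2 * Real.pi * Complex.I := by
    push_cast; ring
  simp only [polarPt]
  rw [this, Complex.exp_periodic]

lemma lintegral_Ioc_periodic {F : ℝ → ℝ≥0∞} {T : ℝ} (hT : 0 < T) (hF : Function.Periodic F T)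
    (a b : ℝ) : ∫⁻ θ in Ioc a (a + T), F θ = ∫⁻ θ in Ioc b (b + T), F θ := by
  have : VAddInvariantMeasure (AddSubgroup.zmultiples T) ℝ volume :=
    ⟨fun c s _ => measure_preimage_add _ _ _⟩
  exact (isAddFundamentalDomain_Ioc hT a).setLIntegral_eq (isAddFundamentalDomain_Ioc hT b) F
    hF.map_vadd_zmultiples

lemma lintegral_Ioo_eq_Ioc_two_pi {F : ℝ → ℝ≥0∞} (hF : Function.Periodic F (2 * Real.pi)) :
    ∫⁻ θ in Ioo (-Real.pi) Real.pi, F θ = ∫⁻ θ in Ioc 0 (2 * Real.pi), F θ := by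
  rw [Measure.restrict_congr_set Ioo_ae_eq_Ioc]
  have := lintegral_Ioc_periodic Real.two_pi_pos hF (-Real.pi) 0
  rwa [show -Real.pi + 2 * Real.pi = Real.pi by ring, zero_add] at this

lemma polarCoord_symm_eq (p : ℝ × ℝ) : Complex.polarCoord.symm p = polarPt p.1 p.2 := by
  rw [Complex.polarCoord_symm_apply, polarPt, Complex.exp_mul_I]
  push_cast; ring

/-- Integration in polar coordinates, with the angle in `(0, 2π]`. -/
lemma lintegral_polar {F : ℂ → ℝ≥0∞} (hF : Measurable F) :
    ∫⁻ z, F z = ∫⁻ r in Ioi (0 : ℝ), ENNReal.ofReal r *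
      ∫⁻ θ in Ioc (0 : ℝ) (2 * Real.pi), F (polarPt r θ) := by
  have hm : Measurable fun p : ℝ × ℝ => F (polarPt p.1 p.2) := hF.comp measurable_polarPt
  rw [← Complex.lintegral_comp_polarCoord_symm F, polarCoord_target,
    Measure.volume_eq_prod, ← Measure.prod_restrict, lintegral_prod]
  · refine lintegral_congr fun r => ?_
    simp only [polarCoord_symm_eq, smul_eq_mul]
    rw [lintegral_const_mul' _ _ ENNReal.ofReal_ne_top, lintegral_Ioo_eq_Ioc_two_pi]
    intro θ
    simp only [polarPt_periodic r θ]
  · simp only [polarCoord_symm_eq, smul_eq_mul]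
    exact (measurable_fst.ennreal_ofReal.mul hm).aemeasurable

lemma measurableSet_disk : MeasurableSet disk := measurableSet_ball

lemma isOpen_disk : IsOpen disk := Metric.isOpen_ball

lemma mem_disk {z : ℂ} : z ∈ disk ↔ ‖z‖ < 1 := by simp [disk]

instance : IsFiniteMeasure (volume.restrict disk) :=
  isFiniteMeasure_restrict.2 measure_ball_lt_top.ne

lemma polarPt_mem_disk {r : ℝ} (hr : r ∈ Ioo (0 : ℝ) 1) (θ : ℝ) : polarPt r θ ∈ disk := by
  rw [mem_disk, norm_polarPt hr.1.le]; exact hr.2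

/-- Polar coordinates for an integral over the part `{z : ‖z‖ ∈ A}` of the plane. -/
lemma lintegral_polar_indicator {F : ℂ → ℝ≥0∞} (hF : Measurable F) {A : Set ℝ}
    (hA : MeasurableSet A) :
    ∫⁻ z in {z : ℂ | ‖z‖ ∈ A}, F z = ∫⁻ r in Ioi (0 : ℝ) ∩ A, ENNReal.ofReal r *
      ∫⁻ θ in Ioc (0 : ℝ) (2 * Real.pi), F (polarPt r θ) := by
  have hA' : MeasurableSet {z : ℂ | ‖z‖ ∈ A} := measurable_norm hA
  rw [← lintegral_indicator hA', lintegral_polar (hF.indicator hA'), inter_comm,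
    ← Measure.restrict_restrict hA, ← lintegral_indicator hA]
  refine setLIntegral_congr_fun measurableSet_Ioi fun r hr => ?_
  have hr' : 0 < r := hr
  by_cases h : r ∈ A
  · rw [indicator_of_mem h]
    congr 2
    funext θ
    rw [indicator_of_mem]
    simpa [norm_polarPt hr'.le] using h
  · rw [indicator_of_notMem h]
    have : ∀ θ, {z : ℂ | ‖z‖ ∈ A}.indicator F (polarPt r θ) = 0 := fun θ => by
      rw [indicator_of_notMem]
      simpa [norm_polarPt hr'.le] using h
    simp [this]

lemma lintegral_disk_polar {F : ℂ → ℝ≥0∞} (hF : Measurable F) :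
    ∫⁻ z in disk, F z = ∫⁻ r in Ioo (0 : ℝ) 1, ENNReal.ofReal r *
      ∫⁻ θ in Ioc (0 : ℝ) (2 * Real.pi), F (polarPt r θ) := by
  have := lintegral_polar_indicator hF (measurableSet_Iio (a := (1 : ℝ)))
  rwa [show {z : ℂ | ‖z‖ ∈ Iio (1 : ℝ)} = disk by ext; simp [mem_disk], Ioi_inter_Iio] at this

/-- A property that holds almost everywhere in the disk holds almost everywhere on almost every
circle. -/
lemma ae_polar {P : ℂ → Prop} (h : ∀ᵐ z ∂(volume.restrict disk), P z) :
    ∀ᵐ r : ℝ, r ∈ Ioo (0 : ℝ) 1 →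
      ∀ᵐ θ ∂(volume.restrict (Ioc (0 : ℝ) (2 * Real.pi))), P (polarPt r θ) := by
  obtain ⟨N, hN, hNm, hN0⟩ := exists_measurable_superset_of_null (ae_iff.1 h)
  have h1 : ∫⁻ z in disk, N.indicator 1 z = 0 := by
    rw [lintegral_indicator_one hNm, hN0]
  have hNi : Measurable (N.indicator (1 : ℂ → ℝ≥0∞)) := measurable_one.indicator hNm
  rw [lintegral_disk_polar hNi, lintegral_eq_zero_iff'] at h1
  · have h2 := (ae_restrict_iff' measurableSet_Ioo).1 h1
    filter_upwards [h2] with r hr hr1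
    have h3 := hr hr1
    simp only [Pi.zero_apply, mul_eq_zero, ENNReal.ofReal_eq_zero, not_le.2 hr1.1, false_or] at h3
    rw [lintegral_eq_zero_iff (f := fun θ => N.indicator 1 (polarPt r θ))
      (hNi.comp (measurable_polarPt_right r))] at h3
    filter_upwards [h3] with θ hθ
    by_contra hP
    have : polarPt r θ ∈ N := hN hP
    simp [this] at hθ
  · refine (Measurable.mul measurable_id.ennreal_ofReal ?_).aemeasurable
    exact (hNi.comp measurable_polarPt).lintegral_prod_right'

/-! ### Singular integrals of powers of the distance -/

/-- Radial integration leaves `y ^ (d - 1 - β)` on `(0, R)`, with `d` the dimension. Needed for `d =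
2` (the disk) and for `d = 1` (the circles). -/
lemma lintegral_ball_norm_inv_rpow_lt_top {E : Type*} [NormedAddCommGroup E] [NormedSpace ℝ E]
    [MeasurableSpace E] [BorelSpace E] [FiniteDimensional ℝ E] [Nontrivial E] (μ : Measure E)
    [μ.IsAddHaarMeasure] {β : ℝ} (hβ : β < Module.finrank ℝ E) (R : ℝ) :
    ∫⁻ x in Metric.ball (0 : E) R, (‖x‖ₑ⁻¹) ^ β ∂μ < ⊤ := by
  have h1 : IntegrableOn (fun x : E => ‖x‖ ^ (-β)) (Metric.ball 0 R) μ := by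
    rw [integrableOn_fun_norm_addHaar μ (f := fun y => y ^ (-β))]
    rcases le_or_gt R 0 with hR | hR
    · simp [Ioo_eq_empty (not_lt.2 hR)]
    have hd : 1 ≤ Module.finrank ℝ E := Module.finrank_pos
    have h2 : IntegrableOn (fun y : ℝ => y ^ ((Module.finrank ℝ E : ℝ) - 1 - β)) (Ioo 0 R) := by
      rw [intervalIntegral.integrableOn_Ioo_rpow_iff hR]
      linarith
    refine h2.congr_fun (fun y hy => ?_) measurableSet_Ioo
    simp only [smul_eq_mul]
    rw [← Real.rpow_natCast, ← Real.rpow_add hy.1, Nat.cast_sub hd]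
    congr 1
    push_cast; ring
  have h2 := h1.hasFiniteIntegral
  refine lt_of_eq_of_lt (lintegral_congr_ae ?_) h2
  have : ∀ᵐ x ∂(μ.restrict (Metric.ball (0 : E) R)), x ≠ 0 :=
    ae_restrict_of_ae (by simp [ae_iff])
  filter_upwards [this] with x hx
  have hx' : 0 < ‖x‖ := norm_pos_iff.2 hx
  rw [← ofReal_norm, ← ofReal_norm, ← ENNReal.ofReal_inv_of_pos hx',
    ENNReal.ofReal_rpow_of_pos (by positivity), Real.norm_of_nonneg (by positivity),
    Real.inv_rpow hx'.le, Real.rpow_neg hx'.le]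

lemma lintegral_ball_sub {F : ℂ → ℝ≥0∞} (w : ℂ) (R : ℝ) :
    ∫⁻ ζ in Metric.ball w R, F (ζ - w) = ∫⁻ u in Metric.ball 0 R, F u := by
  have h : MeasurePreserving (fun ζ : ℂ => ζ - w) volume volume := measurePreserving_sub_right _ w
  rw [← h.setLIntegral_comp_preimage_emb (measurableEmbedding_subRight w) F]
  congr 2
  ext; simp [dist_eq_norm]

/-- The integrals `∫_D |ζ - z|^{-β}` are bounded for `z` in the closed unit disk, if `β < 2`. -/
lemma exists_lintegral_disk_inv_rpow_le {β : ℝ} (hβ : β < 2) :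
    ∃ C : ℝ≥0∞, C < ⊤ ∧ ∀ z : ℂ, ‖z‖ ≤ 1 → ∫⁻ ζ in disk, (‖ζ - z‖ₑ⁻¹) ^ β ≤ C := by
  refine ⟨_, lintegral_ball_norm_inv_rpow_lt_top (E := ℂ) volume
    (by simpa using hβ) 2, fun z hz => ?_⟩
  rw [← lintegral_ball_sub z]
  refine lintegral_mono_set fun ζ hζ => ?_
  rw [mem_disk] at hζ
  rw [Metric.mem_ball, dist_eq_norm]
  linarith [norm_sub_le ζ z]

/-- The weight `r` of polar coordinates about `ζ` cancels the singularity. -/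
lemma lintegral_ball_inv (ζ : ℂ) (ρ : ℝ) :
    ∫⁻ z in Metric.ball ζ ρ, ‖ζ - z‖ₑ⁻¹ ≤ ENNReal.ofReal (2 * Real.pi * ρ) := by
  have h := lintegral_ball_sub (F := fun u => ‖u‖ₑ⁻¹) ζ ρ
  simp_rw [enorm_sub_rev ζ]
  rw [h]
  have h2 := lintegral_polar_indicator (F := fun u : ℂ => ‖u‖ₑ⁻¹) (by fun_prop)
    (measurableSet_Iio (a := ρ))
  rw [show {z : ℂ | ‖z‖ ∈ Iio ρ} = Metric.ball 0 ρ by ext; simp, Ioi_inter_Iio] at h2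
  rw [h2]
  calc _ ≤ ∫⁻ r in Ioo 0 ρ, ENNReal.ofReal (2 * Real.pi) := by
        refine setLIntegral_mono measurable_const fun r hr => ?_
        have : ∀ θ, ‖polarPt r θ‖ₑ⁻¹ = (ENNReal.ofReal r)⁻¹ := fun θ => by
          rw [← ofReal_norm, norm_polarPt hr.1.le]
        simp only [this, lintegral_const, Measure.restrict_apply MeasurableSet.univ, univ_inter,
          Real.volume_Ioc, sub_zero]
        rw [← mul_assoc, ENNReal.mul_inv_cancel (by simpa using hr.1) ENNReal.ofReal_ne_top,
          one_mul]
    _ = _ := by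
        simp only [lintegral_const, Measure.restrict_apply MeasurableSet.univ, univ_inter,
          Real.volume_Ioo, sub_zero]
        rw [← ENNReal.ofReal_mul Real.two_pi_pos.le]

/-- Rotating by `-arg ζ` puts `ζ` on the real axis, and the imaginary part of the difference then no
longer involves `|ζ|`. This makes the circle estimates uniform in `ζ`. -/
lemma abs_sin_le_norm_sub_polarPt {r : ℝ} (hr : 0 ≤ r) (ζ : ℂ) (θ : ℝ) :
    r * |Real.sin (θ - ζ.arg)| ≤ ‖ζ - polarPt r θ‖ := by
  have h1 : (ζ - polarPt r θ) * Complex.exp (-(ζ.arg : ℂ) * Complex.I) =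
      ‖ζ‖ - r * Complex.exp (((θ - ζ.arg : ℝ) : ℂ) * Complex.I) := by
    have h0 := Complex.norm_mul_exp_arg_mul_I ζ
    generalize ζ.arg = a at h0 ⊢
    conv_lhs => rw [← h0]
    rw [sub_mul, mul_assoc, ← Complex.exp_add, polarPt, mul_assoc, ← Complex.exp_add]
    rw [← add_mul, add_neg_cancel, zero_mul, Complex.exp_zero, mul_one, ← add_mul]
    push_cast
    ring_nf
  have h2 : ‖ζ - polarPt r θ‖ =
      ‖(‖ζ‖ : ℂ) - r * Complex.exp (((θ - ζ.arg : ℝ) : ℂ) * Complex.I)‖ := by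
    rw [← h1, norm_mul, ← Complex.ofReal_neg, Complex.norm_exp_ofReal_mul_I, mul_one]
  rw [h2]
  refine le_trans (le_of_eq ?_) (Complex.abs_im_le_norm _)
  rw [Complex.sub_im, Complex.ofReal_im, Complex.im_ofReal_mul, Complex.exp_ofReal_mul_I_im,
    zero_sub, abs_neg, abs_mul, abs_of_nonneg hr]

/-- The integrals `∫ |ζ - r e^{iθ}|^{-γ} dθ` are bounded for `r ≥ 1/2`, if `γ < 1`. -/
lemma exists_lintegral_circle_inv_rpow_le {γ : ℝ} (hγ0 : 0 ≤ γ) (hγ : γ < 1) :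
    ∃ C : ℝ≥0∞, C < ⊤ ∧ ∀ r : ℝ, 1 / 2 ≤ r → ∀ ζ : ℂ,
      ∫⁻ θ in Ioc (0 : ℝ) (2 * Real.pi), (‖ζ - polarPt r θ‖ₑ⁻¹) ^ γ ≤ C := by
  set c : ℝ≥0∞ := ENNReal.ofReal Real.pi ^ γ
  set A := ∫⁻ x in Metric.ball (0 : ℝ) 2, (‖x‖ₑ⁻¹) ^ γ
  have hA : A < ⊤ := lintegral_ball_norm_inv_rpow_lt_top (E := ℝ) volume (by simpa using hγ) 2
  have hc : c < ⊤ := ENNReal.rpow_lt_top_of_nonneg hγ0 ENNReal.ofReal_ne_top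
  refine ⟨c * A + c * A, by finiteness, fun r hr ζ => ?_⟩
  set a := ζ.arg
  -- The factor `2` bounds `1 / r`. This majorant has period `π`, so a translate of it over the
  -- circle is two integrals over `(-π/2, π/2]`.
  set h : ℝ → ℝ≥0∞ := fun t => (2 * ‖Real.sin t‖ₑ⁻¹) ^ γ
  have hper : Function.Periodic h Real.pi := fun t => by simp [h, Real.sin_add_pi]
  have hper' : Function.Periodic (fun θ => h (θ - a)) Real.pi := fun t => by
    simp only; rw [show t + Real.pi - a = t - a + Real.pi by ring, hper]
  have hbase : ∫⁻ t in Ioc (-Real.pi / 2) (Real.pi / 2), h t ≤ c * A := by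
    rw [← lintegral_const_mul' _ _ hc.ne]
    refine (setLIntegral_mono' measurableSet_Ioc (g := fun x => c * (‖x‖ₑ⁻¹) ^ γ)
      fun t ht => ?_).trans ?_
    · simp only [h, c]
      rw [← ENNReal.mul_rpow_of_nonneg _ _ hγ0]
      refine ENNReal.rpow_le_rpow ?_ hγ0
      -- Jordan's inequality `|sin t| ≥ (2/π) |t|` reduces the bound to the power `|t|^{-γ}` on the
      -- line.
      have h1 := Real.mul_abs_le_abs_sin (x := t) (abs_le.2 ⟨by linarith [ht.1], ht.2⟩)
      have h2 : ENNReal.ofReal (2 / Real.pi) * ‖t‖ₑ ≤ ‖Real.sin t‖ₑ := by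
        rw [← ofReal_norm, ← ofReal_norm, ← ENNReal.ofReal_mul (by positivity)]
        exact ENNReal.ofReal_le_ofReal h1
      have h3 := ENNReal.inv_le_inv.2 h2
      rw [ENNReal.mul_inv (.inr enorm_ne_top) (.inl ENNReal.ofReal_ne_top),
        ← ENNReal.ofReal_inv_of_pos (by positivity)] at h3
      calc 2 * ‖Real.sin t‖ₑ⁻¹ ≤ 2 * (ENNReal.ofReal (2 / Real.pi)⁻¹ * ‖t‖ₑ⁻¹) := by gcongr
        _ = ENNReal.ofReal Real.pi * ‖t‖ₑ⁻¹ := by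
          rw [← mul_assoc, show (2 : ℝ≥0∞) = ENNReal.ofReal 2 by simp,
            ← ENNReal.ofReal_mul zero_le_two]
          congr 2
          field_simp
    · refine lintegral_mono_set fun t ht => ?_
      have := Real.pi_lt_four
      simp only [Metric.mem_ball, dist_zero_right, Real.norm_eq_abs, abs_lt]
      exact ⟨by linarith [ht.1], by linarith [ht.2]⟩
  have hshift : ∀ b : ℝ, ∫⁻ θ in Ioc b (b + Real.pi), h (θ - a) ≤ c * A := fun b => by
    rw [lintegral_Ioc_periodic Real.pi_pos hper' b (a - Real.pi / 2)]
    refine le_trans (le_of_eq ?_) hbase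
    have hmp : MeasurePreserving (fun θ : ℝ => θ - a) volume volume := measurePreserving_sub_right _ a
    rw [← hmp.setLIntegral_comp_preimage_emb (measurableEmbedding_subRight a) h]
    congr 2
    ext t
    simp only [mem_Ioc, mem_preimage]
    constructor <;> rintro ⟨h1, h2⟩ <;> constructor <;> linarith
  calc ∫⁻ θ in Ioc (0 : ℝ) (2 * Real.pi), (‖ζ - polarPt r θ‖ₑ⁻¹) ^ γ
      ≤ ∫⁻ θ in Ioc (0 : ℝ) (2 * Real.pi), h (θ - a) := by
        refine lintegral_mono fun θ => ENNReal.rpow_le_rpow ?_ hγ0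
        have h1 := abs_sin_le_norm_sub_polarPt (by linarith : 0 ≤ r) ζ θ
        have h2 : ENNReal.ofReal (1 / 2) * ‖Real.sin (θ - a)‖ₑ ≤ ‖ζ - polarPt r θ‖ₑ := by
          rw [← ofReal_norm, ← ofReal_norm, ← ENNReal.ofReal_mul (by positivity)]
          refine ENNReal.ofReal_le_ofReal (le_trans ?_ h1)
          exact mul_le_mul_of_nonneg_right hr (abs_nonneg _)
        have h3 := ENNReal.inv_le_inv.2 h2
        rw [ENNReal.mul_inv (.inr enorm_ne_top) (.inl ENNReal.ofReal_ne_top),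
          ← ENNReal.ofReal_inv_of_pos (by positivity)] at h3
        simpa using h3
    _ ≤ ∫⁻ θ in Ioc 0 (0 + Real.pi) ∪ Ioc Real.pi (Real.pi + Real.pi), h (θ - a) := by
        refine lintegral_mono_set fun t ht => ?_
        rcases le_or_gt t Real.pi with h | h
        · exact .inl ⟨ht.1, by linarith⟩
        · exact .inr ⟨h, by linarith [ht.2]⟩
    _ ≤ c * A + c * A := (lintegral_union_le _ _ _).trans (add_le_add (hshift 0) (hshift _))

/-! ### The absolute potential and its bounds on the disk and on circles. -/

/-- The potential `∬_D |g(ζ)| / |ζ - z|`. -/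
noncomputable def absPotential (g : ℂ → ℂ) (z : ℂ) : ℝ≥0∞ := ∫⁻ ζ in disk, ‖g ζ‖ₑ * ‖ζ - z‖ₑ⁻¹

/-- Changing `g` on a null set changes the potential at no point, so `g` may be replaced by a
measurable representative. True measurability is what can be restricted to a single circle, a null
set of the plane. -/
lemma measurable_absPotential {g : ℂ → ℂ} (hg : AEStronglyMeasurable g (volume.restrict disk)) :
    Measurable (absPotential g) := by
  have h : absPotential g = fun z => ∫⁻ ζ in disk, ‖hg.mk g ζ‖ₑ * ‖ζ - z‖ₑ⁻¹ := by
    funext z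
    refine lintegral_congr_ae ?_
    filter_upwards [hg.ae_eq_mk] with ζ hζ
    rw [hζ]
  rw [h]
  have hm : Measurable (hg.mk g) := hg.measurable_mk
  refine Measurable.lintegral_prod_right' (f := fun p : ℂ × ℂ => ‖hg.mk g p.2‖ₑ * ‖p.2 - p.1‖ₑ⁻¹) ?_
  fun_prop

/-- The identity `|1 - ζ̄ z|² - |ζ - z|² = (1 - |z|²)(1 - |ζ|²)`. It subordinates the conjugated
half of the kernel to the Cauchy kernel, up to the unit circle. -/
lemma norm_sub_le_norm_one_sub {z ζ : ℂ} (hz : ‖z‖ ≤ 1) (hζ : ‖ζ‖ ≤ 1) :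
    ‖ζ - z‖ ≤ ‖1 - (starRingEnd ℂ) ζ * z‖ := by
  have h1 : ‖ζ - z‖ ^ 2 ≤ ‖1 - (starRingEnd ℂ) ζ * z‖ ^ 2 := by
    have hz2 : ‖z‖ ^ 2 ≤ 1 := pow_le_one₀ (norm_nonneg _) hz
    have hζ2 : ‖ζ‖ ^ 2 ≤ 1 := pow_le_one₀ (norm_nonneg _) hζ
    rw [Complex.sq_norm, Complex.normSq_apply] at *
    rw [Complex.sq_norm, Complex.normSq_apply] at *
    simp only [Complex.sub_re, Complex.sub_im, Complex.mul_re, Complex.mul_im, Complex.conj_re,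
      Complex.conj_im, Complex.one_re, Complex.one_im] at *
    nlinarith [mul_nonneg (sub_nonneg.2 hz2) (sub_nonneg.2 hζ2)]
  exact (abs_le_of_sq_le_sq' h1 (norm_nonneg _)).2

lemma enorm_div_le (a b : ℂ) : ‖a / b‖ₑ ≤ ‖a‖ₑ * ‖b‖ₑ⁻¹ := by
  rcases eq_or_ne b 0 with rfl | hb
  · simp
  · rw [div_eq_mul_inv, enorm_mul, enorm_inv hb]

lemma inv_enorm_one_sub_le {z ζ : ℂ} (hz : ‖z‖ ≤ 1) (hζ : ‖ζ‖ ≤ 1) :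
    ‖1 - (starRingEnd ℂ) ζ * z‖ₑ⁻¹ ≤ ‖ζ - z‖ₑ⁻¹ := by
  refine ENNReal.inv_le_inv.2 ?_
  rw [← ofReal_norm, ← ofReal_norm]
  exact ENNReal.ofReal_le_ofReal (norm_sub_le_norm_one_sub hz hζ)

lemma enorm_le_one {z : ℂ} (hz : ‖z‖ ≤ 1) : ‖z‖ₑ ≤ 1 := by
  rw [← ofReal_norm]
  exact ENNReal.ofReal_le_one.2 hz

lemma enorm_kernelT_le (g : ℂ → ℂ) {z ζ : ℂ} (hz : ‖z‖ ≤ 1) (hζ : ‖ζ‖ ≤ 1) :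
    ‖kernelT g z ζ‖ₑ ≤ 2 * (‖g ζ‖ₑ * ‖ζ - z‖ₑ⁻¹) := by
  rw [two_mul]
  refine (enorm_add_le _ _).trans (add_le_add (enorm_div_le _ _) ((enorm_div_le _ _).trans ?_))
  rw [enorm_mul, RCLike.enorm_conj]
  calc ‖z‖ₑ * ‖g ζ‖ₑ * ‖1 - (starRingEnd ℂ) ζ * z‖ₑ⁻¹ ≤ 1 * ‖g ζ‖ₑ * ‖ζ - z‖ₑ⁻¹ := by
        gcongr ?_ * _ * ?_
        · exact enorm_le_one hz
        · exact inv_enorm_one_sub_le hz hζ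
    _ = _ := by rw [one_mul]

/-- The parameter map `π` covers circles as well as the disk: measurability almost everywhere in the
disk would say nothing about one circle. -/
lemma aestronglyMeasurable_kernelT_prod {X : Type*} [MeasurableSpace X] {μ : Measure X} [SFinite μ]
    {π : X → ℂ} (hπ : Measurable π) {g : ℂ → ℂ}
    (hg : AEStronglyMeasurable g (volume.restrict disk)) :
    AEStronglyMeasurable (fun p : X × ℂ => kernelT g (π p.1) p.2)
      (μ.prod (volume.restrict disk)) := by
  have hg2 : AEMeasurable (fun p : X × ℂ => g p.2) (μ.prod (volume.restrict disk)) :=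
    hg.comp_snd.aemeasurable
  have h1 : Measurable fun p : X × ℂ => p.2 - π p.1 := by fun_prop
  have h2 : Measurable fun p : X × ℂ => π p.1 := by fun_prop
  have hc : Measurable (starRingEnd ℂ) := Complex.continuous_conj.measurable
  have h3 : Measurable fun p : X × ℂ => 1 - (starRingEnd ℂ) p.2 * π p.1 :=
    measurable_const.sub ((hc.comp measurable_snd).mul h2)
  exact ((hg2.div h1.aemeasurable).add
    ((h2.aemeasurable.mul (hc.comp_aemeasurable hg2)).div h3.aemeasurable)).aestronglyMeasurable

lemma aestronglyMeasurable_kernelT {g : ℂ → ℂ}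
    (hg : AEStronglyMeasurable g (volume.restrict disk)) (z : ℂ) :
    AEStronglyMeasurable (kernelT g z) (volume.restrict disk) := by
  have hg2 := hg.aemeasurable
  have hc : Measurable (starRingEnd ℂ) := Complex.continuous_conj.measurable
  exact ((hg2.div (by fun_prop)).add (((hc.comp_aemeasurable hg2).const_mul z).div
    (measurable_const.sub (hc.mul_const z)).aemeasurable)).aestronglyMeasurable

lemma lintegral_enorm_kernelT_le (g : ℂ → ℂ) {z : ℂ} (hz : ‖z‖ ≤ 1) :
    ∫⁻ ζ in disk, ‖kernelT g z ζ‖ₑ ≤ 2 * absPotential g z := by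
  rw [absPotential, ← lintegral_const_mul' _ _ (by simp)]
  exact setLIntegral_mono' measurableSet_disk fun ζ hζ =>
    enorm_kernelT_le g hz (mem_disk.1 hζ).le

lemma definedT_of_absPotential_lt_top {g : ℂ → ℂ}
    (hg : AEStronglyMeasurable g (volume.restrict disk)) {z : ℂ} (hz : ‖z‖ ≤ 1)
    (h : absPotential g z < ⊤) : DefinedT g z :=
  ⟨aestronglyMeasurable_kernelT hg z, (lintegral_enorm_kernelT_le g hz).trans_lt
    (ENNReal.mul_lt_top (by simp) h)⟩

lemma enorm_neg_inv_pi : ‖-(1 / (Real.pi : ℂ))‖ₑ = ENNReal.ofReal (1 / Real.pi) := by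
  rw [enorm_neg, ← ofReal_norm]
  simp [abs_of_pos Real.pi_pos]

lemma enorm_opT_le (g : ℂ → ℂ) {z : ℂ} (hz : ‖z‖ ≤ 1) : ‖opT g z‖ₑ ≤ absPotential g z := by
  rw [opT, enorm_mul, enorm_neg_inv_pi]
  calc _ ≤ ENNReal.ofReal (1 / Real.pi) * (2 * absPotential g z) := by
        gcongr
        exact (enorm_integral_le_lintegral_enorm _).trans (lintegral_enorm_kernelT_le g hz)
    _ ≤ 1 * absPotential g z := by
        rw [← mul_assoc]
        gcongr
        rw [show (2 : ℝ≥0∞) = ENNReal.ofReal 2 by simp, ← ENNReal.ofReal_mul (by positivity),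
          ← ENNReal.ofReal_one]
        refine ENNReal.ofReal_le_ofReal ?_
        rw [one_div_mul_eq_div, div_le_one Real.pi_pos]
        exact Real.two_le_pi
    _ = _ := one_mul _

lemma kernelT_congr {g h : ℂ → ℂ} (hgh : ∀ᵐ z ∂(volume.restrict disk), g z = h z) (z : ℂ) :
    kernelT g z =ᵐ[volume.restrict disk] kernelT h z := by
  filter_upwards [hgh] with ζ hζ
  rw [kernelT, kernelT, hζ]

lemma opT_congr {g h : ℂ → ℂ} (hgh : ∀ᵐ z ∂(volume.restrict disk), g z = h z) :
    opT g = opT h := by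
  funext z
  rw [opT, opT, integral_congr_ae (kernelT_congr hgh z)]

/-- Hölder's inequality, for the splitting `|ζ - z|⁻¹ = |ζ - z|^{-γ/s} |ζ - z|^{-(3/2)/s'}`,
`γ = (3 - s) / 2`. -/
lemma exists_absPotential_rpow_le {s : ℝ} (hs1 : 1 < s) (hs2 : s < 2) :
    ∃ C : ℝ≥0∞, C < ⊤ ∧ ∀ g : ℂ → ℂ, AEStronglyMeasurable g (volume.restrict disk) →
      ∀ z : ℂ, ‖z‖ ≤ 1 → absPotential g z ^ s ≤
        C * ∫⁻ ζ in disk, ‖g ζ‖ₑ ^ s * (‖ζ - z‖ₑ⁻¹) ^ ((3 - s) / 2) := by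
  obtain ⟨C₀, hC₀, hC⟩ := exists_lintegral_disk_inv_rpow_le (β := 3 / 2) (by norm_num)
  have hs0 : 0 < s := by linarith
  have hs10 : 0 < s - 1 := by linarith
  refine ⟨C₀ ^ (s - 1), ENNReal.rpow_lt_top_of_nonneg hs10.le hC₀.ne, fun g hg z hz => ?_⟩
  -- After raising to the powers `s` and `s/(s-1)`, the two factors of the kernel have the exponents
  -- `(3 - s)/2 < 1`, integrable even along circles, and `3/2 < 2`, integrable over the disk.
  set a := (3 - s) / 2 / s with ha
  have ha0 : 0 ≤ a := by apply div_nonneg <;> linarith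
  have hb : 1 - a = 3 / 2 / (s / (s - 1)) := by rw [ha]; field_simp; ring
  have hb0 : 0 ≤ 1 - a := by rw [hb]; positivity
  have hconj : s.HolderConjugate (s / (s - 1)) := Real.HolderConjugate.conjExponent hs1
  have hgm : AEMeasurable (fun ζ => ‖g ζ‖ₑ) (volume.restrict disk) := hg.enorm
  have key := ENNReal.lintegral_mul_le_Lp_mul_Lq (volume.restrict disk) hconj
    (f := fun ζ => ‖g ζ‖ₑ * (‖ζ - z‖ₑ⁻¹) ^ a) (g := fun ζ => (‖ζ - z‖ₑ⁻¹) ^ (1 - a))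
    (hgm.mul (by fun_prop)) (by fun_prop)
  have e1 : ∫⁻ ζ in disk, ((fun ζ => ‖g ζ‖ₑ * (‖ζ - z‖ₑ⁻¹) ^ a) *
      fun ζ => (‖ζ - z‖ₑ⁻¹) ^ (1 - a)) ζ = absPotential g z := by
    refine lintegral_congr fun ζ => ?_
    simp only [Pi.mul_apply]
    rw [mul_assoc, ← ENNReal.rpow_add_of_nonneg _ _ ha0 hb0, add_sub_cancel, ENNReal.rpow_one]
  have e2 : ∫⁻ ζ in disk, (‖g ζ‖ₑ * (‖ζ - z‖ₑ⁻¹) ^ a) ^ s =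
      ∫⁻ ζ in disk, ‖g ζ‖ₑ ^ s * (‖ζ - z‖ₑ⁻¹) ^ ((3 - s) / 2) := by
    refine lintegral_congr fun ζ => ?_
    rw [ENNReal.mul_rpow_of_nonneg _ _ hs0.le, ← ENNReal.rpow_mul, ha, div_mul_cancel₀ _ hs0.ne']
  have e3 : ∫⁻ ζ in disk, ((‖ζ - z‖ₑ⁻¹) ^ (1 - a)) ^ (s / (s - 1)) ≤ C₀ := by
    refine le_of_eq_of_le (lintegral_congr fun ζ => ?_) (hC z hz)
    rw [← ENNReal.rpow_mul, hb, div_mul_cancel₀ _ (by positivity)]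
  rw [e1, e2] at key
  calc absPotential g z ^ s ≤ ((∫⁻ ζ in disk, ‖g ζ‖ₑ ^ s * (‖ζ - z‖ₑ⁻¹) ^ ((3 - s) / 2)) ^ (1 / s) *
        C₀ ^ (1 / (s / (s - 1)))) ^ s := by
        refine ENNReal.rpow_le_rpow (key.trans ?_) hs0.le
        gcongr
    _ = _ := by
        rw [ENNReal.mul_rpow_of_nonneg _ _ hs0.le, ← ENNReal.rpow_mul, ← ENNReal.rpow_mul,
          one_div_mul_cancel hs0.ne', ENNReal.rpow_one, mul_comm]
        congr 2
        field_simp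

/-- Tonelli: the remaining kernel is integrated over `x` first, for fixed `ζ`. One statement serves
the disk and the circles; only the bound `K` differs. -/
lemma lintegral_absPotential_rpow_le {s : ℝ} {C K : ℝ≥0∞} (hC : C < ⊤) {g : ℂ → ℂ}
    (hg : AEStronglyMeasurable g (volume.restrict disk))
    (h : ∀ z : ℂ, ‖z‖ ≤ 1 → absPotential g z ^ s ≤
        C * ∫⁻ ζ in disk, ‖g ζ‖ₑ ^ s * (‖ζ - z‖ₑ⁻¹) ^ ((3 - s) / 2))
    {X : Type*} [MeasurableSpace X] {μ : Measure X} [SFinite μ]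
    {π : X → ℂ} (hπ : Measurable π) (hπ1 : ∀ᵐ x ∂μ, ‖π x‖ ≤ 1)
    (hK : ∀ ζ ∈ disk, ∫⁻ x, (‖ζ - π x‖ₑ⁻¹) ^ ((3 - s) / 2) ∂μ ≤ K) :
    ∫⁻ x, absPotential g (π x) ^ s ∂μ ≤ C * (K * ∫⁻ ζ in disk, ‖g ζ‖ₑ ^ s) := by
  have hg2 : AEMeasurable (fun p : X × ℂ => ‖g p.2‖ₑ) (μ.prod (volume.restrict disk)) :=
    hg.comp_snd.enorm
  have h1 : Measurable fun p : X × ℂ => p.2 - π p.1 := by fun_prop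
  calc ∫⁻ x, absPotential g (π x) ^ s ∂μ
      ≤ ∫⁻ x, (C * ∫⁻ ζ in disk, ‖g ζ‖ₑ ^ s * (‖ζ - π x‖ₑ⁻¹) ^ ((3 - s) / 2)) ∂μ := by
        refine lintegral_mono_ae ?_
        filter_upwards [hπ1] with x hx using h _ hx
    _ = C * ∫⁻ ζ in disk, (∫⁻ x, ‖g ζ‖ₑ ^ s * (‖ζ - π x‖ₑ⁻¹) ^ ((3 - s) / 2) ∂μ) := by
        rw [lintegral_const_mul' _ _ hC.ne, lintegral_lintegral_swap]
        exact (hg2.pow_const s).mul (h1.enorm.inv.pow_const _).aemeasurable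
    _ ≤ C * ∫⁻ ζ in disk, K * ‖g ζ‖ₑ ^ s := by
        gcongr C * ?_
        refine setLIntegral_mono' measurableSet_disk fun ζ hζ => ?_
        rw [lintegral_const_mul _ (by fun_prop), mul_comm]
        gcongr
        exact hK ζ hζ
    _ = _ := by
        rw [lintegral_const_mul'']
        exact hg.enorm.pow_const s

/-- The potential operator is bounded on `L^s(D)`. -/
lemma exists_lintegral_disk_absPotential_le {s : ℝ} (hs1 : 1 < s) (hs2 : s < 2) :
    ∃ C : ℝ≥0∞, C < ⊤ ∧ ∀ g : ℂ → ℂ, AEStronglyMeasurable g (volume.restrict disk) →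
      ∫⁻ z in disk, absPotential g z ^ s ≤ C * ∫⁻ ζ in disk, ‖g ζ‖ₑ ^ s := by
  obtain ⟨C, hC, h⟩ := exists_absPotential_rpow_le hs1 hs2
  obtain ⟨K, hK, hK'⟩ := exists_lintegral_disk_inv_rpow_le (β := (3 - s) / 2) (by linarith)
  refine ⟨C * K, by finiteness, fun g hg => ?_⟩
  rw [mul_assoc]
  refine lintegral_absPotential_rpow_le hC hg (h g hg) measurable_id ?_ fun ζ hζ => ?_
  · filter_upwards [ae_restrict_mem measurableSet_disk] with z hz using (mem_disk.1 hz).le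
  · simp_rw [enorm_sub_rev ζ]
    exact hK' ζ (mem_disk.1 hζ).le

/-- The potential operator is bounded from `L^s(D)` to `L^s` of the circles of radius at least
`1/2`, uniformly in the radius. -/
lemma exists_lintegral_circle_absPotential_rpow_le {s : ℝ} (hs1 : 1 < s) (hs2 : s < 2) :
    ∃ C : ℝ≥0∞, C < ⊤ ∧ ∀ g : ℂ → ℂ, AEStronglyMeasurable g (volume.restrict disk) →
      ∀ r ∈ Icc (1 / 2 : ℝ) 1,
      ∫⁻ θ in Ioc (0 : ℝ) (2 * Real.pi), absPotential g (polarPt r θ) ^ s ≤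
        C * ∫⁻ ζ in disk, ‖g ζ‖ₑ ^ s := by
  obtain ⟨C, hC, h⟩ := exists_absPotential_rpow_le hs1 hs2
  obtain ⟨K, hK, hK'⟩ := exists_lintegral_circle_inv_rpow_le (γ := (3 - s) / 2) (by linarith)
    (by linarith)
  refine ⟨C * K, by finiteness, fun g hg r hr => ?_⟩
  rw [mul_assoc]
  refine lintegral_absPotential_rpow_le hC hg (h g hg) (measurable_polarPt_right r) ?_
    fun ζ _ => hK' r hr.1 ζ
  filter_upwards with θ
  rw [norm_polarPt (by linarith [hr.1])]
  exact hr.2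

/-- Hölder against the constant `1` on a circle of finite angular length. -/
lemma exists_lintegral_circle_absPotential_le {s : ℝ} (hs1 : 1 < s) (hs2 : s < 2) :
    ∃ C : ℝ≥0∞, C < ⊤ ∧ ∀ g : ℂ → ℂ, AEStronglyMeasurable g (volume.restrict disk) →
      ∀ r ∈ Icc (1 / 2 : ℝ) 1,
      ∫⁻ θ in Ioc (0 : ℝ) (2 * Real.pi), absPotential g (polarPt r θ) ≤
        C * (∫⁻ ζ in disk, ‖g ζ‖ₑ ^ s) ^ (1 / s) := by
  obtain ⟨C, hC, h⟩ := exists_lintegral_circle_absPotential_rpow_le hs1 hs2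
  have hs0 : 0 < s := by linarith
  have hs10 : 0 < s - 1 := by linarith
  have hconj : s.HolderConjugate (s / (s - 1)) := Real.HolderConjugate.conjExponent hs1
  set K : ℝ≥0∞ := ENNReal.ofReal (2 * Real.pi) ^ (1 / (s / (s - 1))) with hKdef
  have hK : K < ⊤ := ENNReal.rpow_lt_top_of_nonneg (by positivity) ENNReal.ofReal_ne_top
  have hC' : C ^ (1 / s) < ⊤ := ENNReal.rpow_lt_top_of_nonneg (by positivity) hC.ne
  refine ⟨C ^ (1 / s) * K, ENNReal.mul_lt_top hC' hK, fun g hg r hr => ?_⟩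
  have hm : Measurable fun θ => absPotential g (polarPt r θ) :=
    (measurable_absPotential hg).comp (measurable_polarPt_right r)
  have key := ENNReal.lintegral_mul_le_Lp_mul_Lq (volume.restrict (Ioc (0 : ℝ) (2 * Real.pi))) hconj
    (g := fun _ => 1) hm.aemeasurable aemeasurable_const
  simp only [Pi.mul_apply, mul_one, ENNReal.one_rpow, lintegral_const, one_mul,
    Measure.restrict_apply MeasurableSet.univ, univ_inter, Real.volume_Ioc, sub_zero] at key
  calc _ ≤ _ := key
    _ ≤ (C * ∫⁻ ζ in disk, ‖g ζ‖ₑ ^ s) ^ (1 / s) * K := by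
        gcongr
        exact h g hg r hr
    _ = _ := by
        rw [ENNReal.mul_rpow_of_nonneg _ _ (by positivity)]
        ring

lemma aestronglyMeasurable_opT_comp {X : Type*} [MeasurableSpace X] {μ : Measure X} [SFinite μ]
    {π : X → ℂ} (hπ : Measurable π) {g : ℂ → ℂ}
    (hg : AEStronglyMeasurable g (volume.restrict disk)) :
    AEStronglyMeasurable (fun x => opT g (π x)) μ :=
  (aestronglyMeasurable_kernelT_prod hπ hg).integral_prod_right'.const_mul _

lemma lintegral_lt_top_of_rpow {X : Type*} [MeasurableSpace X] {μ : Measure X}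
    [IsFiniteMeasure μ] {s : ℝ} (hs : 1 ≤ s) {F : X → ℝ≥0∞} (h : ∫⁻ x, F x ^ s ∂μ < ⊤) :
    ∫⁻ x, F x ∂μ < ⊤ := by
  calc ∫⁻ x, F x ∂μ ≤ ∫⁻ x, (1 + F x ^ s) ∂μ := by
        refine lintegral_mono fun x => ?_
        rcases le_total (F x) 1 with hx | hx
        · exact hx.trans le_self_add
        · calc F x = F x ^ (1 : ℝ) := (ENNReal.rpow_one _).symm
            _ ≤ F x ^ s := ENNReal.rpow_le_rpow_of_exponent_le hx hs
            _ ≤ _ := le_add_self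
    _ = ∫⁻ x, 1 ∂μ + ∫⁻ x, F x ^ s ∂μ := lintegral_add_left measurable_const _
    _ < ⊤ := ENNReal.add_lt_top.2 ⟨by simp, h⟩

lemma integrableOn_disk_of_rpow {s : ℝ} (hs : 1 ≤ s) {g : ℂ → ℂ}
    (hg : AEStronglyMeasurable g (volume.restrict disk)) (hgs : ∫⁻ z in disk, ‖g z‖ₑ ^ s < ⊤) :
    IntegrableOn g disk :=
  ⟨hg, lintegral_lt_top_of_rpow hs hgs⟩

/-- For the disk `g ∈ L¹` suffices, since `|ζ - z|⁻¹` is integrable in `z` uniformly in `ζ`. -/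
lemma lintegral_absPotential_lt_top {g : ℂ → ℂ} (hg : IntegrableOn g disk) :
    ∫⁻ z in disk, absPotential g z < ⊤ := by
  obtain ⟨K, hK, hK'⟩ := exists_lintegral_disk_inv_rpow_le (β := 1) (by norm_num)
  have hg2 : AEMeasurable (fun p : ℂ × ℂ => ‖g p.2‖ₑ)
      ((volume.restrict disk).prod (volume.restrict disk)) := hg.1.comp_snd.enorm
  have h1 : Measurable fun p : ℂ × ℂ => p.2 - p.1 := by fun_prop
  calc ∫⁻ z in disk, absPotential g z = ∫⁻ ζ in disk, ∫⁻ z in disk, ‖g ζ‖ₑ * ‖ζ - z‖ₑ⁻¹ := by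
        unfold absPotential
        rw [lintegral_lintegral_swap]
        exact hg2.mul h1.enorm.inv.aemeasurable
    _ ≤ ∫⁻ ζ in disk, K * ‖g ζ‖ₑ := by
        refine setLIntegral_mono' measurableSet_disk fun ζ hζ => ?_
        rw [lintegral_const_mul _ (by fun_prop), mul_comm]
        gcongr
        simp_rw [enorm_sub_rev ζ]
        simpa using hK' ζ (mem_disk.1 hζ).le
    _ = K * ∫⁻ ζ in disk, ‖g ζ‖ₑ := lintegral_const_mul' _ _ hK.ne
    _ < ⊤ := ENNReal.mul_lt_top hK hg.2

lemma ae_definedT {g : ℂ → ℂ} (hg : IntegrableOn g disk) :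
    ∀ᵐ z ∂(volume.restrict disk), DefinedT g z := by
  filter_upwards [ae_lt_top (measurable_absPotential hg.1) (lintegral_absPotential_lt_top hg).ne,
    ae_restrict_mem measurableSet_disk] with z hz hzD
  exact definedT_of_absPotential_lt_top hg.1 (mem_disk.1 hzD).le hz

lemma lintegral_opT_rpow_lt_top {s : ℝ} (hs1 : 1 < s) (hs2 : s < 2) {g : ℂ → ℂ}
    (hg : AEStronglyMeasurable g (volume.restrict disk)) (hgs : ∫⁻ z in disk, ‖g z‖ₑ ^ s < ⊤) :
    ∫⁻ z in disk, ‖opT g z‖ₑ ^ s < ⊤ := by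
  obtain ⟨C, hC, h⟩ := exists_lintegral_disk_absPotential_le hs1 hs2
  refine lt_of_le_of_lt ?_ ((h g hg).trans_lt (ENNReal.mul_lt_top hC hgs))
  refine setLIntegral_mono' measurableSet_disk fun z hz => ENNReal.rpow_le_rpow ?_ (by linarith)
  exact enorm_opT_le g (mem_disk.1 hz).le

lemma norm_polarPt_le_one {r : ℝ} (hr : r ∈ Icc (1 / 2 : ℝ) 1) (θ : ℝ) : ‖polarPt r θ‖ ≤ 1 := by
  rw [norm_polarPt (by linarith [hr.1])]; exact hr.2

lemma lintegral_circle_absPotential_lt_top {s : ℝ} (hs1 : 1 < s) (hs2 : s < 2) {g : ℂ → ℂ}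
    (hg : AEStronglyMeasurable g (volume.restrict disk)) (hgs : ∫⁻ z in disk, ‖g z‖ₑ ^ s < ⊤)
    {r : ℝ} (hr : r ∈ Icc (1 / 2 : ℝ) 1) :
    ∫⁻ θ in Ioc (0 : ℝ) (2 * Real.pi), absPotential g (polarPt r θ) < ⊤ := by
  obtain ⟨C, hC, h⟩ := exists_lintegral_circle_absPotential_le hs1 hs2
  exact (h g hg r hr).trans_lt (ENNReal.mul_lt_top hC
    (ENNReal.rpow_lt_top_of_nonneg (by positivity) hgs.ne))

/-- Finiteness of the potential in `L¹` of the circle. The conclusion concerns each circle, not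
almost every one; this is what gives precise functions a boundary value without exceptional radii.
-/
lemma ae_circle_definedT {s : ℝ} (hs1 : 1 < s) (hs2 : s < 2) {g : ℂ → ℂ}
    (hg : AEStronglyMeasurable g (volume.restrict disk)) (hgs : ∫⁻ z in disk, ‖g z‖ₑ ^ s < ⊤)
    {r : ℝ} (hr : r ∈ Icc (1 / 2 : ℝ) 1) :
    ∀ᵐ θ ∂(volume.restrict (Ioc (0 : ℝ) (2 * Real.pi))), DefinedT g (polarPt r θ) := by
  filter_upwards [ae_lt_top ((measurable_absPotential hg).comp (measurable_polarPt_right r))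
    (lintegral_circle_absPotential_lt_top hs1 hs2 hg hgs hr).ne] with θ hθ
  exact definedT_of_absPotential_lt_top hg (norm_polarPt_le_one hr θ) hθ

lemma integrableOn_opT_polarPt {s : ℝ} (hs1 : 1 < s) (hs2 : s < 2) {g : ℂ → ℂ}
    (hg : AEStronglyMeasurable g (volume.restrict disk)) (hgs : ∫⁻ z in disk, ‖g z‖ₑ ^ s < ⊤)
    {r : ℝ} (hr : r ∈ Icc (1 / 2 : ℝ) 1) :
    IntegrableOn (fun θ => opT g (polarPt r θ)) (Ioc (0 : ℝ) (2 * Real.pi)) := by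
  refine ⟨aestronglyMeasurable_opT_comp (measurable_polarPt_right r) hg, ?_⟩
  refine lt_of_le_of_lt ?_ (lintegral_circle_absPotential_lt_top hs1 hs2 hg hgs hr)
  exact lintegral_mono fun θ => enorm_opT_le g (norm_polarPt_le_one hr θ)

/-! ### Boundary values -/

lemma enorm_div_sub_div_le (a : ℂ) {u v : ℂ} (hu : u ≠ 0) (hv : v ≠ 0) :
    ‖a / u - a / v‖ₑ ≤ ‖a‖ₑ * ‖v - u‖ₑ * (‖u‖ₑ⁻¹ * ‖v‖ₑ⁻¹) := by
  have : a / u - a / v = a * (v - u) * (u⁻¹ * v⁻¹) := by field_simp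
  rw [this, enorm_mul, enorm_mul, enorm_mul, enorm_inv hu, enorm_inv hv]

/-- In both halves of the kernel the difference factors out `z - z'` over the product of the two
denominators, and the conjugated denominators dominate the others. -/
lemma enorm_kernelT_sub_le (g : ℂ → ℂ) {z z' ζ : ℂ} (hz : ‖z‖ ≤ 1) (hz' : ‖z'‖ ≤ 1)
    (hζ : ‖ζ‖ ≤ 1) (h : ζ ≠ z) (h' : ζ ≠ z') :
    ‖kernelT g z ζ - kernelT g z' ζ‖ₑ ≤
      2 * (‖g ζ‖ₑ * ‖z - z'‖ₑ * (‖ζ - z‖ₑ⁻¹ * ‖ζ - z'‖ₑ⁻¹)) := by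
  have hne : ∀ {z : ℂ}, ‖z‖ ≤ 1 → ζ ≠ z → 1 - (starRingEnd ℂ) ζ * z ≠ 0 := fun hz h => by
    have h1 := norm_sub_le_norm_one_sub hz hζ
    have h2 : 0 < ‖ζ - _‖ := norm_pos_iff.2 (sub_ne_zero.2 h)
    exact norm_pos_iff.1 (h2.trans_le h1)
  have e : kernelT g z ζ - kernelT g z' ζ = (g ζ / (ζ - z) - g ζ / (ζ - z')) +
      (starRingEnd ℂ) (g ζ) * (z - z') *
        ((1 - (starRingEnd ℂ) ζ * z)⁻¹ * (1 - (starRingEnd ℂ) ζ * z')⁻¹) := by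
    have h1 := hne hz h
    have h2 := hne hz' h'
    rw [kernelT, kernelT, add_sub_add_comm]
    congr 1
    rw [div_sub_div _ _ h1 h2, div_eq_mul_inv, mul_inv]
    ring
  rw [e, two_mul]
  refine (enorm_add_le _ _).trans (add_le_add ?_ ?_)
  · refine (enorm_div_sub_div_le _ (sub_ne_zero.2 h) (sub_ne_zero.2 h')).trans (le_of_eq ?_)
    rw [show ζ - z' - (ζ - z) = z - z' by ring]
  · rw [enorm_mul, enorm_mul, enorm_mul, enorm_inv (hne hz h), enorm_inv (hne hz' h'),
      RCLike.enorm_conj]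
    gcongr
    · rw [← ofReal_norm, ← ofReal_norm]
      exact ENNReal.ofReal_le_ofReal (norm_sub_le_norm_one_sub hz hζ)
    · rw [← ofReal_norm, ← ofReal_norm]
      exact ENNReal.ofReal_le_ofReal (norm_sub_le_norm_one_sub hz' hζ)

lemma inv_enorm_sub_le {δ : ℝ} (hδ : 0 < δ) {z ζ : ℂ} (h : ‖ζ‖ + δ ≤ ‖z‖) :
    ‖ζ - z‖ₑ⁻¹ ≤ ENNReal.ofReal δ⁻¹ := by
  rw [ENNReal.ofReal_inv_of_pos hδ, ← ofReal_norm]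
  refine ENNReal.inv_le_inv.2 (ENNReal.ofReal_le_ofReal ?_)
  rw [norm_sub_rev]
  linarith [norm_sub_norm_le z ζ]

/-- The part of `g` on the annulus of width `δ` next to the unit circle. -/
noncomputable def annulusPart (δ : ℝ) (g : ℂ → ℂ) : ℂ → ℂ := {ζ : ℂ | 1 - δ ≤ ‖ζ‖}.indicator g

lemma measurableSet_annulus (δ : ℝ) : MeasurableSet {ζ : ℂ | 1 - δ ≤ ‖ζ‖} :=
  measurableSet_le measurable_const measurable_norm

/-- Dominated convergence: a point of the open disk leaves the annulus as soon as `δ < 1 - |z|`. -/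
lemma tendsto_lintegral_annulusPart {s : ℝ} (hs : 0 < s) {g : ℂ → ℂ}
    (hg : AEStronglyMeasurable g (volume.restrict disk)) (hgs : ∫⁻ z in disk, ‖g z‖ₑ ^ s < ⊤) :
    Tendsto (fun δ => ∫⁻ z in disk, ‖annulusPart δ g z‖ₑ ^ s) (𝓝[>] 0) (𝓝 0) := by
  have h0 : (0 : ℝ≥0∞) = ∫⁻ z in disk, 0 := by simp
  rw [h0]
  refine tendsto_lintegral_filter_of_dominated_convergence' (fun z => ‖g z‖ₑ ^ s) ?_ ?_ hgs.ne ?_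
  · filter_upwards with δ
    exact ((hg.indicator (measurableSet_annulus δ)).enorm).pow_const s
  · filter_upwards with δ
    filter_upwards with z
    refine ENNReal.rpow_le_rpow ?_ hs.le
    exact enorm_indicator_le_enorm_self _ _
  · filter_upwards [ae_restrict_mem measurableSet_disk] with z hz
    rw [mem_disk] at hz
    refine tendsto_const_nhds.congr' ?_
    have : Ioo (0 : ℝ) (1 - ‖z‖) ∈ 𝓝[>] (0 : ℝ) := Ioo_mem_nhdsGT (by linarith)
    filter_upwards [this] with δ hδ
    rw [annulusPart, indicator_of_notMem, enorm_zero, ENNReal.zero_rpow_of_pos hs]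
    simp only [mem_ofPred_eq, not_le]
    linarith [hδ.2]

/-- For `ζ` in the annulus the two kernels are bounded separately. Otherwise `ζ` has distance at
least `δ/2` from `z` and `z'`, and the kernel is Lipschitz there. -/
lemma enorm_kernelT_sub_le_annulus (g : ℂ → ℂ) {δ : ℝ} (hδ : 0 < δ) {z z' ζ : ℂ} (hz : ‖z‖ ≤ 1)
    (hz' : ‖z'‖ ≤ 1) (hzδ : 1 - δ / 2 ≤ ‖z‖) (hzδ' : 1 - δ / 2 ≤ ‖z'‖) (hζ : ‖ζ‖ < 1) :
    ‖kernelT g z ζ - kernelT g z' ζ‖ₑ ≤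
      2 * (‖annulusPart δ g ζ‖ₑ * ‖ζ - z‖ₑ⁻¹) + 2 * (‖annulusPart δ g ζ‖ₑ * ‖ζ - z'‖ₑ⁻¹) +
      2 * (‖g ζ‖ₑ * ‖z - z'‖ₑ * (ENNReal.ofReal (δ / 2)⁻¹ * ENNReal.ofReal (δ / 2)⁻¹)) := by
  by_cases h : 1 - δ ≤ ‖ζ‖
  · rw [annulusPart, indicator_of_mem (by exact h)]
    exact (enorm_sub_le.trans (add_le_add (enorm_kernelT_le g hz hζ.le)
      (enorm_kernelT_le g hz' hζ.le))).trans le_self_add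
  · rw [not_le] at h
    refine le_trans ?_ le_add_self
    refine (enorm_kernelT_sub_le g hz hz' hζ.le ?_ ?_).trans ?_
    · rintro rfl; linarith
    · rintro rfl; linarith
    · gcongr 2 * (_ * (?_ * ?_))
      · exact inv_enorm_sub_le (by positivity) (by linarith)
      · exact inv_enorm_sub_le (by positivity) (by linarith)

lemma enorm_opT_sub_le {g : ℂ → ℂ} (hg : AEStronglyMeasurable g (volume.restrict disk))
    {δ : ℝ} (hδ : 0 < δ) {z z' : ℂ} (hz : ‖z‖ ≤ 1)
    (hz' : ‖z'‖ ≤ 1) (hzδ : 1 - δ / 2 ≤ ‖z‖) (hzδ' : 1 - δ / 2 ≤ ‖z'‖)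
    (hd : DefinedT g z) (hd' : DefinedT g z') :
    ‖opT g z - opT g z'‖ₑ ≤
      2 * absPotential (annulusPart δ g) z + 2 * absPotential (annulusPart δ g) z' +
      ‖z - z'‖ₑ * (2 * (ENNReal.ofReal (δ / 2)⁻¹ * ENNReal.ofReal (δ / 2)⁻¹) *
        ∫⁻ ζ in disk, ‖g ζ‖ₑ) := by
  have hga : AEMeasurable (fun ζ => ‖annulusPart δ g ζ‖ₑ) (volume.restrict disk) :=
    (hg.indicator (measurableSet_annulus δ)).enorm
  have hm : ∀ z, AEMeasurable (fun ζ => ‖annulusPart δ g ζ‖ₑ * ‖ζ - z‖ₑ⁻¹)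
      (volume.restrict disk) := fun z => hga.mul (by fun_prop)
  rw [opT, opT, ← mul_sub, ← integral_sub hd hd', enorm_mul, enorm_neg_inv_pi]
  have h1 : ENNReal.ofReal (1 / Real.pi) ≤ 1 := by
    rw [ENNReal.ofReal_le_one, div_le_one Real.pi_pos]
    linarith [Real.two_le_pi]
  refine (mul_le_of_le_one_left' h1).trans ((enorm_integral_le_lintegral_enorm _).trans ?_)
  refine (setLIntegral_mono' measurableSet_disk fun ζ hζ =>
    enorm_kernelT_sub_le_annulus g hδ hz hz' hzδ hzδ' (mem_disk.1 hζ)).trans (le_of_eq ?_)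
  rw [lintegral_add_right' _ (((hg.enorm.mul_const _).mul_const _).const_mul 2),
    lintegral_add_right' _ ((hm z').const_mul 2), lintegral_const_mul'' _ (hm z),
    lintegral_const_mul'' _ (hm z'), absPotential, absPotential]
  congr 1
  have : ∀ ζ, 2 * (‖g ζ‖ₑ * ‖z - z'‖ₑ * (ENNReal.ofReal (δ / 2)⁻¹ * ENNReal.ofReal (δ / 2)⁻¹)) =
      (‖z - z'‖ₑ * (2 * (ENNReal.ofReal (δ / 2)⁻¹ * ENNReal.ofReal (δ / 2)⁻¹))) * ‖g ζ‖ₑ :=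
    fun ζ => by ring
  simp_rw [this]
  rw [lintegral_const_mul'' _ hg.enorm, mul_assoc]

lemma enorm_polarPt_sub_one {r : ℝ} (hr : r ≤ 1) (θ : ℝ) :
    ‖polarPt r θ - polarPt 1 θ‖ₑ = ENNReal.ofReal (1 - r) := by
  rw [← ofReal_norm, polarPt, polarPt, ← sub_mul, norm_mul, Complex.norm_exp_ofReal_mul_I, mul_one,
    ← Complex.ofReal_sub, Complex.norm_real, Real.norm_eq_abs, abs_sub_comm,
    abs_of_nonneg (by linarith)]

/-- `T̃ g` on the circles of radius `r ↗ 1` converges in `L¹` to `T̃ g` on the unit circle. -/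
lemma tendsto_lintegral_opT_sub {s : ℝ} (hs1 : 1 < s) (hs2 : s < 2) {g : ℂ → ℂ}
    (hg : AEStronglyMeasurable g (volume.restrict disk)) (hgs : ∫⁻ z in disk, ‖g z‖ₑ ^ s < ⊤) :
    Tendsto (fun r => ∫⁻ θ in Ioc (0 : ℝ) (2 * Real.pi), ‖opT g (polarPt r θ) -
      opT g (polarPt 1 θ)‖ₑ) (𝓝[<] 1) (𝓝 0) := by
  obtain ⟨C, hC, h⟩ := exists_lintegral_circle_absPotential_le hs1 hs2
  have hs0 : 0 < s := by linarith
  rw [ENNReal.tendsto_nhds_zero]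
  intro ε hε
  have h1 : Tendsto (fun δ => 4 * (C * (∫⁻ z in disk, ‖annulusPart δ g z‖ₑ ^ s) ^ (1 / s)))
      (𝓝[>] 0) (𝓝 (4 * (C * 0 ^ (1 / s)))) := by
    refine ENNReal.Tendsto.const_mul (ENNReal.Tendsto.const_mul ?_ (.inr hC.ne)) (.inr (by simp))
    exact (tendsto_lintegral_annulusPart hs0 hg hgs).ennrpow_const _
  rw [ENNReal.zero_rpow_of_pos (by positivity), mul_zero, mul_zero, ENNReal.tendsto_nhds_zero] at h1
  have hε2 : 0 < ε / 2 := ENNReal.half_pos hε.ne'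
  -- The width `δ` is fixed first, making the annulus terms small uniformly in `r`; only then does
  -- `r` tend to `1` in the Lipschitz term.
  obtain ⟨δ, hδε, hδ⟩ := ((h1 _ hε2).and self_mem_nhdsWithin).exists
  have hδ0 : 0 < δ := hδ
  have hga : AEStronglyMeasurable (annulusPart δ g) (volume.restrict disk) :=
    hg.indicator (measurableSet_annulus δ)
  set A := 2 * (ENNReal.ofReal (δ / 2)⁻¹ * ENNReal.ofReal (δ / 2)⁻¹) * ∫⁻ ζ in disk, ‖g ζ‖ₑ
  have hA : A < ⊤ := ENNReal.mul_lt_top (by finiteness) (lintegral_lt_top_of_rpow hs1.le hgs)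
  have h2 : Tendsto (fun r : ℝ => ENNReal.ofReal (1 - r) * A * ENNReal.ofReal (2 * Real.pi))
      (𝓝[<] 1) (𝓝 (ENNReal.ofReal (1 - 1) * A * ENNReal.ofReal (2 * Real.pi))) := by
    refine ENNReal.Tendsto.mul_const (ENNReal.Tendsto.mul_const ?_ (.inr hA.ne))
      (.inr ENNReal.ofReal_ne_top)
    refine ENNReal.tendsto_ofReal (Tendsto.mono_left ?_ nhdsWithin_le_nhds)
    exact tendsto_const_nhds.sub tendsto_id
  rw [sub_self, ENNReal.ofReal_zero, zero_mul, zero_mul, ENNReal.tendsto_nhds_zero] at h2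
  have h3 : Ioo (max (1 / 2) (1 - δ / 2)) 1 ∈ 𝓝[<] (1 : ℝ) :=
    Ioo_mem_nhdsLT (max_lt (by norm_num) (by linarith))
  filter_upwards [h2 _ hε2, h3] with r hr hr1
  have hr2 : r ∈ Icc (1 / 2 : ℝ) 1 := ⟨((le_max_left _ _).trans_lt hr1.1).le, hr1.2.le⟩
  have hr3 : 1 - δ / 2 ≤ r := ((le_max_right _ _).trans_lt hr1.1).le
  have h11 : (1 : ℝ) ∈ Icc (1 / 2 : ℝ) 1 := by constructor <;> norm_num
  have hm : ∀ r, Measurable fun θ => absPotential (annulusPart δ g) (polarPt r θ) := fun r =>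
    (measurable_absPotential hga).comp (measurable_polarPt_right r)
  calc _ ≤ ∫⁻ θ in Ioc (0 : ℝ) (2 * Real.pi),
        (2 * absPotential (annulusPart δ g) (polarPt r θ) +
          2 * absPotential (annulusPart δ g) (polarPt 1 θ) + ENNReal.ofReal (1 - r) * A) := by
        refine lintegral_mono_ae ?_
        filter_upwards [ae_circle_definedT hs1 hs2 hg hgs hr2,
          ae_circle_definedT hs1 hs2 hg hgs h11] with θ hθ hθ1
        rw [← enorm_polarPt_sub_one hr2.2 θ]
        refine enorm_opT_sub_le hg hδ0 (norm_polarPt_le_one hr2 θ) (norm_polarPt_le_one h11 θ)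
          ?_ ?_ hθ hθ1
        · rwa [norm_polarPt (by linarith [hr2.1])]
        · rw [norm_polarPt zero_le_one]; linarith
    _ = 2 * (∫⁻ θ in Ioc (0 : ℝ) (2 * Real.pi), absPotential (annulusPart δ g) (polarPt r θ)) +
        2 * (∫⁻ θ in Ioc (0 : ℝ) (2 * Real.pi), absPotential (annulusPart δ g) (polarPt 1 θ)) +
        ENNReal.ofReal (1 - r) * A * ENNReal.ofReal (2 * Real.pi) := by
        rw [lintegral_add_right _ measurable_const, lintegral_add_right _ ((hm 1).const_mul 2), lintegral_const_mul _ (hm r),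
          lintegral_const_mul _ (hm 1), lintegral_const]
        simp
    _ ≤ 2 * (C * (∫⁻ z in disk, ‖annulusPart δ g z‖ₑ ^ s) ^ (1 / s)) +
        2 * (C * (∫⁻ z in disk, ‖annulusPart δ g z‖ₑ ^ s) ^ (1 / s)) + ε / 2 := by
        gcongr
        · exact h _ hga r hr2
        · exact h _ hga 1 h11
    _ = 4 * (C * (∫⁻ z in disk, ‖annulusPart δ g z‖ₑ ^ s) ^ (1 / s)) + ε / 2 := by ring
    _ ≤ ε / 2 + ε / 2 := by gcongr
    _ = ε := ENNReal.add_halves ε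

lemma circleTest_continuous (φ : circleTest) : Continuous (φ : ℝ → ℂ) := φ.2.1.continuous

lemma circleTest_bounded (φ : circleTest) : ∃ M, 0 ≤ M ∧ ∀ θ, ‖(φ : ℝ → ℂ) θ‖ ≤ M := by
  obtain ⟨M, hM⟩ := φ.2.2.isBounded_of_continuous Real.two_pi_pos.ne' (circleTest_continuous φ)
    |>.exists_norm_le
  exact ⟨M, (norm_nonneg _).trans (hM _ (mem_range_self 0)), fun θ => hM _ (mem_range_self θ)⟩

/-- An integrable function of the angle as a distribution on the circle. -/
noncomputable def circleDistributionOf (u : ℝ → ℂ) (hu : IntegrableOn u (Ioc 0 (2 * Real.pi))) :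
    circleDistribution := by
  have hi : ∀ φ : circleTest, IntervalIntegrable (fun θ => u θ * (φ : ℝ → ℂ) θ) volume 0
      (2 * Real.pi) := fun φ => by
    refine IntervalIntegrable.mul_continuousOn ?_ (circleTest_continuous φ).continuousOn
    rwa [intervalIntegrable_iff_integrableOn_Ioc_of_le Real.two_pi_pos.le]
  refine ⟨{ toFun := fun φ => ∫ θ in (0 : ℝ)..(2 * Real.pi), u θ * (φ : ℝ → ℂ) θ
            map_add' := fun φ ψ => ?_
            map_smul' := fun c φ => ?_ }, 0, ∫ θ in Ioc 0 (2 * Real.pi), ‖u θ‖,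
            integral_nonneg fun _ => norm_nonneg _, fun φ M hM => ?_⟩
  · simp only [Submodule.coe_add, Pi.add_apply, mul_add]
    exact intervalIntegral.integral_add (hi φ) (hi ψ)
  · simp only [Submodule.coe_smul, Pi.smul_apply, smul_eq_mul, RingHom.id_apply]
    rw [← intervalIntegral.integral_const_mul]
    congr 1; funext θ; ring
  · have h0 : ∀ θ, ‖(φ : ℝ → ℂ) θ‖ ≤ M := fun θ => by simpa using hM 0 le_rfl θ
    simp only [LinearMap.coe_mk, AddHom.coe_mk]
    rw [intervalIntegral.integral_of_le Real.two_pi_pos.le]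
    refine (norm_integral_le_integral_norm _).trans ?_
    rw [← integral_mul_const]
    refine integral_mono_of_nonneg (.of_forall fun _ => norm_nonneg _) (hu.norm.mul_const M)
      (.of_forall fun θ => ?_)
    simp only [norm_mul]
    exact mul_le_mul_of_nonneg_left (h0 θ) (norm_nonneg _)

lemma circleDistributionOf_apply (u : ℝ → ℂ) (hu : IntegrableOn u (Ioc 0 (2 * Real.pi)))
    (φ : circleTest) : (circleDistributionOf u hu : circleTest →ₗ[ℂ] ℂ) φ =
      ∫ θ in (0 : ℝ)..(2 * Real.pi), u θ * (φ : ℝ → ℂ) θ := rfl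

/-- `T̃ g` has a boundary value in the sense of distributions, if `g ∈ L^s(D)`, `s > 1`. -/
lemma exists_hasBoundaryValue_opT {s : ℝ} (hs1 : 1 < s) (hs2 : s < 2) {g : ℂ → ℂ}
    (hg : AEStronglyMeasurable g (volume.restrict disk)) (hgs : ∫⁻ z in disk, ‖g z‖ₑ ^ s < ⊤) :
    ∃ L, HasBoundaryValue (opT g) L := by
  have hint : ∀ r ∈ Icc (1 / 2 : ℝ) 1, IntegrableOn (fun θ => opT g (polarPt r θ))
    (Ioc (0 : ℝ) (2 * Real.pi)) := fun r hr => integrableOn_opT_polarPt hs1 hs2 hg hgs hr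
  have h1 : (1 : ℝ) ∈ Icc (1 / 2 : ℝ) 1 := by constructor <;> norm_num
  have hev : ∀ᶠ r in 𝓝[<] (1 : ℝ), r ∈ Icc (1 / 2 : ℝ) 1 :=
    mem_of_superset (Ioo_mem_nhdsLT (by norm_num : (1 / 2 : ℝ) < 1)) Ioo_subset_Icc_self
  -- The boundary value is an integrable function: the defining integral itself, evaluated on the
  -- unit circle.
  refine ⟨circleDistributionOf (fun θ => opT g (polarPt 1 θ)) (hint 1 h1), ?_, fun φ => ?_⟩
  · filter_upwards [hev] with r hr
    rw [intervalIntegrable_iff_integrableOn_Ioc_of_le Real.two_pi_pos.le]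
    exact hint r hr
  · rw [circleDistributionOf_apply]
    obtain ⟨M, hM0, hM⟩ := circleTest_bounded φ
    simp_rw [intervalIntegral.integral_of_le Real.two_pi_pos.le]
    have hφ : ∀ r ∈ Icc (1 / 2 : ℝ) 1, IntegrableOn (fun θ => opT g (polarPt r θ) * (φ : ℝ → ℂ) θ)
        (Ioc (0 : ℝ) (2 * Real.pi)) := fun r hr =>
      (hint r hr).mul_bdd (circleTest_continuous φ).aestronglyMeasurable (.of_forall hM)
    refine tendsto_integral_of_L1 _ (hφ 1 h1).1 (hev.mono hφ) ?_
    have h2 := ENNReal.Tendsto.mul_const (b := ENNReal.ofReal M)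
      (tendsto_lintegral_opT_sub hs1 hs2 hg hgs) (.inr ENNReal.ofReal_ne_top)
    rw [zero_mul] at h2
    refine tendsto_of_tendsto_of_tendsto_of_le_of_le tendsto_const_nhds h2
      (fun _ => zero_le) fun r => ?_
    rw [← lintegral_mul_const' _ _ ENNReal.ofReal_ne_top]
    refine lintegral_mono fun θ => ?_
    rw [← sub_mul, enorm_mul]
    gcongr
    rw [← ofReal_norm]
    exact ENNReal.ofReal_le_ofReal (hM θ)

/-! ### The Cauchy-Pompeiu formula for test functions -/

lemma hasDerivAt_polarPt_left (r θ : ℝ) :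
    HasDerivAt (fun r => polarPt r θ) (Complex.exp (θ * Complex.I)) r := by
  simpa [polarPt] using (Complex.ofRealCLM.hasDerivAt (x := r)).mul_const
    (Complex.exp (θ * Complex.I))

lemma hasDerivAt_polarPt_right (r θ : ℝ) :
    HasDerivAt (polarPt r) (r * (Complex.I * Complex.exp (θ * Complex.I))) θ := by
  have h1 : HasDerivAt (fun θ : ℝ => (θ : ℂ) * Complex.I) Complex.I θ := by
    simpa using (Complex.ofRealCLM.hasDerivAt (x := θ)).mul_const Complex.I
  have := (h1.cexp).const_mul (r : ℂ)
  rwa [mul_comm (Complex.exp _)] at this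

/-- The Cauchy-Riemann operator in polar form: `∂_r + (i/r) ∂_θ = 2 e^{-iθ} ∂/∂z̄`. -/
lemma fderiv_add_I_mul_fderiv {ψ : ℂ → ℂ} (x : ℂ) (θ : ℝ) :
    fderiv ℝ ψ x (Complex.exp (θ * Complex.I)) +
      Complex.I * fderiv ℝ ψ x (Complex.I * Complex.exp (θ * Complex.I)) =
      2 * (Complex.exp (-(θ * Complex.I)) * dbar ψ x) := by
  have e1 : Complex.exp (θ * Complex.I) = Real.cos θ • (1 : ℂ) + Real.sin θ • Complex.I := by
    rw [Complex.exp_mul_I]; simp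
  have e2 : Complex.I * Complex.exp (θ * Complex.I) =
      (-Real.sin θ) • (1 : ℂ) + Real.cos θ • Complex.I := by
    rw [Complex.exp_mul_I]; simp [mul_add]; ring_nf; simp; ring
  have e3 : Complex.exp (-(θ * Complex.I)) = Real.cos θ - Real.sin θ * Complex.I := by
    rw [← neg_mul, Complex.exp_mul_I]; simp; ring
  rw [e2, e1, e3, map_add, map_add, map_smul, map_smul, map_smul, map_smul, dbar]
  simp only [Complex.real_smul]
  push_cast
  linear_combination (Complex.sin θ * fderiv ℝ ψ x Complex.I) * Complex.I_sq

/-- The Cauchy-Pompeiu formula. -/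
lemma integral_dbar_add_div {ψ : ℂ → ℂ} (hψ : ContDiff ℝ 1 ψ) (hc : HasCompactSupport ψ) (z : ℂ) :
    ∫ t, dbar ψ (z + t) / t = -Real.pi * ψ z := by
  obtain ⟨R, hR0, hR⟩ : ∃ R : ℝ, 0 < R ∧ ∀ x, R ≤ ‖x‖ → z + x ∉ tsupport ψ := by
    obtain ⟨R, hR⟩ := hc.isCompact.isBounded.exists_norm_le
    refine ⟨max (R + ‖z‖ + 1) 1, by positivity, fun x hx hmem => ?_⟩
    have h1 := hR _ hmem
    have h2 := norm_sub_le (z + x) z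
    rw [add_sub_cancel_left] at h2
    linarith [le_max_left (R + ‖z‖ + 1) 1]
  -- `A` is the radial derivative and `B` the angular one divided by `r`; the area factor `r`
  -- cancels the modulus of `1/t`. Along each ray `A` integrates to `-ψ z`, and around each circle
  -- `B` integrates to `0`.
  set A : ℝ × ℝ → ℂ := fun p => fderiv ℝ ψ (z + polarPt p.1 p.2) (Complex.exp (p.2 * Complex.I))
  set B : ℝ × ℝ → ℂ := fun p => fderiv ℝ ψ (z + polarPt p.1 p.2)
    (Complex.I * Complex.exp (p.2 * Complex.I))
  have hfd : Continuous (fderiv ℝ ψ) := hψ.continuous_fderiv one_ne_zero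
  have hpc : Continuous fun p : ℝ × ℝ => z + polarPt p.1 p.2 :=
    continuous_const.add continuous_polarPt
  have hAc : Continuous A := (hfd.comp hpc).clm_apply (by fun_prop)
  have hBc : Continuous B := (hfd.comp hpc).clm_apply (by fun_prop)
  have hfd0 : ∀ r θ : ℝ, R ≤ r → fderiv ℝ ψ (z + polarPt r θ) = 0 := fun r θ hr => by
    have : z + polarPt r θ ∉ tsupport ψ := hR _ (by rwa [norm_polarPt (hR0.le.trans hr)])
    exact image_eq_zero_of_notMem_tsupport fun h => this (tsupport_fderiv_subset ℝ h)
  have hint : ∀ F : ℝ × ℝ → ℂ, Continuous F → (∀ r θ, R ≤ r → F (r, θ) = 0) →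
      IntegrableOn F (Ioi 0 ×ˢ Ioo (-Real.pi) Real.pi) := fun F hF hF0 => by
    have h1 : IntegrableOn F (Icc 0 R ×ˢ Icc (-Real.pi) Real.pi) :=
      hF.continuousOn.integrableOn_compact (isCompact_Icc.prod isCompact_Icc)
    refine h1.of_forall_sdiff_eq_zero (measurableSet_Ioi.prod measurableSet_Ioo) ?_
    rintro ⟨r, θ⟩ ⟨⟨hr, hθ⟩, hn⟩
    refine hF0 r θ ?_
    by_contra hlt
    exact hn ⟨⟨le_of_lt hr, (not_le.1 hlt).le⟩, Ioo_subset_Icc_self hθ⟩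
  have hA := hint A hAc fun r θ hr => by simp [A, hfd0 r θ hr]
  have hB := hint B hBc fun r θ hr => by simp [B, hfd0 r θ hr]
  have hdiff : Differentiable ℝ ψ := hψ.differentiable one_ne_zero
  have iA : ∫ p in Ioi (0 : ℝ) ×ˢ Ioo (-Real.pi) Real.pi, A p = -(2 * Real.pi) * ψ z := by
    rw [Measure.volume_eq_prod] at hA ⊢
    rw [IntegrableOn, ← Measure.prod_restrict] at hA
    rw [← Measure.prod_restrict, integral_prod_symm A hA]
    have : ∀ θ, ∫ r in Ioi (0 : ℝ), A (r, θ) = -ψ z := fun θ => by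
      have hd : ∀ r : ℝ, HasDerivAt (fun r => ψ (z + polarPt r θ)) (A (r, θ)) r := fun r =>
        (hdiff _).hasFDerivAt.comp_hasDerivAt r ((hasDerivAt_polarPt_left r θ).const_add z)
      have hi : IntegrableOn (fun r => A (r, θ)) (Ioi 0) := by
        have h1 : IntegrableOn (fun r => A (r, θ)) (Icc 0 R) :=
          (hAc.comp (by fun_prop : Continuous fun r : ℝ => (r, θ))).continuousOn.integrableOn_compact
            isCompact_Icc
        refine h1.of_forall_sdiff_eq_zero measurableSet_Ioi fun r hr => ?_
        have : R ≤ r := by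
          by_contra hlt
          exact hr.2 ⟨le_of_lt hr.1, (not_le.1 hlt).le⟩
        simp [A, hfd0 r θ this]
      have ht : Tendsto (fun r => ψ (z + polarPt r θ)) atTop (𝓝 0) := by
        refine tendsto_const_nhds.congr' ?_
        filter_upwards [eventually_ge_atTop R] with r hr
        exact (image_eq_zero_of_notMem_tsupport
          (hR _ (by rwa [norm_polarPt (hR0.le.trans hr)]))).symm
      rw [integral_Ioi_of_hasDerivAt_of_tendsto (hd 0).continuousAt.continuousWithinAt
        (fun r _ => hd r) hi ht]
      simp [polarPt]
    simp only [this, setIntegral_const, measureReal_def, Real.volume_Ioo]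
    rw [ENNReal.toReal_ofReal (by linarith [Real.pi_pos]), Complex.real_smul]
    push_cast; ring
  have iB : ∫ p in Ioi (0 : ℝ) ×ˢ Ioo (-Real.pi) Real.pi, B p = 0 := by
    rw [Measure.volume_eq_prod] at hB ⊢
    rw [setIntegral_prod B hB]
    refine setIntegral_eq_zero_of_forall_eq_zero fun r hr => ?_
    have hr0 : (r : ℂ) ≠ 0 := by exact_mod_cast (ne_of_gt hr)
    have hd : ∀ θ : ℝ, HasDerivAt (fun θ => ψ (z + polarPt r θ)) (r * B (r, θ)) θ := fun θ => by
      have := (hdiff _).hasFDerivAt.comp_hasDerivAt θ ((hasDerivAt_polarPt_right r θ).const_add z)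
      rwa [← Complex.real_smul, map_smul, Complex.real_smul] at this
    have hcont : Continuous fun θ => B (r, θ) := hBc.comp (by fun_prop)
    have h1 : ∫ θ in (-Real.pi)..Real.pi, (r : ℂ) * B (r, θ) = 0 := by
      rw [intervalIntegral.integral_eq_sub_of_hasDerivAt (fun θ _ => hd θ)
        ((continuous_const.mul hcont).intervalIntegrable _ _)]
      have : polarPt r Real.pi = polarPt r (-Real.pi) := by
        rw [← polarPt_periodic r (-Real.pi)]; congr 1; ring
      rw [this, sub_self]
    rw [intervalIntegral.integral_const_mul, mul_eq_zero] at h1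
    have h2 := h1.resolve_left hr0
    rwa [intervalIntegral.integral_of_le (by linarith [Real.pi_pos]),
      integral_Ioc_eq_integral_Ioo] at h2
  rw [← Complex.integral_comp_polarCoord_symm, polarCoord_target]
  have e : ∀ p ∈ Ioi (0 : ℝ) ×ˢ Ioo (-Real.pi) Real.pi,
      p.1 • (dbar ψ (z + Complex.polarCoord.symm p) / Complex.polarCoord.symm p) =
        (1 / 2 : ℂ) * (A p + Complex.I * B p) := fun p hp => by
    have hr0 : (p.1 : ℂ) ≠ 0 := by exact_mod_cast (ne_of_gt hp.1)
    rw [polarCoord_symm_eq]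
    simp only [A, B]
    rw [fderiv_add_I_mul_fderiv, Complex.real_smul, Complex.exp_neg]
    have := Complex.exp_ne_zero (p.2 * Complex.I)
    conv_lhs => enter [2, 2]; rw [polarPt]
    field_simp
  rw [setIntegral_congr_fun (measurableSet_Ioi.prod measurableSet_Ioo) e, integral_const_mul,
    integral_add hA (hB.const_mul _), integral_const_mul, iA, iB]
  ring

/-! ### The derivative `dbar` of test functions -/

lemma dbar_eq_zero_of_notMem {φ : ℂ → ℂ} {z : ℂ} (h : z ∉ tsupport φ) : dbar φ z = 0 := by
  have : fderiv ℝ φ z = 0 :=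
    image_eq_zero_of_notMem_tsupport fun h' => h (tsupport_fderiv_subset ℝ h')
  simp [dbar, this]

lemma continuous_dbar {φ : ℂ → ℂ} (h : ContDiff ℝ 1 φ) : Continuous (dbar φ) := by
  have hfd : Continuous (fderiv ℝ φ) := h.continuous_fderiv one_ne_zero
  unfold dbar
  fun_prop

lemma dbar_mul {φ ψ : ℂ → ℂ} {z : ℂ} (hφ : DifferentiableAt ℝ φ z)
    (hψ : DifferentiableAt ℝ ψ z) :
    dbar (fun z => φ z * ψ z) z = φ z * dbar ψ z + ψ z * dbar φ z := by
  simp only [dbar]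
  rw [fderiv_fun_mul hφ hψ]
  simp only [add_apply, smul_apply, smul_eq_mul]
  ring

lemma hasCompactSupport_dbar {φ : ℂ → ℂ} (hc : HasCompactSupport φ) :
    HasCompactSupport (dbar φ) :=
  HasCompactSupport.intro hc.isCompact fun _ h => dbar_eq_zero_of_notMem h

lemma exists_norm_dbar_le {φ : ℂ → ℂ} (h : ContDiff ℝ 1 φ) (hc : HasCompactSupport φ) :
    ∃ M, ∀ z, ‖dbar φ z‖ ≤ M :=
  (hasCompactSupport_dbar hc).exists_bound_of_continuous (continuous_dbar h)

/-! ### The Cauchy transform -/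

/-- The Cauchy transform `∬_D a(ζ) / (ζ - z)`. -/
noncomputable def cauchyT (a : ℂ → ℂ) (z : ℂ) : ℂ := ∫ ζ in disk, a ζ / (ζ - z)

lemma integrable_cauchy_prod {a b : ℂ → ℂ} (ha : IntegrableOn a disk)
    (hb : AEStronglyMeasurable b (volume.restrict disk)) {M : ℝ} (hM : ∀ z ∈ disk, ‖b z‖ ≤ M) :
    Integrable (fun p : ℂ × ℂ => a p.2 / (p.2 - p.1) * b p.1)
      ((volume.restrict disk).prod (volume.restrict disk)) := by
  have ha2 : AEMeasurable (fun p : ℂ × ℂ => a p.2)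
    ((volume.restrict disk).prod (volume.restrict disk)) := ha.1.comp_snd.aemeasurable
  have hb1 : AEMeasurable (fun p : ℂ × ℂ => b p.1)
    ((volume.restrict disk).prod (volume.restrict disk)) := hb.comp_fst.aemeasurable
  have hm : AEMeasurable (fun p : ℂ × ℂ => a p.2 / (p.2 - p.1) * b p.1)
    ((volume.restrict disk).prod (volume.restrict disk)) := (ha2.div (by fun_prop)).mul hb1
  refine ⟨hm.aestronglyMeasurable, ?_⟩
  rw [HasFiniteIntegral, lintegral_prod _ hm.enorm]
  calc _ ≤ ∫⁻ z in disk, ENNReal.ofReal M * absPotential a z := by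
        refine setLIntegral_mono' measurableSet_disk fun z hz => ?_
        rw [absPotential, ← lintegral_const_mul' _ _ ENNReal.ofReal_ne_top]
        refine lintegral_mono fun ζ => ?_
        rw [enorm_mul, mul_comm]
        gcongr
        · rw [← ofReal_norm]
          exact ENNReal.ofReal_le_ofReal (hM z hz)
        · exact enorm_div_le _ _
    _ < ⊤ := by
        rw [lintegral_const_mul' _ _ ENNReal.ofReal_ne_top]
        exact ENNReal.mul_lt_top ENNReal.ofReal_lt_top (lintegral_absPotential_lt_top ha)

/-- Fubini, with the sign coming from the antisymmetry of `1 / (ζ - z)`. -/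
lemma integral_cauchyT_mul {a b : ℂ → ℂ} (ha : IntegrableOn a disk)
    (hb : AEStronglyMeasurable b (volume.restrict disk)) {M : ℝ} (hM : ∀ z ∈ disk, ‖b z‖ ≤ M) :
    ∫ z in disk, cauchyT a z * b z = -∫ ζ in disk, a ζ * cauchyT b ζ := by
  simp only [cauchyT]
  simp_rw [← integral_mul_const]
  rw [integral_integral_swap (integrable_cauchy_prod ha hb hM), ← integral_neg]
  refine integral_congr_ae (.of_forall fun ζ => ?_)
  simp only
  rw [← integral_const_mul, ← integral_neg]
  refine integral_congr_ae (.of_forall fun z => ?_)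
  simp only
  rw [← neg_sub z ζ, div_neg]
  ring

lemma integrableOn_cauchyT {a : ℂ → ℂ} (ha : IntegrableOn a disk) :
    IntegrableOn (cauchyT a) disk := by
  have := (integrable_cauchy_prod ha (b := fun _ => 1) (M := 1) aestronglyMeasurable_const
    (fun _ _ => by simp)).integral_prod_left
  simp only [mul_one] at this
  exact this

/-- The support condition lets the integral extend over the plane, where it is the Cauchy-Pompeiu
integral after a translation. -/
lemma cauchyT_dbar {φ : ℂ → ℂ} (hφ : ContDiff ℝ 1 φ) (hc : HasCompactSupport φ)
    (hs : tsupport φ ⊆ disk) (ζ : ℂ) : cauchyT (dbar φ) ζ = -Real.pi * φ ζ := by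
  rw [← integral_dbar_add_div hφ hc, cauchyT, setIntegral_eq_integral_of_forall_compl_eq_zero,
    ← integral_add_left_eq_self _ ζ]
  · simp
  · intro z hz
    rw [dbar_eq_zero_of_notMem fun h => hz (hs h), zero_div]

/-- The weak `dbar` derivative of the Cauchy transform. -/
lemma integral_cauchyT_mul_dbar {g φ : ℂ → ℂ} (hg : IntegrableOn g disk) (hφ : ContDiff ℝ 1 φ)
    (hc : HasCompactSupport φ) (hs : tsupport φ ⊆ disk) :
    ∫ z in disk, cauchyT g z * dbar φ z = Real.pi * ∫ z in disk, g z * φ z := by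
  obtain ⟨M, hM⟩ := exists_norm_dbar_le hφ hc
  rw [integral_cauchyT_mul hg (continuous_dbar hφ).aestronglyMeasurable fun z _ => hM z]
  simp_rw [cauchyT_dbar hφ hc hs]
  rw [← integral_const_mul, ← integral_neg]
  congr 1; funext z; ring

lemma hasDerivAt_div_sub (a ζ : ℂ) {z : ℂ} (h : ζ ≠ z) :
    HasDerivAt (fun z => a / (ζ - z)) (a / (ζ - z) ^ 2) z := by
  have h1 : HasDerivAt (fun z => ζ - z) (-1) z := by simpa using (hasDerivAt_id z).const_sub ζ
  have := (hasDerivAt_const z a).fun_div h1 (sub_ne_zero.2 h)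
  simpa using this

/-- Differentiation under the integral: for `x` within `δ` of `z`, half the distance from `z` to the
circle of radius `R`, the kernel is at most `1/δ` wherever `a` does not vanish. -/
lemma differentiableOn_cauchyT {a : ℂ → ℂ} (ha : IntegrableOn a disk) {R : ℝ}
    (h0 : ∀ ζ ∈ Metric.ball (0 : ℂ) R, a ζ = 0) :
    DifferentiableOn ℂ (cauchyT a) (Metric.ball 0 R) := by
  intro z hz
  rw [mem_ball_zero_iff] at hz
  set δ := (R - ‖z‖) / 2 with hδ
  have hδ0 : 0 < δ := by rw [hδ]; linarith
  have key : ∀ x ∈ Metric.ball z δ, ∀ ζ, a ζ = 0 ∨ δ ≤ ‖ζ - x‖ := fun x hx ζ => by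
    by_cases h : ‖ζ‖ < R
    · exact .inl (h0 ζ (by simpa using h))
    · right
      have h1 : ‖x - z‖ < δ := by simpa [dist_eq_norm] using hx
      have h2 := norm_sub_norm_le ζ x
      have h3 := norm_sub_norm_le x z
      linarith
  have ham : AEMeasurable a (volume.restrict disk) := ha.1.aemeasurable
  have hF : ∀ x : ℂ, AEStronglyMeasurable (fun ζ => a ζ / (ζ - x)) (volume.restrict disk) :=
    fun x => (ham.div (by fun_prop)).aestronglyMeasurable
  have hbd : ∀ ζ, ‖a ζ / (ζ - z)‖ ≤ ‖a ζ‖ / δ := fun ζ => by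
    rcases key z (Metric.mem_ball_self hδ0) ζ with h | h
    · simp [h]
    · rw [norm_div]; gcongr
  refine (hasDerivAt_integral_of_dominated_loc_of_deriv_le (F := fun x ζ => a ζ / (ζ - x))
    (F' := fun x ζ => a ζ / (ζ - x) ^ 2) (bound := fun ζ => ‖a ζ‖ / δ ^ 2)
    (Metric.ball_mem_nhds z hδ0) (.of_forall hF) ?_ ?_ ?_ (ha.norm.div_const _)
    ?_).2.differentiableAt.differentiableWithinAt
  · exact (ha.norm.div_const δ).mono' (hF z) (.of_forall hbd)
  · exact (ham.div (by fun_prop)).aestronglyMeasurable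
  · refine .of_forall fun ζ x hx => ?_
    rcases key x hx ζ with h | h
    · simp only [h, zero_div, norm_zero]; positivity
    · rw [norm_div, norm_pow]; gcongr
  · refine .of_forall fun ζ x hx => ?_
    rcases key x hx ζ with h | h
    · simpa [h] using hasDerivAt_const x (0 : ℂ)
    · refine hasDerivAt_div_sub _ _ fun e => ?_
      rw [e, sub_self, norm_zero] at h
      linarith

lemma hasDerivAt_mul_div_one_sub (a c : ℂ) {z : ℂ} (h : 1 - c * z ≠ 0) :
    HasDerivAt (fun z => z * a / (1 - c * z)) (a / (1 - c * z) ^ 2) z := by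
  have h1 : HasDerivAt (fun z => 1 - c * z) (-c) z := by
    simpa using ((hasDerivAt_id z).const_mul c).const_sub 1
  have h2 : HasDerivAt (fun z => z * a) a z := by simpa using (hasDerivAt_id z).mul_const a
  have h3 := h2.fun_div h1 h
  rwa [show a * (1 - c * z) - z * a * -c = a by ring] at h3

/-- The antiholomorphic part of the kernel gives a holomorphic function. -/
lemma differentiableOn_conj_part {g : ℂ → ℂ} (hg : IntegrableOn g disk) :
    DifferentiableOn ℂ (fun z => ∫ ζ in disk, z * (starRingEnd ℂ) (g ζ) /
      (1 - (starRingEnd ℂ) ζ * z)) disk := by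
  intro z hz
  rw [mem_disk] at hz
  set δ := (1 - ‖z‖) / 2 with hδ
  have hδ0 : 0 < δ := by rw [hδ]; linarith
  have key : ∀ x ∈ Metric.ball z δ, ∀ ζ ∈ disk, δ ≤ ‖1 - (starRingEnd ℂ) ζ * x‖ :=
    fun x hx ζ hζ => by
      rw [mem_disk] at hζ
      have h1 : ‖x - z‖ < δ := by simpa [dist_eq_norm] using hx
      have h2 := norm_sub_norm_le (1 : ℂ) ((starRingEnd ℂ) ζ * x)
      have h3 := norm_sub_norm_le x z
      rw [norm_mul, RCLike.norm_conj, norm_one] at h2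
      have : ‖ζ‖ * ‖x‖ ≤ 1 * ‖x‖ := by gcongr
      linarith
  have hc : Measurable (starRingEnd ℂ) := Complex.continuous_conj.measurable
  have ham : AEMeasurable (fun ζ => (starRingEnd ℂ) (g ζ)) (volume.restrict disk) :=
    hc.comp_aemeasurable hg.1.aemeasurable
  have hden : ∀ x : ℂ, Measurable fun ζ : ℂ => 1 - (starRingEnd ℂ) ζ * x := fun x =>
    measurable_const.sub (hc.mul_const x)
  have hF : ∀ x : ℂ, AEStronglyMeasurable (fun ζ => x * (starRingEnd ℂ) (g ζ) /
      (1 - (starRingEnd ℂ) ζ * x)) (volume.restrict disk) := fun x =>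
    ((ham.const_mul x).div (hden x).aemeasurable).aestronglyMeasurable
  refine (hasDerivAt_integral_of_dominated_loc_of_deriv_le
    (F := fun x ζ => x * (starRingEnd ℂ) (g ζ) / (1 - (starRingEnd ℂ) ζ * x))
    (F' := fun x ζ => (starRingEnd ℂ) (g ζ) / (1 - (starRingEnd ℂ) ζ * x) ^ 2)
    (bound := fun ζ => ‖g ζ‖ / δ ^ 2)
    (Metric.ball_mem_nhds z hδ0) (.of_forall hF) ?_ ?_ ?_ (hg.norm.div_const _)
    ?_).2.differentiableAt.differentiableWithinAt
  · refine (hg.norm.div_const δ).mono' (hF z) ?_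
    filter_upwards [ae_restrict_mem measurableSet_disk] with ζ hζ
    rw [norm_div, norm_mul, RCLike.norm_conj]
    have := key z (Metric.mem_ball_self hδ0) ζ hζ
    gcongr
    exact mul_le_of_le_one_left (norm_nonneg _) hz.le
  · exact (ham.div ((hden z).pow_const 2).aemeasurable).aestronglyMeasurable
  · filter_upwards [ae_restrict_mem measurableSet_disk] with ζ hζ x hx
    rw [norm_div, norm_pow, RCLike.norm_conj]
    have := key x hx ζ hζ
    gcongr
  · filter_upwards [ae_restrict_mem measurableSet_disk] with ζ hζ x hx
    refine hasDerivAt_mul_div_one_sub _ _ ?_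
    exact norm_pos_iff.1 (hδ0.trans_le (key x hx ζ hζ))

lemma integrableOn_conj_part {g : ℂ → ℂ} (hg : IntegrableOn g disk) {z : ℂ} (hz : z ∈ disk) :
    IntegrableOn (fun ζ => z * (starRingEnd ℂ) (g ζ) / (1 - (starRingEnd ℂ) ζ * z)) disk := by
  rw [mem_disk] at hz
  have hc : Measurable (starRingEnd ℂ) := Complex.continuous_conj.measurable
  have ham : AEMeasurable (fun ζ => (starRingEnd ℂ) (g ζ)) (volume.restrict disk) :=
    hc.comp_aemeasurable hg.1.aemeasurable
  refine (hg.norm.div_const (1 - ‖z‖)).mono' ((ham.const_mul z).div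
    (measurable_const.sub (hc.mul_const z)).aemeasurable).aestronglyMeasurable ?_
  filter_upwards [ae_restrict_mem measurableSet_disk] with ζ hζ
  rw [mem_disk] at hζ
  rw [norm_div, norm_mul, RCLike.norm_conj]
  have h2 := norm_sub_norm_le (1 : ℂ) ((starRingEnd ℂ) ζ * z)
  rw [norm_mul, RCLike.norm_conj, norm_one] at h2
  have h3 : ‖ζ‖ * ‖z‖ ≤ 1 * ‖z‖ := by gcongr
  have h4 : 1 - ‖z‖ ≤ ‖1 - (starRingEnd ℂ) ζ * z‖ := by linarith
  have h5 : 0 < 1 - ‖z‖ := by linarith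
  gcongr
  exact mul_le_of_le_one_left (norm_nonneg _) hz.le

/-- At interior points the conjugated half is always integrable, so absolute convergence of the
whole kernel forces that of the Cauchy half and the integral splits. -/
lemma opT_eq {g : ℂ → ℂ} (hg : IntegrableOn g disk) {z : ℂ} (hz : z ∈ disk) (hd : DefinedT g z) :
    opT g z = -(1 / (Real.pi : ℂ)) * cauchyT g z + -(1 / (Real.pi : ℂ)) *
      ∫ ζ in disk, z * (starRingEnd ℂ) (g ζ) / (1 - (starRingEnd ℂ) ζ * z) := by
  have h1 := integrableOn_conj_part hg hz
  have h2 : IntegrableOn (fun ζ => g ζ / (ζ - z)) disk := by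
    refine (Integrable.sub hd h1).congr (.of_forall fun ζ => ?_)
    simp [kernelT]
  rw [opT, cauchyT, ← mul_add, ← integral_add h2 h1]
  rfl

/-! ### Weyl's lemma -/

lemma integrableOn_inv_ball (R : ℝ) : IntegrableOn (fun t : ℂ => t⁻¹) (Metric.ball 0 R) := by
  refine ⟨measurable_inv.aestronglyMeasurable, ?_⟩
  refine lt_of_le_of_lt (lintegral_mono fun t => ?_)
    (lintegral_ball_norm_inv_rpow_lt_top (E := ℂ) volume (β := 1) (by simp) R)
  rw [ENNReal.rpow_one]
  simpa using enorm_div_le 1 t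

lemma locallyIntegrable_inv : LocallyIntegrable (fun t : ℂ => t⁻¹) := fun z =>
  ⟨Metric.ball 0 (‖z‖ + 1), Metric.isOpen_ball.mem_nhds (by simp), integrableOn_inv_ball _⟩

/-- A smooth solution of `∂u/∂z̄ = ψ`. -/
noncomputable def solveDbar (ψ : ℂ → ℂ) : ℂ → ℂ :=
  (fun t : ℂ => t⁻¹) ⋆[ContinuousLinearMap.mul ℝ ℂ] ψ

lemma contDiff_solveDbar {ψ : ℂ → ℂ} (hψ : ContDiff ℝ (⊤ : ℕ∞) ψ) (hc : HasCompactSupport ψ) :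
    ContDiff ℝ (⊤ : ℕ∞) (solveDbar ψ) :=
  hc.contDiff_convolution_right _ locallyIntegrable_inv hψ

/-- The derivatives of the convolution fall on `ψ`; reflecting `t` to `-t` leaves the Cauchy-Pompeiu
integral. The kernel is not normalized, hence the factor `π`. -/
lemma dbar_solveDbar {ψ : ℂ → ℂ} (hψ : ContDiff ℝ 1 ψ) (hc : HasCompactSupport ψ) (z : ℂ) :
    dbar (solveDbar ψ) z = Real.pi * ψ z := by
  have hfd : Continuous (fderiv ℝ ψ) := hψ.continuous_fderiv one_ne_zero
  have hcf : HasCompactSupport (fderiv ℝ ψ) := hc.fderiv ℝ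
  have h1 := hc.hasFDerivAt_convolution_right (ContinuousLinearMap.mul ℝ ℂ)
    locallyIntegrable_inv hψ z
  have hv : ∀ v : ℂ, fderiv ℝ (solveDbar ψ) z v = ∫ t : ℂ, t⁻¹ * fderiv ℝ ψ (z - t) v := fun v => by
    rw [solveDbar, h1.fderiv, convolution_precompR_apply _ locallyIntegrable_inv hcf hfd]
    rfl
  have hi : ∀ v : ℂ, Integrable fun t : ℂ => t⁻¹ * fderiv ℝ ψ (z - t) v := fun v => by
    have hcv : HasCompactSupport fun t => fderiv ℝ ψ t v :=
      hcf.comp_left (g := fun L : ℂ →L[ℝ] ℂ => L v) rfl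
    exact hcv.convolutionExists_right (ContinuousLinearMap.mul ℝ ℂ) locallyIntegrable_inv
      (by fun_prop) z
  rw [dbar, hv, hv, ← integral_const_mul, ← integral_add (hi _) ((hi _).const_mul _),
    ← integral_const_mul]
  have h2 := integral_dbar_add_div hψ hc z
  rw [← integral_neg_eq_self] at h2
  rw [show (Real.pi : ℂ) * ψ z = -(-Real.pi * ψ z) by ring, ← h2, ← integral_neg]
  refine integral_congr_ae (.of_forall fun t => ?_)
  simp only [dbar, div_neg, neg_neg, ← sub_eq_add_neg]
  ring

lemma solveDbar_eq {ψ : ℂ → ℂ} (h : ∀ z ∉ disk, ψ z = 0) (z : ℂ) :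
    solveDbar ψ z = -cauchyT ψ z := by
  rw [solveDbar, convolution_eq_swap, cauchyT, setIntegral_eq_integral_of_forall_compl_eq_zero,
    ← integral_neg]
  · refine integral_congr_ae (.of_forall fun t => ?_)
    simp only [ContinuousLinearMap.mul_apply']
    rw [← neg_sub t z, inv_neg]
    ring
  · intro t ht
    rw [h t ht, zero_div]

/-- A function with vanishing weak `dbar` derivative in `D` is almost everywhere equal to a
holomorphic function in every smaller disk. -/
lemma exists_holomorphic_of_weak_dbar_zero_ball {h : ℂ → ℂ} (hl : LocallyIntegrableOn h disk)
    (hw : ∀ φ : ℂ → ℂ, ContDiff ℝ (⊤ : ℕ∞) φ → HasCompactSupport φ → tsupport φ ⊆ disk →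
      ∫ z in disk, h z * dbar φ z = 0) {R : ℝ} (hR0 : 0 < R) (hR1 : R < 1) :
    ∃ Φ : ℂ → ℂ, DifferentiableOn ℂ Φ (Metric.ball 0 R) ∧
      ∀ᵐ z ∂volume, z ∈ Metric.ball (0 : ℂ) R → h z = Φ z := by
  let χ : ContDiffBump (0 : ℂ) := ⟨R, (1 + R) / 2, hR0, by linarith⟩
  set χc : ℂ → ℂ := fun z => (χ z : ℂ) with hχc
  have hχd : ContDiff ℝ (⊤ : ℕ∞) χc := Complex.ofRealCLM.contDiff.comp χ.contDiff
  have hχs : tsupport χc ⊆ Metric.closedBall 0 ((1 + R) / 2) := by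
    rw [← χ.tsupport_eq]
    refine closure_mono fun z hz => ?_
    simp only [χc, Function.mem_support] at hz ⊢
    exact_mod_cast hz
  have hKD : Metric.closedBall (0 : ℂ) ((1 + R) / 2) ⊆ disk :=
    Metric.closedBall_subset_ball (by linarith)
  have hχcs : HasCompactSupport χc :=
    (isCompact_closedBall (0 : ℂ) ((1 + R) / 2)).of_isClosed_subset (isClosed_tsupport _) hχs
  have hχ1 : ∀ z ∈ Metric.ball (0 : ℂ) R, χc z = 1 := fun z hz => by
    simp only [χc, χ.one_of_mem_closedBall (Metric.ball_subset_closedBall hz), Complex.ofReal_one]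
  have hχd1 : ContDiff ℝ 1 χc := hχd.of_le (by exact_mod_cast le_top)
  have hdχ0 : ∀ z ∈ Metric.ball (0 : ℂ) R, dbar χc z = 0 := fun z hz => by
    have : χc =ᶠ[𝓝 z] fun _ => 1 :=
      mem_of_superset (Metric.isOpen_ball.mem_nhds hz) hχ1
    rw [dbar, this.fderiv_eq]
    simp
  obtain ⟨M, hM⟩ := exists_norm_dbar_le hχd1 hχcs
  -- Formally `a` is the `∂/∂z̄`-derivative of `χ h`, since that of `h` vanishes. As `a = 0` on the
  -- small ball, its Cauchy transform is holomorphic there, and `-(1/π)` times it is the candidate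
  -- for `h`.
  set a : ℂ → ℂ := fun z => h z * dbar χc z with ha_def
  have ha : IntegrableOn a disk := by
    have h1 : IntegrableOn a (Metric.closedBall 0 ((1 + R) / 2)) :=
      (hl.integrableOn_compact_subset hKD (isCompact_closedBall _ _)).mul_bdd
        (continuous_dbar hχd1).aestronglyMeasurable (.of_forall hM)
    refine h1.of_forall_sdiff_eq_zero measurableSet_disk fun z hz => ?_
    simp only [a, dbar_eq_zero_of_notMem fun h' => hz.2 (hχs h'), mul_zero]
  have ha0 : ∀ z ∈ Metric.ball (0 : ℂ) R, a z = 0 := fun z hz => by simp [a, hdχ0 z hz]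
  have hH := differentiableOn_cauchyT ha ha0
  refine ⟨fun z => -(1 / Real.pi : ℂ) * cauchyT a z, hH.const_mul _, ?_⟩
  have hBD : Metric.ball (0 : ℂ) R ⊆ disk := Metric.ball_subset_ball hR1.le
  have key := Metric.isOpen_ball.ae_eq_zero_of_integral_contDiff_smul_eq_zero
    (U := Metric.ball (0 : ℂ) R) (μ := volume)
    (f := fun z => h z - -(1 / Real.pi : ℂ) * cauchyT a z) ?_ ?_
  · filter_upwards [key] with z hz hzB using sub_eq_zero.1 (hz hzB)
  · exact (hl.mono_set hBD).sub ((hH.const_mul _).continuousOn.locallyIntegrableOn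
      Metric.isOpen_ball.measurableSet)
  intro ψ hψ hψc hψs
  set ψc : ℂ → ℂ := fun z => (ψ z : ℂ) with hψc_def
  have hψcd : ContDiff ℝ (⊤ : ℕ∞) ψc := Complex.ofRealCLM.contDiff.comp hψ
  have hψcc : HasCompactSupport ψc := hψc.comp_left (g := fun x : ℝ => (x : ℂ)) (by simp)
  have hψcd1 : ContDiff ℝ 1 ψc := hψcd.of_le (by exact_mod_cast le_top)
  have hψ0 : ∀ z ∉ Metric.ball (0 : ℂ) R, ψc z = 0 := fun z hz => by
    simp only [ψc, image_eq_zero_of_notMem_tsupport fun h' => hz (hψs h'), Complex.ofReal_zero]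
  have hψD : ∀ z ∉ disk, ψc z = 0 := fun z hz => hψ0 z fun h' => hz (hBD h')
  obtain ⟨N, hN⟩ := hψcc.exists_bound_of_continuous hψcd.continuous
  set u := solveDbar ψc
  have hu : ContDiff ℝ (⊤ : ℕ∞) u := contDiff_solveDbar hψcd hψcc
  have hu1 : ContDiff ℝ 1 u := hu.of_le (by exact_mod_cast le_top)
  -- `u` need not have compact support, so the cutoff is required. As `χ = 1` where `ψ ≠ 0`, testing
  -- gives `π ∫ h ψ + ∫ a u = 0`, and `u = -cauchyT ψ` moves the Cauchy transform from `ψ` to `a`.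
  have htest := hw (fun z => χc z * u z) (hχd.mul hu) (hχcs.mul_right)
    ((closure_mono (Function.support_mul_subset_left _ _)).trans (hχs.trans hKD))
  have hprod : ∀ z, h z * dbar (fun z => χc z * u z) z = Real.pi * (h z * ψc z) + a z * u z := by
    intro z
    rw [dbar_mul (hχd1.differentiable one_ne_zero z) (hu1.differentiable one_ne_zero z),
      dbar_solveDbar hψcd1 hψcc]
    by_cases hz : z ∈ Metric.ball (0 : ℂ) R
    · rw [hχ1 z hz]; simp only [a]; ring
    · rw [hψ0 z hz]; simp only [a]; ring
  have hu_eq : ∀ z, u z = -cauchyT ψc z := solveDbar_eq hψD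
  have hswap := integral_cauchyT_mul ha hψcd.continuous.aestronglyMeasurable (fun z _ => hN z)
  have hi1 : IntegrableOn (fun z => h z * ψc z) disk := by
    have h1 : IntegrableOn (fun z => h z * ψc z) (Metric.closedBall 0 ((1 + R) / 2)) :=
      (hl.integrableOn_compact_subset hKD (isCompact_closedBall _ _)).mul_bdd
        hψcd.continuous.aestronglyMeasurable (.of_forall hN)
    refine h1.of_forall_sdiff_eq_zero measurableSet_disk fun z hz => ?_
    rw [hψ0 z fun h' => hz.2 ?_, mul_zero]
    exact Metric.closedBall_subset_closedBall (by linarith) (Metric.ball_subset_closedBall h')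
  have hi2 : IntegrableOn (fun z => a z * u z) disk := by
    obtain ⟨K, hK⟩ := (isCompact_closedBall (0 : ℂ) 1).exists_bound_of_continuousOn
      hu.continuous.continuousOn
    refine Integrable.mul_bdd (c := K) ha hu.continuous.aestronglyMeasurable ?_
    filter_upwards [ae_restrict_mem measurableSet_disk] with z hz
    exact hK z (Metric.ball_subset_closedBall hz)
  have hi3 : IntegrableOn (fun z => cauchyT a z * ψc z) disk :=
    Integrable.mul_bdd (c := N) (integrableOn_cauchyT ha) hψcd.continuous.aestronglyMeasurable
      (.of_forall hN)
  simp_rw [hprod] at htest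
  rw [integral_add (hi1.const_mul _) hi2, integral_const_mul] at htest
  have h4 : ∫ z in disk, a z * u z = ∫ z in disk, cauchyT a z * ψc z := by
    rw [hswap, ← integral_neg]
    refine integral_congr_ae (.of_forall fun z => ?_)
    simp only [hu_eq]; ring
  rw [h4] at htest
  have hpi : (Real.pi : ℂ) ≠ 0 := by exact_mod_cast Real.pi_ne_zero
  rw [← setIntegral_eq_integral_of_forall_compl_eq_zero (s := disk)]
  · have e : ∀ z, ψ z • (h z - -(1 / Real.pi : ℂ) * cauchyT a z) =
        h z * ψc z + (1 / Real.pi : ℂ) * (cauchyT a z * ψc z) := fun z => by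
      rw [Complex.real_smul]; simp only [ψc]; ring
    simp_rw [e]
    rw [integral_add hi1 (hi3.const_mul _), integral_const_mul]
    field_simp
    linear_combination htest
  · intro z hz
    have : ψ z = 0 := Complex.ofReal_eq_zero.1 (hψD z hz)
    rw [this, zero_smul]

/-- Weyl's lemma for the Cauchy-Riemann operator in the unit disk. -/
lemma exists_holomorphic_of_weak_dbar_zero {h : ℂ → ℂ} (hl : LocallyIntegrableOn h disk)
    (hw : ∀ φ : ℂ → ℂ, ContDiff ℝ (⊤ : ℕ∞) φ → HasCompactSupport φ → tsupport φ ⊆ disk →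
      ∫ z in disk, h z * dbar φ z = 0) :
    ∃ Φ : ℂ → ℂ, DifferentiableOn ℂ Φ disk ∧ ∀ᵐ z ∂(volume.restrict disk), h z = Φ z := by
  set R : ℕ → ℝ := fun n => 1 - 1 / (n + 2) with hR
  have hR0 : ∀ n, 0 < R n := fun n => by
    have : (0 : ℝ) ≤ n := n.cast_nonneg
    rw [hR]; simp only; rw [sub_pos, div_lt_one (by positivity)]; linarith
  have hR1 : ∀ n, R n < 1 := fun n => by
    rw [hR]; simp only [sub_lt_self_iff]; positivity
  have hmono : ∀ m n, m ≤ n → R m ≤ R n := fun m n hmn => by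
    rw [hR]; simp only
    have : (m : ℝ) ≤ n := by exact_mod_cast hmn
    gcongr
  choose Φ hΦd hΦe using fun n => exists_holomorphic_of_weak_dbar_zero_ball hl hw (hR0 n) (hR1 n)
  have hex : ∀ z ∈ disk, ∃ n, z ∈ Metric.ball (0 : ℂ) (R n) := fun z hz => by
    rw [mem_disk] at hz
    obtain ⟨n, hn⟩ := exists_nat_one_div_lt (sub_pos.2 hz)
    refine ⟨n, ?_⟩
    rw [mem_ball_zero_iff, hR]
    have : 1 / ((n : ℝ) + 2) ≤ 1 / (n + 1) := by gcongr; norm_num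
    simp only
    linarith
  -- Continuous functions that agree almost everywhere on an open set agree on it, so the functions
  -- on the exhausting balls glue.
  have hcons : ∀ m n, m ≤ n → EqOn (Φ m) (Φ n) (Metric.ball 0 (R m)) := fun m n hmn => by
    have hsub : Metric.ball (0 : ℂ) (R m) ⊆ Metric.ball 0 (R n) :=
      Metric.ball_subset_ball (hmono m n hmn)
    refine Measure.eqOn_open_of_ae_eq (μ := volume) ?_ Metric.isOpen_ball (hΦd m).continuousOn
      ((hΦd n).continuousOn.mono hsub)
    rw [EventuallyEq, ae_restrict_iff' measurableSet_ball]
    filter_upwards [hΦe m, hΦe n] with z h1 h2 hz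
    rw [← h1 hz, h2 (hsub hz)]
  have hcons' : ∀ m n z, z ∈ Metric.ball (0 : ℂ) (R m) → z ∈ Metric.ball (0 : ℂ) (R n) →
      Φ m z = Φ n z := fun m n z hm hn => by
    rcases le_total m n with h | h
    · exact hcons m n h hm
    · exact (hcons n m h hn).symm
  classical
  set Ψ : ℂ → ℂ := fun z => if hz : z ∈ disk then Φ (hex z hz).choose z else 0 with hΨ
  have hΨe : ∀ n, ∀ z ∈ Metric.ball (0 : ℂ) (R n), Ψ z = Φ n z := fun n z hz => by
    have hzD : z ∈ disk := Metric.ball_subset_ball (hR1 n).le hz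
    rw [hΨ]
    simp only [hzD, dif_pos]
    exact hcons' _ _ _ (hex z hzD).choose_spec hz
  refine ⟨Ψ, fun z hz => ?_, ?_⟩
  · obtain ⟨n, hn⟩ := hex z hz
    have hnhds := Metric.isOpen_ball.mem_nhds hn
    have h1 : DifferentiableAt ℂ (Φ n) z := (hΦd n).differentiableAt hnhds
    exact (h1.congr_of_eventuallyEq (mem_of_superset hnhds (hΨe n))).differentiableWithinAt
  · rw [ae_restrict_iff' measurableSet_disk]
    filter_upwards [ae_all_iff.2 hΦe] with z hz hzD
    obtain ⟨n, hn⟩ := hex z hzD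
    rw [hΨe n z hn, hz n hn]

/-! ### The representation by the operator `T̃` -/

lemma integrableOn_mul_of_compact {h b : ℂ → ℂ} (hl : LocallyIntegrableOn h disk)
    (hb : Continuous b) (hc : HasCompactSupport b) (hs : tsupport b ⊆ disk) :
    IntegrableOn (fun z => h z * b z) disk := by
  obtain ⟨M, hM⟩ := hc.exists_bound_of_continuous hb
  have h1 : IntegrableOn (fun z => h z * b z) (tsupport b) :=
    (hl.integrableOn_compact_subset hs hc).mul_bdd hb.aestronglyMeasurable (.of_forall hM)
  refine h1.of_forall_sdiff_eq_zero measurableSet_disk fun z hz => ?_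
  rw [image_eq_zero_of_notMem_tsupport hz.2, mul_zero]

lemma tsupport_dbar_subset (φ : ℂ → ℂ) : tsupport (dbar φ) ⊆ tsupport φ :=
  closure_minimal (fun _ hz => by_contra fun h => hz (dbar_eq_zero_of_notMem h))
    (isClosed_tsupport φ)

/-- The Cauchy transform of `g` has weak derivative `-π g`, so Weyl's lemma applies to `w + (1/π)
cauchyT g`. The conjugated half of `T̃ g` is holomorphic and is absorbed into `Φ`. -/
lemma exists_holomorphic_add_opT {w g : ℂ → ℂ} (hw : IsWeakDbar w g) (hg : IntegrableOn g disk) :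
    ∃ Φ : ℂ → ℂ, DifferentiableOn ℂ Φ disk ∧
      ∀ᵐ z ∂(volume.restrict disk), w z = Φ z + opT g z := by
  have hC := integrableOn_cauchyT hg
  have hpi : (Real.pi : ℂ) ≠ 0 := by exact_mod_cast Real.pi_ne_zero
  obtain ⟨Φ, hΦ, hΦe⟩ := exists_holomorphic_of_weak_dbar_zero
    (h := fun z => w z + (1 / Real.pi : ℂ) * cauchyT g z) (hw.1.add
      (IntegrableOn.locallyIntegrableOn (hC.const_mul _))) (fun φ hφ hc hs => by
    have hφ1 : ContDiff ℝ 1 φ := hφ.of_le (by exact_mod_cast le_top)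
    have hd := continuous_dbar hφ1
    have hdc := hasCompactSupport_dbar hc
    have hds := (tsupport_dbar_subset φ).trans hs
    have i1 := integrableOn_mul_of_compact hw.1 hd hdc hds
    have i2 := integrableOn_mul_of_compact hC.locallyIntegrableOn hd hdc hds
    simp_rw [add_mul, mul_assoc]
    rw [integral_add i1 (i2.const_mul _), integral_const_mul,
      integral_cauchyT_mul_dbar hg hφ1 hc hs, hw.2.2 φ hφ hc hs]
    field_simp
    ring)
  refine ⟨fun z => Φ z - -(1 / (Real.pi : ℂ)) *
      ∫ ζ in disk, z * (starRingEnd ℂ) (g ζ) / (1 - (starRingEnd ℂ) ζ * z),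
    hΦ.sub ((differentiableOn_conj_part hg).const_mul _), ?_⟩
  filter_upwards [hΦe, ae_definedT hg, ae_restrict_mem measurableSet_disk] with z h1 h2 h3
  rw [opT_eq hg h3 h2]
  linear_combination h1

/-! ### Hardy norms -/

lemma hardyNorm_lt_top_iff {p : ℝ} (hp : 0 < p) {w : ℂ → ℂ} :
    hardyNorm p w < ⊤ ↔ ∃ M : ℝ≥0∞, M < ⊤ ∧ ∀ r ∈ Ioo (0 : ℝ) 1,
      ∫⁻ θ in Ioc (0 : ℝ) (2 * Real.pi), ‖w (polarPt r θ)‖ₑ ^ p ≤ M := by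
  have hc0 : ENNReal.ofReal (1 / (2 * Real.pi)) ≠ 0 := by
    rw [Ne, ENNReal.ofReal_eq_zero, not_le]; positivity
  rw [hardyNorm, ENNReal.rpow_lt_top_iff_of_pos (by positivity)]
  constructor
  · intro h
    refine ⟨(ENNReal.ofReal (1 / (2 * Real.pi)))⁻¹ * _,
      ENNReal.mul_lt_top (ENNReal.inv_lt_top.2 (pos_iff_ne_zero.2 hc0)) h, fun r hr => ?_⟩
    have h1 := le_iSup₂ (f := fun r (_ : r ∈ Ioo (0 : ℝ) 1) => ENNReal.ofReal (1 / (2 * Real.pi)) *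
      ∫⁻ θ in Ioc (0 : ℝ) (2 * Real.pi), ‖w (polarPt r θ)‖ₑ ^ p) r hr
    rw [mul_comm _ (iSup _), ← div_eq_mul_inv, ENNReal.le_div_iff_mul_le (.inl hc0)
      (.inl ENNReal.ofReal_ne_top), mul_comm]
    exact h1
  · rintro ⟨M, hM, h⟩
    refine lt_of_le_of_lt (iSup₂_le fun r hr => ?_)
      (ENNReal.mul_lt_top (ENNReal.ofReal_lt_top (r := 1 / (2 * Real.pi))) hM)
    gcongr
    exact h r hr

lemma continuous_comp_polarPt {Φ : ℂ → ℂ} (hΦ : ContinuousOn Φ disk) {r : ℝ}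
    (hr : r ∈ Ioo (0 : ℝ) 1) : Continuous fun θ => Φ (polarPt r θ) :=
  hΦ.comp_continuous (continuous_polarPt.comp (by fun_prop : Continuous fun θ : ℝ => (r, θ)))
    fun θ => polarPt_mem_disk hr θ

/-- Radii of full measure are dense, and Fatou's lemma carries the bound to the limit radius because
`Φ` is continuous. -/
lemma lintegral_circle_le_of_ae {p : ℝ} {Φ : ℂ → ℂ} (hΦ : ContinuousOn Φ disk)
    {a : ℝ} (ha0 : 0 ≤ a) {B : ℝ≥0∞} (h : ∀ᵐ r : ℝ, r ∈ Ioo a 1 →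
      ∫⁻ θ in Ioc (0 : ℝ) (2 * Real.pi), ‖Φ (polarPt r θ)‖ₑ ^ p ≤ B) {r : ℝ} (hr : r ∈ Ioo a 1) :
    ∫⁻ θ in Ioc (0 : ℝ) (2 * Real.pi), ‖Φ (polarPt r θ)‖ₑ ^ p ≤ B := by
  set S := {r : ℝ | r ∈ Ioo a 1 → ∫⁻ θ in Ioc (0 : ℝ) (2 * Real.pi), ‖Φ (polarPt r θ)‖ₑ ^ p ≤ B}
  have hd : Dense S := Measure.dense_of_ae h
  obtain ⟨x, hxS, hx⟩ := mem_closure_iff_seq_limit.1 (hd.open_subset_closure_inter isOpen_Ioo hr)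
  have hx01 : ∀ n, x n ∈ Ioo (0 : ℝ) 1 := fun n => ⟨ha0.trans_lt (hxS n).1.1, (hxS n).1.2⟩
  have hr01 : r ∈ Ioo (0 : ℝ) 1 := ⟨ha0.trans_lt hr.1, hr.2⟩
  have hlim : ∀ θ, Tendsto (fun n => ‖Φ (polarPt (x n) θ)‖ₑ ^ p) atTop
      (𝓝 (‖Φ (polarPt r θ)‖ₑ ^ p)) := fun θ => by
    have h1 : ContinuousAt Φ (polarPt r θ) :=
      hΦ.continuousAt (isOpen_disk.mem_nhds (polarPt_mem_disk hr01 θ))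
    have h2 : Continuous fun r : ℝ => polarPt r θ :=
      continuous_polarPt.comp (by fun_prop : Continuous fun r : ℝ => (r, θ))
    exact (((h1.tendsto.comp h2.continuousAt).comp hx).enorm).ennrpow_const p
  calc _ = ∫⁻ θ in Ioc (0 : ℝ) (2 * Real.pi),
        liminf (fun n => ‖Φ (polarPt (x n) θ)‖ₑ ^ p) atTop := by
        refine lintegral_congr fun θ => (hlim θ).liminf_eq.symm
    _ ≤ liminf (fun n => ∫⁻ θ in Ioc (0 : ℝ) (2 * Real.pi), ‖Φ (polarPt (x n) θ)‖ₑ ^ p) atTop :=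
        lintegral_liminf_le fun n =>
          ((continuous_comp_polarPt hΦ (hx01 n)).enorm.measurable).pow_const p
    _ ≤ liminf (fun _ : ℕ => B) atTop :=
        liminf_le_liminf (.of_forall fun n => (hxS n).2 (hxS n).1)
    _ = B := by simp

lemma rpow_le_one_add {p : ℝ} (hp0 : 0 ≤ p) (hp1 : p ≤ 1) (x : ℝ≥0∞) : x ^ p ≤ 1 + x := by
  rcases le_total x 1 with hx | hx
  · exact (ENNReal.rpow_le_one hx hp0).trans le_self_add
  · calc x ^ p ≤ x ^ (1 : ℝ) := ENNReal.rpow_le_rpow_of_exponent_le hx hp1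
      _ = x := ENNReal.rpow_one x
      _ ≤ _ := le_add_self

/-- The holomorphic part of `w = Φ + T̃ g` belongs to the Hardy space. -/
lemma holomorphic_part_mem_holoHardy {p : ℝ} (hp0 : 0 < p) (hp1 : p ≤ 1) {s : ℝ} (hs1 : 1 < s)
    (hs2 : s < 2) {w g Φ : ℂ → ℂ} (hw : hardyNorm p w < ⊤)
    (hg : AEStronglyMeasurable g (volume.restrict disk)) (hgs : ∫⁻ z in disk, ‖g z‖ₑ ^ s < ⊤)
    (hΦ : DifferentiableOn ℂ Φ disk) (h : ∀ᵐ z ∂(volume.restrict disk), w z = Φ z + opT g z) :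
    Φ ∈ holoHardy p := by
  refine ⟨hΦ, (hardyNorm_lt_top_iff hp0).2 ?_⟩
  obtain ⟨M, hM, hMr⟩ := (hardyNorm_lt_top_iff hp0).1 hw
  obtain ⟨C, hC, hCr⟩ := exists_lintegral_circle_absPotential_le hs1 hs2
  set P := C * (∫⁻ ζ in disk, ‖g ζ‖ₑ ^ s) ^ (1 / s)
  have hP : P < ⊤ := ENNReal.mul_lt_top hC (ENNReal.rpow_lt_top_of_nonneg (by positivity) hgs.ne)
  -- The potential is controlled only on circles of radius at least `1/2`; on the smaller ones `Φ`
  -- is bounded by compactness.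
  obtain ⟨K, hK⟩ := (isCompact_closedBall (0 : ℂ) (1 / 2)).exists_bound_of_continuousOn
    (hΦ.continuousOn.mono (Metric.closedBall_subset_ball (by norm_num)))
  set B := M + (ENNReal.ofReal (2 * Real.pi) + P)
  have hae : ∀ᵐ r : ℝ, r ∈ Ioo (1 / 2 : ℝ) 1 →
      ∫⁻ θ in Ioc (0 : ℝ) (2 * Real.pi), ‖Φ (polarPt r θ)‖ₑ ^ p ≤ B := by
    filter_upwards [ae_polar h] with r hr hr1
    have hr0 : r ∈ Ioo (0 : ℝ) 1 := ⟨by linarith [hr1.1], hr1.2⟩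
    have hr2 := Ioo_subset_Icc_self hr1
    have hmeas : Measurable fun θ => absPotential g (polarPt r θ) :=
      (measurable_absPotential hg).comp (measurable_polarPt_right r)
    calc _ ≤ ∫⁻ θ in Ioc (0 : ℝ) (2 * Real.pi),
          (‖w (polarPt r θ)‖ₑ ^ p + (1 + absPotential g (polarPt r θ))) := by
          refine lintegral_mono_ae ?_
          filter_upwards [hr hr0] with θ hθ
          have e : Φ (polarPt r θ) = w (polarPt r θ) - opT g (polarPt r θ) := by
            rw [hθ]; ring
          rw [e]
          calc _ ≤ (‖w (polarPt r θ)‖ₑ + ‖opT g (polarPt r θ)‖ₑ) ^ p :=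
                ENNReal.rpow_le_rpow enorm_sub_le hp0.le
            _ ≤ ‖w (polarPt r θ)‖ₑ ^ p + ‖opT g (polarPt r θ)‖ₑ ^ p :=
                ENNReal.rpow_add_le_add_rpow _ _ hp0.le hp1
            _ ≤ _ := by
                gcongr
                refine (rpow_le_one_add hp0.le hp1 _).trans ?_
                gcongr
                exact enorm_opT_le g (norm_polarPt_le_one hr2 θ)
      _ ≤ B := by
          rw [lintegral_add_right (g := fun θ => 1 + absPotential g (polarPt r θ)) _
            (measurable_const.add hmeas),
            lintegral_add_left measurable_const]
          simp only [B]
          gcongr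
          · exact hMr r hr0
          · simp
          · exact hCr g hg r hr2
  refine ⟨max B (ENNReal.ofReal K ^ p * ENNReal.ofReal (2 * Real.pi)), ?_, fun r hr => ?_⟩
  · refine max_lt (by finiteness) (ENNReal.mul_lt_top ?_ ENNReal.ofReal_lt_top)
    exact ENNReal.rpow_lt_top_of_nonneg hp0.le ENNReal.ofReal_ne_top
  rcases le_or_gt r (1 / 2) with h2 | h2
  · refine le_max_of_le_right ?_
    calc _ ≤ ∫⁻ θ in Ioc (0 : ℝ) (2 * Real.pi), ENNReal.ofReal K ^ p := by
          refine lintegral_mono fun θ => ENNReal.rpow_le_rpow ?_ hp0.le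
          rw [← ofReal_norm]
          refine ENNReal.ofReal_le_ofReal (hK _ ?_)
          rw [mem_closedBall_zero_iff, norm_polarPt hr.1.le]
          exact h2
      _ = _ := by simp
  · exact le_max_of_le_left (lintegral_circle_le_of_ae hΦ.continuousOn (by norm_num) hae
      ⟨h2, hr.2⟩)

/-! ### Growth and integrability of functions of the Hardy space -/

lemma measurable_indicator_disk {Φ : ℂ → ℂ} (hΦ : ContinuousOn Φ disk) :
    Measurable (disk.indicator Φ) := by
  classical
  rw [← piecewise_eq_indicator]
  exact hΦ.measurable_piecewise continuousOn_const measurableSet_disk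

/-- A substitute for the subharmonicity of `|Φ|^p`: in the mean value inequality for `|Φ|` write
`|Φ| = |Φ|^{1-p} |Φ|^p`, bound the first factor by `(K |Φ z|)^{1-p}` and cancel `|Φ z|^{1-p}`. -/
lemma mean_value_rpow {Φ : ℂ → ℂ} {p : ℝ} (hp0 : 0 < p) (hp1 : p ≤ 1) {z : ℂ} {t K : ℝ} (ht : 0 < t)
    (hΦ : DifferentiableOn ℂ Φ (Metric.closedBall z t))
    (hK : ∀ ζ ∈ Metric.closedBall z t, ‖Φ ζ‖ ≤ K * ‖Φ z‖) :
    ENNReal.ofReal (2 * Real.pi) * ‖Φ z‖ₑ ^ p ≤ ENNReal.ofReal K ^ (1 - p) *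
      ∫⁻ θ in Ioc (0 : ℝ) (2 * Real.pi), ‖Φ (z + polarPt t θ)‖ₑ ^ p := by
  rcases eq_or_ne (Φ z) 0 with h0 | h0
  · simp [h0, ENNReal.zero_rpow_of_pos hp0]
  have hmem : ∀ θ, z + polarPt t θ ∈ Metric.closedBall z t := fun θ => by
    rw [Metric.mem_closedBall, dist_eq_norm, add_sub_cancel_left, norm_polarPt ht.le]
  have hK0 : 0 ≤ K := by
    have h1 := hK z (Metric.mem_closedBall_self ht.le)
    have h2 : 0 < ‖Φ z‖ := norm_pos_iff.2 h0
    nlinarith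
  have hav : ∫ θ in (0 : ℝ)..(2 * Real.pi), Φ (z + polarPt t θ) = 2 * Real.pi * Φ z := by
    have h1 : DiffContOnCl ℂ Φ (Metric.ball z |t|) := by
      rw [abs_of_pos ht]
      exact hΦ.diffContOnCl_ball subset_rfl
    have h2 := h1.circleAverage
    rw [Real.circleAverage] at h2
    have h3 : ∀ θ, circleMap z t θ = z + polarPt t θ := fun θ => rfl
    simp_rw [h3] at h2
    rw [← h2, Complex.real_smul]
    have : (Real.pi : ℂ) ≠ 0 := by exact_mod_cast Real.pi_ne_zero
    push_cast
    field_simp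
  have h1 : ENNReal.ofReal (2 * Real.pi) * ‖Φ z‖ₑ ≤
      ∫⁻ θ in Ioc (0 : ℝ) (2 * Real.pi), ‖Φ (z + polarPt t θ)‖ₑ := by
    rw [intervalIntegral.integral_of_le Real.two_pi_pos.le] at hav
    refine le_trans (le_of_eq ?_) (enorm_integral_le_lintegral_enorm _)
    rw [hav, enorm_mul, ← ofReal_norm (2 * (Real.pi : ℂ))]
    congr 2
    simp [abs_of_pos Real.pi_pos]
  have hNe : ‖Φ z‖ₑ ≠ 0 := by simpa using h0
  have h2 : ∀ θ, ‖Φ (z + polarPt t θ)‖ₑ ≤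
      (ENNReal.ofReal K * ‖Φ z‖ₑ) ^ (1 - p) * ‖Φ (z + polarPt t θ)‖ₑ ^ p := fun θ => by
    have h3 : ‖Φ (z + polarPt t θ)‖ₑ ≤ ENNReal.ofReal K * ‖Φ z‖ₑ := by
      rw [← ofReal_norm, ← ofReal_norm, ← ENNReal.ofReal_mul hK0]
      exact ENNReal.ofReal_le_ofReal (hK _ (hmem θ))
    calc ‖Φ (z + polarPt t θ)‖ₑ = ‖Φ (z + polarPt t θ)‖ₑ ^ (1 - p) *
          ‖Φ (z + polarPt t θ)‖ₑ ^ p := by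
          rw [← ENNReal.rpow_add_of_nonneg _ _ (by linarith) hp0.le, sub_add_cancel,
            ENNReal.rpow_one]
      _ ≤ _ := by
          gcongr
  have hX : ‖Φ z‖ₑ ^ (1 - p) ≠ 0 := by
    simp [ENNReal.rpow_eq_zero_iff, hNe]
  have hX' : ‖Φ z‖ₑ ^ (1 - p) ≠ ⊤ :=
    (ENNReal.rpow_lt_top_of_nonneg (by linarith) enorm_ne_top).ne
  have h4 : ‖Φ z‖ₑ ^ (1 - p) * (ENNReal.ofReal (2 * Real.pi) * ‖Φ z‖ₑ ^ p) ≤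
      ‖Φ z‖ₑ ^ (1 - p) * (ENNReal.ofReal K ^ (1 - p) *
      ∫⁻ θ in Ioc (0 : ℝ) (2 * Real.pi), ‖Φ (z + polarPt t θ)‖ₑ ^ p) := by
    calc _ = ENNReal.ofReal (2 * Real.pi) * (‖Φ z‖ₑ ^ (1 - p) * ‖Φ z‖ₑ ^ p) := by ring
      _ = ENNReal.ofReal (2 * Real.pi) * ‖Φ z‖ₑ := by
          rw [← ENNReal.rpow_add_of_nonneg _ _ (by linarith) hp0.le, sub_add_cancel,
            ENNReal.rpow_one]
      _ ≤ ∫⁻ θ in Ioc (0 : ℝ) (2 * Real.pi),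
          (ENNReal.ofReal K * ‖Φ z‖ₑ) ^ (1 - p) * ‖Φ (z + polarPt t θ)‖ₑ ^ p :=
          h1.trans (lintegral_mono h2)
      _ = _ := by
          rw [lintegral_const_mul', ENNReal.mul_rpow_of_nonneg _ _ (by linarith)]
          · ring
          · exact (ENNReal.rpow_lt_top_of_nonneg (by linarith) (by finiteness)).ne
  exact (ENNReal.mul_le_mul_iff_right hX hX').1 h4

lemma lintegral_Ioo_ofReal {ρ : ℝ} (hρ : 0 ≤ ρ) :
    ∫⁻ t in Ioo 0 ρ, ENNReal.ofReal t = ENNReal.ofReal (ρ ^ 2 / 2) := by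
  rw [← ofReal_integral_eq_lintegral_ofReal]
  · rw [← integral_Ioc_eq_integral_Ioo, ← intervalIntegral.integral_of_le hρ, integral_id]
    simp
  · exact (continuous_id.integrableOn_Icc).mono_set Ioo_subset_Icc_self
  · filter_upwards [ae_restrict_mem measurableSet_Ioo] with t ht using ht.1.le

lemma lintegral_ball_rpow_ge {Φ : ℂ → ℂ} {p : ℝ} (hp0 : 0 < p) (hp1 : p ≤ 1) {z : ℂ} {ρ K : ℝ}
    (hρ : 0 < ρ) (hsub : Metric.closedBall z ρ ⊆ disk) (hΦ : DifferentiableOn ℂ Φ disk)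
    (hK : ∀ ζ ∈ Metric.closedBall z ρ, ‖Φ ζ‖ ≤ K * ‖Φ z‖) :
    ENNReal.ofReal (Real.pi * ρ ^ 2) * ‖Φ z‖ₑ ^ p ≤ ENNReal.ofReal K ^ (1 - p) *
      ∫⁻ ζ in Metric.ball z ρ, ‖disk.indicator Φ ζ‖ₑ ^ p := by
  have hm : Measurable fun ζ => ‖disk.indicator Φ ζ‖ₑ ^ p :=
    (measurable_indicator_disk hΦ.continuousOn).enorm.pow_const p
  have hm' : Measurable fun u => ‖disk.indicator Φ (z + u)‖ₑ ^ p :=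
    hm.comp (measurable_const.add measurable_id)
  have hK' : ENNReal.ofReal K ^ (1 - p) ≠ ⊤ :=
    (ENNReal.rpow_lt_top_of_nonneg (by linarith) ENNReal.ofReal_ne_top).ne
  have e1 : ∫⁻ ζ in Metric.ball z ρ, ‖disk.indicator Φ ζ‖ₑ ^ p =
      ∫⁻ t in Ioo (0 : ℝ) ρ, ENNReal.ofReal t * ∫⁻ θ in Ioc (0 : ℝ) (2 * Real.pi),
        ‖disk.indicator Φ (z + polarPt t θ)‖ₑ ^ p := by
    have h := lintegral_ball_sub (F := fun u => ‖disk.indicator Φ (z + u)‖ₑ ^ p) z ρ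
    simp only [add_sub_cancel] at h
    have h2 := lintegral_polar_indicator hm' (measurableSet_Iio (a := ρ))
    rw [show {z : ℂ | ‖z‖ ∈ Iio ρ} = Metric.ball 0 ρ by ext; simp, Ioi_inter_Iio] at h2
    rw [h, h2]
  rw [e1, ← lintegral_const_mul' _ _ hK']
  calc _ = ∫⁻ t in Ioo (0 : ℝ) ρ, ENNReal.ofReal t * (ENNReal.ofReal (2 * Real.pi) * ‖Φ z‖ₑ ^ p) := by
        rw [lintegral_mul_const' _ _ (by finiteness), lintegral_Ioo_ofReal hρ.le, ← mul_assoc,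
          ← ENNReal.ofReal_mul (by positivity)]
        congr 2
        ring
    _ ≤ _ := by
        refine setLIntegral_mono' measurableSet_Ioo fun t ht => ?_
        have hsub' : Metric.closedBall z t ⊆ Metric.closedBall z ρ :=
          Metric.closedBall_subset_closedBall ht.2.le
        have h1 := mean_value_rpow hp0 hp1 ht.1 (hΦ.mono (hsub'.trans hsub))
          fun ζ hζ => hK ζ (hsub' hζ)
        rw [mul_left_comm (ENNReal.ofReal K ^ (1 - p))]
        gcongr ENNReal.ofReal t * ?_
        refine h1.trans (le_of_eq ?_)
        congr 2
        funext θ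
        rw [indicator_of_mem]
        refine hsub (hsub' ?_)
        rw [Metric.mem_closedBall, dist_eq_norm, add_sub_cancel_left, norm_polarPt ht.1.le]

/-- The ball lies in an annulus of width `2 ρ`, each of whose circles contributes at most `M`. This
bound is linear in `ρ`, against the area of order `ρ²` in `lintegral_ball_rpow_ge`, whence `|Φ z|^p
≲ 1/ρ`. -/
lemma lintegral_ball_rpow_le {Φ : ℂ → ℂ} {p : ℝ} {M : ℝ≥0∞} (hΦ : ContinuousOn Φ disk)
    (hM : ∀ r ∈ Ioo (0 : ℝ) 1, ∫⁻ θ in Ioc (0 : ℝ) (2 * Real.pi), ‖Φ (polarPt r θ)‖ₑ ^ p ≤ M)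
    {z : ℂ} {ρ : ℝ} (hz : ‖z‖ + ρ < 1) :
    ∫⁻ ζ in Metric.ball z ρ, ‖disk.indicator Φ ζ‖ₑ ^ p ≤ ENNReal.ofReal (2 * ρ) * M := by
  have hm : Measurable fun ζ => ‖disk.indicator Φ ζ‖ₑ ^ p :=
    (measurable_indicator_disk hΦ).enorm.pow_const p
  calc _ ≤ ∫⁻ ζ in {ζ : ℂ | ‖ζ‖ ∈ Ioo (‖z‖ - ρ) (‖z‖ + ρ)}, ‖disk.indicator Φ ζ‖ₑ ^ p := by
        refine lintegral_mono_set fun ζ hζ => ?_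
        rw [Metric.mem_ball, dist_eq_norm] at hζ
        have h1 := norm_sub_norm_le ζ z
        have h2 := norm_sub_norm_le z ζ
        rw [norm_sub_rev] at h2
        exact ⟨by linarith, by linarith⟩
    _ = _ := lintegral_polar_indicator hm measurableSet_Ioo
    _ ≤ ∫⁻ r in Ioi (0 : ℝ) ∩ Ioo (‖z‖ - ρ) (‖z‖ + ρ), M := by
        refine setLIntegral_mono' (measurableSet_Ioi.inter measurableSet_Ioo) fun r hr => ?_
        have hr' : r ∈ Ioo (0 : ℝ) 1 := ⟨hr.1, by linarith [hr.2.2]⟩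
        have h1 : ENNReal.ofReal r ≤ 1 := by
          rw [ENNReal.ofReal_le_one]; exact hr'.2.le
        refine (mul_le_of_le_one_left' h1).trans (le_of_eq_of_le ?_ (hM r hr'))
        congr 1
        funext θ
        rw [indicator_of_mem (polarPt_mem_disk hr' θ)]
    _ ≤ ∫⁻ r in Ioo (‖z‖ - ρ) (‖z‖ + ρ), M := lintegral_mono_set inter_subset_right
    _ = _ := by
        rw [lintegral_const, Measure.restrict_apply MeasurableSet.univ, univ_inter,
          Real.volume_Ioo, mul_comm]
        congr 2
        ring

/-- Functions of the Hardy space `H^p(D)` grow at most like `(1 - |z|)^{-1/p}`. -/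
lemma exists_growth_of_holoHardy {p : ℝ} (hp0 : 0 < p) (hp1 : p ≤ 1) {Φ : ℂ → ℂ}
    (hΦ : Φ ∈ holoHardy p) :
    ∃ C : ℝ, 0 ≤ C ∧ ∀ z ∈ disk, ‖Φ z‖ ≤ C * (1 - ‖z‖) ^ (-(1 / p)) := by
  obtain ⟨hd, hn⟩ := hΦ
  obtain ⟨M, hM, hMr⟩ := (hardyNorm_lt_top_iff hp0).1 hn
  set a := 1 / p with ha
  have ha0 : 0 < a := by positivity
  set K : ℝ := 2 ^ a with hKdef
  have hK0 : 0 < K := by positivity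
  set B : ℝ := 4 / Real.pi * (ENNReal.ofReal K ^ (1 - p) * M).toReal with hB
  have hB0 : 0 ≤ B := by positivity
  have hfin : ENNReal.ofReal K ^ (1 - p) * M ≠ ⊤ := (ENNReal.mul_lt_top
    (ENNReal.rpow_lt_top_of_nonneg (by linarith) ENNReal.ofReal_ne_top) hM).ne
  have main : ∀ R ∈ Ioo (0 : ℝ) 1, ∀ z ∈ Metric.closedBall (0 : ℂ) R,
      (R - ‖z‖) ^ a * ‖Φ z‖ ≤ B ^ a := by
    intro R hR
    have hsubR : Metric.closedBall (0 : ℂ) R ⊆ disk := Metric.closedBall_subset_ball hR.2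
    have hcont : ContinuousOn (fun z : ℂ => (R - ‖z‖) ^ a * ‖Φ z‖) (Metric.closedBall 0 R) := by
      refine ContinuousOn.mul ?_ (hd.continuousOn.mono hsubR).norm
      exact (Continuous.rpow_const (by fun_prop) fun _ => .inr ha0.le).continuousOn
    -- Around a maximum point of the weighted modulus, on the ball of half the distance to the
    -- circle of radius `R`, one has `|Φ| ≤ 2^{1/p} |Φ z₀|`. This supplies the constant `K` of the
    -- mean value estimate; taking `R < 1` ensures that the maximum is attained.
    obtain ⟨z₀, hz₀, hmax⟩ := (isCompact_closedBall (0 : ℂ) R).exists_isMaxOn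
      ⟨0, by simp [hR.1.le]⟩ hcont
    refine fun z hz => (hmax hz).trans ?_
    have hz₀' : ‖z₀‖ ≤ R := by simpa using hz₀
    rcases hz₀'.eq_or_lt with heq | hlt
    · simp only [heq, sub_self, Real.zero_rpow ha0.ne', zero_mul]
      positivity
    set ρ := (R - ‖z₀‖) / 2 with hρ
    have hρ0 : 0 < ρ := by rw [hρ]; linarith
    have hRρ : R - ‖z₀‖ = 2 * ρ := by rw [hρ]; ring
    have hζ : ∀ ζ ∈ Metric.closedBall z₀ ρ, ‖ζ‖ ≤ R - ρ := fun ζ hζ => by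
      rw [Metric.mem_closedBall, dist_eq_norm] at hζ
      have h1 := norm_sub_norm_le ζ z₀
      linarith
    have hsub : Metric.closedBall z₀ ρ ⊆ disk := fun ζ h => by
      rw [mem_disk]; linarith [hζ ζ h, hR.2]
    have hKb : ∀ ζ ∈ Metric.closedBall z₀ ρ, ‖Φ ζ‖ ≤ K * ‖Φ z₀‖ := fun ζ h => by
      have h1 : (R - ‖ζ‖) ^ a * ‖Φ ζ‖ ≤ (R - ‖z₀‖) ^ a * ‖Φ z₀‖ :=
        hmax (by rw [mem_closedBall_zero_iff]; linarith [hζ ζ h])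
      have h2 : ρ ^ a ≤ (R - ‖ζ‖) ^ a :=
        Real.rpow_le_rpow hρ0.le (by linarith [hζ ζ h]) ha0.le
      rw [hRρ, Real.mul_rpow zero_le_two hρ0.le] at h1
      have h3 : 0 < ρ ^ a := by positivity
      refine le_of_mul_le_mul_left ?_ h3
      calc ρ ^ a * ‖Φ ζ‖ ≤ (R - ‖ζ‖) ^ a * ‖Φ ζ‖ := by gcongr
        _ ≤ _ := h1
        _ = _ := by rw [hKdef]; ring
    have h1 := lintegral_ball_rpow_ge hp0 hp1 hρ0 hsub hd hKb
    have h2 := lintegral_ball_rpow_le hd.continuousOn hMr (z := z₀) (ρ := ρ) (by linarith [hR.2])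
    have h3 : ENNReal.ofReal (Real.pi * ρ ^ 2) * ‖Φ z₀‖ₑ ^ p ≤
        ENNReal.ofReal (2 * ρ) * (ENNReal.ofReal K ^ (1 - p) * M) := by
      refine h1.trans ?_
      rw [mul_left_comm]
      gcongr
    have h4 : Real.pi * ρ ^ 2 * ‖Φ z₀‖ ^ p ≤ 2 * ρ * (ENNReal.ofReal K ^ (1 - p) * M).toReal := by
      have h5 := ENNReal.toReal_mono (ENNReal.mul_ne_top ENNReal.ofReal_ne_top hfin) h3
      rw [ENNReal.toReal_mul, ENNReal.toReal_mul, ENNReal.toReal_ofReal (by positivity),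
        ENNReal.toReal_ofReal (by positivity), ← ENNReal.toReal_rpow, toReal_enorm] at h5
      exact h5
    have h5 : 2 * ρ * ‖Φ z₀‖ ^ p ≤ B := by
      rw [hB, div_mul_eq_mul_div, le_div_iff₀ Real.pi_pos]
      refine le_of_mul_le_mul_left ?_ hρ0
      linarith
    have h6 : (2 * ρ) ^ a * ‖Φ z₀‖ = (2 * ρ * ‖Φ z₀‖ ^ p) ^ a := by
      rw [Real.mul_rpow (x := 2 * ρ) (y := ‖Φ z₀‖ ^ p) (by positivity) (by positivity),
        ← Real.rpow_mul (norm_nonneg _), ha,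
        mul_one_div_cancel hp0.ne', Real.rpow_one]
    simp only [hRρ]
    rw [h6]
    exact Real.rpow_le_rpow (by positivity) h5 ha0.le
  refine ⟨K * B ^ a, by positivity, fun z hz => ?_⟩
  rw [mem_disk] at hz
  have h0 : 0 ≤ ‖z‖ := norm_nonneg z
  -- With this `R`, `R - |z|` is half of `1 - |z|`, which costs the factor `K = 2^{1/p}`.
  have h1 := main ((1 + ‖z‖) / 2) ⟨by linarith, by linarith⟩ z (by
    rw [mem_closedBall_zero_iff]; linarith)
  have hpos : 0 < 1 - ‖z‖ := by linarith
  rw [show (1 + ‖z‖) / 2 - ‖z‖ = (1 - ‖z‖) / 2 by ring, Real.div_rpow hpos.le zero_le_two,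
    div_mul_eq_mul_div, div_le_iff₀ hK0] at h1
  rw [Real.rpow_neg hpos.le, ← div_eq_mul_inv, le_div_iff₀ (by positivity)]
  linarith

/-- `H^p(D) ⊆ L^s(D)` for `p ≤ s < 2 p`. -/
lemma lintegral_rpow_lt_top_of_holoHardy {p : ℝ} (hp0 : 0 < p) (hp1 : p ≤ 1) {s : ℝ} (hps : p ≤ s)
    (hs : s < 2 * p) {Φ : ℂ → ℂ} (hΦ : Φ ∈ holoHardy p) : ∫⁻ z in disk, ‖Φ z‖ₑ ^ s < ⊤ := by
  obtain ⟨C, hC0, hC⟩ := exists_growth_of_holoHardy hp0 hp1 hΦ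
  obtain ⟨hd, hn⟩ := hΦ
  obtain ⟨M, hM, hMr⟩ := (hardyNorm_lt_top_iff hp0).1 hn
  have hsp : 0 ≤ s - p := by linarith
  have e : ∫⁻ z in disk, ‖Φ z‖ₑ ^ s = ∫⁻ z in disk, ‖disk.indicator Φ z‖ₑ ^ s :=
    setLIntegral_congr_fun measurableSet_disk fun z hz => by rw [indicator_of_mem hz]
  rw [e, lintegral_disk_polar ((measurable_indicator_disk hd.continuousOn).enorm.pow_const s)]
  -- In `|Φ|^s = |Φ|^{s-p} |Φ|^p` the growth bound is applied to the first factor only. The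
  -- resulting weight is integrable because `s < 2p`.
  have hint : IntegrableOn (fun r : ℝ => (1 - r) ^ (-((s - p) / p))) (Ioo 0 1) := by
    have h1 : IntervalIntegrable (fun r : ℝ => r ^ (-((s - p) / p))) volume 0 1 :=
      intervalIntegral.intervalIntegrable_rpow' (by rw [neg_lt_neg_iff, div_lt_one hp0]; linarith)
    have h2 := (h1.comp_sub_left 1).symm
    simp only [sub_self, sub_zero] at h2
    rw [intervalIntegrable_iff_integrableOn_Ioo_of_le zero_le_one] at h2
    exact h2
  calc _ ≤ ∫⁻ r in Ioo (0 : ℝ) 1,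
        (ENNReal.ofReal (C ^ (s - p)) * M) * ‖(1 - r) ^ (-((s - p) / p))‖ₑ := by
        refine setLIntegral_mono' measurableSet_Ioo fun r hr => ?_
        have hpos : 0 < 1 - r := by linarith [hr.2]
        have h1 : ENNReal.ofReal r ≤ 1 := by
          rw [ENNReal.ofReal_le_one]; exact hr.2.le
        refine (mul_le_of_le_one_left' h1).trans ?_
        have hb : ∀ θ, ‖disk.indicator Φ (polarPt r θ)‖ₑ ^ s ≤
            (ENNReal.ofReal (C ^ (s - p)) * ‖(1 - r) ^ (-((s - p) / p))‖ₑ) *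
              ‖Φ (polarPt r θ)‖ₑ ^ p := fun θ => by
          rw [indicator_of_mem (polarPt_mem_disk hr θ)]
          have h2 := hC _ (polarPt_mem_disk hr θ)
          rw [norm_polarPt hr.1.le] at h2
          calc ‖Φ (polarPt r θ)‖ₑ ^ s = ‖Φ (polarPt r θ)‖ₑ ^ (s - p) * ‖Φ (polarPt r θ)‖ₑ ^ p := by
                rw [← ENNReal.rpow_add_of_nonneg _ _ hsp hp0.le, sub_add_cancel]
            _ ≤ _ := by
                gcongr
                rw [← ofReal_norm, ENNReal.ofReal_rpow_of_nonneg (norm_nonneg _) hsp,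
                  ← ofReal_norm, ← ENNReal.ofReal_mul (by positivity)]
                refine ENNReal.ofReal_le_ofReal ?_
                refine (Real.rpow_le_rpow (norm_nonneg _) h2 hsp).trans (le_of_eq ?_)
                rw [Real.mul_rpow hC0 (by positivity), ← Real.rpow_mul hpos.le,
                  Real.norm_of_nonneg (by positivity)]
                congr 2
                ring
        refine (lintegral_mono hb).trans ?_
        rw [lintegral_const_mul' _ _ (by finiteness)]
        calc _ ≤ (ENNReal.ofReal (C ^ (s - p)) * ‖(1 - r) ^ (-((s - p) / p))‖ₑ) * M := by
              gcongr
              exact hMr r hr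
          _ = _ := by ring
    _ = (ENNReal.ofReal (C ^ (s - p)) * M) *
          ∫⁻ r in Ioo (0 : ℝ) 1, ‖(1 - r) ^ (-((s - p) / p))‖ₑ :=
        lintegral_const_mul' _ _ (by finiteness)
    _ < ⊤ := ENNReal.mul_lt_top (by finiteness) hint.2

/-! ### Boundary values of holomorphic functions of polynomial growth -/

/-- The integral `∫ e^{imθ} φ(θ) dθ`. -/
noncomputable def circleCoeff (m : ℕ) (φ : ℝ → ℂ) : ℂ :=
  ∫ θ in (0 : ℝ)..(2 * Real.pi), Complex.exp (m * θ * Complex.I) * φ θ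

lemma deriv_mem_circleTest {φ : ℝ → ℂ} (h : φ ∈ circleTest) : deriv φ ∈ circleTest := by
  refine ⟨?_, fun θ => ?_⟩
  · have h1 : ContDiff ℝ ((⊤ : ℕ∞) + 1) φ := by simpa using h.1
    exact ((contDiff_succ_iff_deriv (n := ((⊤ : ℕ∞) : WithTop ℕ∞))).1 h1).2.2
  · rw [← deriv_comp_add_const]
    congr 1
    exact funext h.2

lemma iteratedDeriv_mem_circleTest {φ : ℝ → ℂ} (h : φ ∈ circleTest) (N : ℕ) :
    iteratedDeriv N φ ∈ circleTest := by
  induction N with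
  | zero => simpa using h
  | succ N ih =>
    rw [iteratedDeriv_succ]
    exact deriv_mem_circleTest ih

lemma circleCoeff_deriv (m : ℕ) {φ : ℝ → ℂ} (h : φ ∈ circleTest) :
    circleCoeff m (deriv φ) = -(m * Complex.I) * circleCoeff m φ := by
  have he : ∀ θ : ℝ, HasDerivAt (fun θ : ℝ => Complex.exp (m * θ * Complex.I))
      (m * Complex.I * Complex.exp (m * θ * Complex.I)) θ := fun θ => by
    have h1 : HasDerivAt (fun θ : ℝ => (m : ℂ) * θ * Complex.I) (m * Complex.I) θ := by
      simpa using ((Complex.ofRealCLM.hasDerivAt (x := θ)).const_mul (m : ℂ)).mul_const Complex.I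
    have h2 := h1.cexp
    rwa [mul_comm (Complex.exp _)] at h2
  have hφ : Differentiable ℝ φ := h.1.differentiable (by simp)
  have hcd : Continuous (deriv φ) := (deriv_mem_circleTest h).1.continuous
  have key := intervalIntegral.integral_mul_deriv_eq_deriv_mul (a := 0) (b := 2 * Real.pi)
    (u := fun θ : ℝ => Complex.exp (m * θ * Complex.I)) (v := φ)
    (fun θ _ => he θ) (fun θ _ => (hφ θ).hasDerivAt)
    (Continuous.intervalIntegrable (by fun_prop) _ _) (hcd.intervalIntegrable _ _)
  have hb : Complex.exp (m * ((2 * Real.pi : ℝ) : ℂ) * Complex.I) = 1 := by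
    rw [← Complex.exp_nat_mul_two_pi_mul_I m]
    congr 1; push_cast; ring
  have hb' : φ (2 * Real.pi) = φ 0 := by simpa using h.2 0
  rw [hb, hb'] at key
  rw [circleCoeff, key, circleCoeff, ← intervalIntegral.integral_const_mul]
  simp only [Complex.ofReal_zero, mul_zero, zero_mul, Complex.exp_zero, one_mul, sub_self, zero_sub]
  rw [← intervalIntegral.integral_neg]
  congr 1; funext θ; ring

lemma circleCoeff_iteratedDeriv (m N : ℕ) {φ : ℝ → ℂ} (h : φ ∈ circleTest) :
    circleCoeff m (iteratedDeriv N φ) = (-(m * Complex.I)) ^ N * circleCoeff m φ := by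
  induction N with
  | zero => simp
  | succ N ih =>
    rw [iteratedDeriv_succ, circleCoeff_deriv m (iteratedDeriv_mem_circleTest h N), ih]
    ring

lemma norm_circleCoeff_le (m : ℕ) {φ : ℝ → ℂ} {M : ℝ} (hM : ∀ θ, ‖φ θ‖ ≤ M) :
    ‖circleCoeff m φ‖ ≤ 2 * Real.pi * M := by
  have := intervalIntegral.norm_integral_le_of_norm_le_const (a := 0) (b := 2 * Real.pi) (C := M)
    (f := fun θ : ℝ => Complex.exp (m * θ * Complex.I) * φ θ) fun θ _ => by
      rw [norm_mul, show (m : ℂ) * θ * Complex.I = ((m * θ : ℝ) : ℂ) * Complex.I by push_cast; ring,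
        Complex.norm_exp_ofReal_mul_I, one_mul]
      exact hM θ
  rw [sub_zero, abs_of_pos Real.two_pi_pos] at this
  rw [circleCoeff]
  linarith

/-- `N` integrations by parts give decay of order `m^{-N}`; the factor `2^N` comes from `m + 1 ≤
2m`, and `m = 0` is bounded directly. -/
lemma norm_circleCoeff_mul_pow_le (m N : ℕ) {φ : ℝ → ℂ} (h : φ ∈ circleTest) {M : ℝ}
    (hM : ∀ k ≤ N, ∀ θ, ‖iteratedDeriv k φ θ‖ ≤ M) :
    ‖circleCoeff m φ‖ * ((m : ℝ) + 1) ^ N ≤ 2 ^ N * (2 * Real.pi * M) := by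
  have hM0 : 0 ≤ M := (norm_nonneg _).trans (hM 0 (Nat.zero_le _) 0)
  rcases Nat.eq_zero_or_pos m with rfl | hm
  · have h1 := norm_circleCoeff_le 0 (φ := φ) (M := M) fun θ => by simpa using hM 0 (Nat.zero_le _) θ
    simp only [Nat.cast_zero, zero_add, one_pow, mul_one]
    have h2 : (1 : ℝ) ≤ 2 ^ N := one_le_pow₀ one_le_two
    have h3 : 0 ≤ 2 * Real.pi * M := by positivity
    nlinarith
  · have h1 := norm_circleCoeff_le m (hM N le_rfl)
    rw [circleCoeff_iteratedDeriv m N h, norm_mul, norm_pow, norm_neg, norm_mul, Complex.norm_I,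
      mul_one, Complex.norm_natCast] at h1
    have h2 : ((m : ℝ) + 1) ^ N ≤ (2 * m) ^ N := by
      have : (1 : ℝ) ≤ m := by exact_mod_cast hm
      gcongr
      linarith
    calc _ ≤ ‖circleCoeff m φ‖ * (2 * m) ^ N := by gcongr
      _ = 2 ^ N * ((m : ℝ) ^ N * ‖circleCoeff m φ‖) := by rw [mul_pow]; ring
      _ ≤ _ := by gcongr

lemma circleTest_bounded_derivs (φ : circleTest) (N : ℕ) :
    ∃ M, ∀ k ≤ N, ∀ θ, ‖iteratedDeriv k (φ : ℝ → ℂ) θ‖ ≤ M := by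
  choose M hM0 hM using fun k => circleTest_bounded ⟨_, iteratedDeriv_mem_circleTest φ.2 k⟩
  refine ⟨∑ k ∈ Finset.range (N + 1), M k, fun k hk θ => (hM k θ).trans ?_⟩
  exact Finset.single_le_sum (f := M) (fun i _ => hM0 i) (Finset.mem_range.2 (by omega))

lemma summable_inv_add_one_sq : Summable fun m : ℕ => 1 / ((m : ℝ) + 1) ^ 2 := by
  have := (summable_nat_add_iff 1).2 (Real.summable_one_div_nat_pow (p := 2).2 one_lt_two)
  simpa using this

/-- Two derivatives beyond the growth order `N` of the coefficients leave a summable majorant. -/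
lemma norm_coeff_mul_circleCoeff_le {a : ℕ → ℂ} {A : ℝ} {N : ℕ} (hA : 0 ≤ A)
    (ha : ∀ m, ‖a m‖ ≤ A * ((m : ℝ) + 1) ^ N) {φ : ℝ → ℂ} (h : φ ∈ circleTest) {M : ℝ}
    (hM : ∀ k ≤ N + 2, ∀ θ, ‖iteratedDeriv k φ θ‖ ≤ M) (m : ℕ) :
    ‖a m * circleCoeff m φ‖ ≤ A * (2 ^ (N + 2) * (2 * Real.pi)) * M * (1 / ((m : ℝ) + 1) ^ 2) := by
  have h1 := norm_circleCoeff_mul_pow_le m (N + 2) h hM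
  rw [norm_mul, mul_one_div, le_div_iff₀ (by positivity)]
  calc _ ≤ A * ((m : ℝ) + 1) ^ N * ‖circleCoeff m φ‖ * ((m : ℝ) + 1) ^ 2 := by
        gcongr
        exact ha m
    _ = A * (‖circleCoeff m φ‖ * ((m : ℝ) + 1) ^ (N + 2)) := by ring
    _ ≤ A * (2 ^ (N + 2) * (2 * Real.pi * M)) := by gcongr
    _ = _ := by ring

lemma summable_coeff_mul_circleCoeff {a : ℕ → ℂ} {A : ℝ} {N : ℕ} (hA : 0 ≤ A)
    (ha : ∀ m, ‖a m‖ ≤ A * ((m : ℝ) + 1) ^ N) (φ : circleTest) :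
    Summable fun m => ‖a m * circleCoeff m (φ : ℝ → ℂ)‖ := by
  obtain ⟨M, hM⟩ := circleTest_bounded_derivs φ (N + 2)
  exact Summable.of_nonneg_of_le (fun _ => norm_nonneg _)
    (norm_coeff_mul_circleCoeff_le hA ha φ.2 hM) (summable_inv_add_one_sq.mul_left _)

/-- The distribution `∑ a_m e^{imθ}`, for coefficients of polynomial growth. -/
noncomputable def circleDistributionOfCoeff (a : ℕ → ℂ) {A : ℝ} {N : ℕ} (hA : 0 ≤ A)
    (ha : ∀ m, ‖a m‖ ≤ A * ((m : ℝ) + 1) ^ N) : circleDistribution := by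
  have hi : ∀ (m : ℕ) (φ : circleTest), IntervalIntegrable
      (fun θ : ℝ => Complex.exp (m * θ * Complex.I) * (φ : ℝ → ℂ) θ) volume 0 (2 * Real.pi) :=
    fun m φ => Continuous.intervalIntegrable
      ((by fun_prop : Continuous fun θ : ℝ => Complex.exp (m * θ * Complex.I)).mul
        (circleTest_continuous φ)) _ _
  refine ⟨{ toFun := fun φ => ∑' m, a m * circleCoeff m (φ : ℝ → ℂ)
            map_add' := fun φ ψ => ?_
            map_smul' := fun c φ => ?_ }, N + 2,
            A * (2 ^ (N + 2) * (2 * Real.pi)) * ∑' m : ℕ, (1 / ((m : ℝ) + 1) ^ 2),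
            ?_, fun φ M hM => ?_⟩
  · rw [← (summable_coeff_mul_circleCoeff hA ha φ).of_norm.tsum_add
      (summable_coeff_mul_circleCoeff hA ha ψ).of_norm]
    congr 1; funext m
    rw [← mul_add]
    congr 1
    simp only [circleCoeff, Submodule.coe_add, Pi.add_apply, mul_add]
    exact intervalIntegral.integral_add (hi m φ) (hi m ψ)
  · rw [RingHom.id_apply, smul_eq_mul, ← tsum_mul_left]
    congr 1; funext m
    rw [mul_left_comm]
    congr 1
    simp only [circleCoeff, Submodule.coe_smul, Pi.smul_apply, smul_eq_mul]
    rw [← intervalIntegral.integral_const_mul]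
    congr 1; funext θ; ring
  · have : 0 ≤ ∑' m : ℕ, (1 / ((m : ℝ) + 1) ^ 2) := tsum_nonneg fun m => by positivity
    positivity
  · simp only [LinearMap.coe_mk, AddHom.coe_mk]
    refine (norm_tsum_le_tsum_norm (summable_coeff_mul_circleCoeff hA ha φ)).trans ?_
    refine ((summable_coeff_mul_circleCoeff hA ha φ).tsum_le_tsum
      (norm_coeff_mul_circleCoeff_le hA ha φ.2 hM) (summable_inv_add_one_sq.mul_left _)).trans ?_
    rw [tsum_mul_left]
    exact le_of_eq (by ring)

lemma circleDistributionOfCoeff_apply (a : ℕ → ℂ) {A : ℝ} {N : ℕ} (hA : 0 ≤ A)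
    (ha : ∀ m, ‖a m‖ ≤ A * ((m : ℝ) + 1) ^ N) (φ : circleTest) :
    (circleDistributionOfCoeff a hA ha : circleTest →ₗ[ℂ] ℂ) φ =
      ∑' m, a m * circleCoeff m (φ : ℝ → ℂ) := rfl

lemma polarPt_pow (r θ : ℝ) (m : ℕ) :
    polarPt r θ ^ m = (r : ℂ) ^ m * Complex.exp (m * θ * Complex.I) := by
  rw [polarPt, mul_pow, ← Complex.exp_nat_mul, mul_assoc]

lemma summable_add_one_pow_mul_geometric {r : ℝ} (hr : r ∈ Ioo (0 : ℝ) 1) (N : ℕ) :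
    Summable fun m : ℕ => ((m : ℝ) + 1) ^ N * r ^ m := by
  have h1 := summable_pow_mul_geometric_of_norm_lt_one N (r := r)
    (by rw [Real.norm_of_nonneg hr.1.le]; exact hr.2)
  have h2 := ((summable_nat_add_iff 1).2 h1).mul_right r⁻¹
  refine h2.congr fun m => ?_
  have := hr.1.ne'
  rw [pow_succ, ← mul_assoc, mul_assoc _ r, mul_inv_cancel₀ this, mul_one]
  push_cast
  rfl

/-- For `r < 1` the power series may be integrated term by term. The resulting series is dominated
by its value at `r = 1`, absolutely convergent by the smoothness of `φ`, so the limit passes inside.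
-/
lemma hasBoundaryValue_of_hasSum {Φ : ℂ → ℂ} (hΦ : ContinuousOn Φ disk) {a : ℕ → ℂ} {A : ℝ} {N : ℕ}
    (hA : 0 ≤ A) (ha : ∀ m, ‖a m‖ ≤ A * ((m : ℝ) + 1) ^ N)
    (hs : ∀ z ∈ disk, HasSum (fun m => a m * z ^ m) (Φ z)) :
    HasBoundaryValue Φ (circleDistributionOfCoeff a hA ha) := by
  have hev : ∀ᶠ r in 𝓝[<] (1 : ℝ), r ∈ Ioo (0 : ℝ) 1 := Ioo_mem_nhdsLT zero_lt_one
  refine ⟨?_, fun φ => ?_⟩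
  · filter_upwards [hev] with r hr
    exact (continuous_comp_polarPt hΦ hr).intervalIntegrable _ _
  rw [circleDistributionOfCoeff_apply]
  obtain ⟨M, hM0, hM⟩ := circleTest_bounded φ
  have key : ∀ r ∈ Ioo (0 : ℝ) 1, ∫ θ in (0 : ℝ)..(2 * Real.pi), Φ (polarPt r θ) * (φ : ℝ → ℂ) θ =
      ∑' m, (r : ℂ) ^ m * (a m * circleCoeff m (φ : ℝ → ℂ)) := fun r hr => by
    have hsum := (summable_add_one_pow_mul_geometric hr N).mul_left (A * M)
    have h1 := intervalIntegral.hasSum_integral_of_dominated_convergence (μ := volume)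
      (a := 0) (b := 2 * Real.pi)
      (F := fun m θ => a m * polarPt r θ ^ m * (φ : ℝ → ℂ) θ)
      (f := fun θ => Φ (polarPt r θ) * (φ : ℝ → ℂ) θ)
      (fun m _ => A * M * (((m : ℝ) + 1) ^ N * r ^ m)) (fun m => ?_) (fun m => ?_)
      (.of_forall fun _ _ => hsum) intervalIntegrable_const
      (.of_forall fun θ _ => (hs _ (polarPt_mem_disk hr θ)).mul_right _)
    · rw [← h1.tsum_eq]
      congr 1; funext m
      rw [circleCoeff, ← intervalIntegral.integral_const_mul, ← intervalIntegral.integral_const_mul]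
      congr 1; funext θ
      rw [polarPt_pow]; ring
    · refine Continuous.aestronglyMeasurable ?_
      refine (continuous_const.mul (Continuous.pow ?_ m)).mul (circleTest_continuous φ)
      exact continuous_polarPt.comp (by fun_prop : Continuous fun θ : ℝ => (r, θ))
    · refine .of_forall fun θ _ => ?_
      rw [norm_mul, norm_mul, norm_pow, norm_polarPt hr.1.le]
      calc _ ≤ A * ((m : ℝ) + 1) ^ N * r ^ m * M := by
            have := hr.1.le
            gcongr
            · exact ha m
            · exact hM θ
        _ = _ := by ring
  have hlim : Tendsto (fun r : ℝ => ∑' m, (r : ℂ) ^ m * (a m * circleCoeff m (φ : ℝ → ℂ))) (𝓝[<] 1)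
      (𝓝 (∑' m, a m * circleCoeff m (φ : ℝ → ℂ))) := by
    refine tendsto_tsum_of_dominated_convergence (summable_coeff_mul_circleCoeff hA ha φ)
      (fun m => ?_) ?_
    · have h1 : Tendsto (fun r : ℝ => (r : ℂ) ^ m * (a m * circleCoeff m (φ : ℝ → ℂ))) (𝓝 1)
          (𝓝 (((1 : ℝ) : ℂ) ^ m * (a m * circleCoeff m (φ : ℝ → ℂ)))) :=
        Continuous.tendsto (by fun_prop) 1
      simp only [Complex.ofReal_one, one_pow, one_mul] at h1
      exact h1.mono_left nhdsWithin_le_nhds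
    · filter_upwards [hev] with r hr m
      rw [norm_mul, norm_pow, Complex.norm_real, Real.norm_of_nonneg hr.1.le]
      exact mul_le_of_le_one_left (norm_nonneg _) (pow_le_one₀ hr.1.le hr.2.le)
  refine hlim.congr' ?_
  filter_upwards [hev] with r hr using (key r hr).symm

/-- Cauchy's estimate on the circle of radius `r = (m+1)/(m+2)`, where `1 - r = 1/(m+2)` and `r^{-m}
≤ e`. The factor `2^N` comes from `m + 2 ≤ 2(m+1)`. -/
lemma norm_taylor_coeff_le {Φ : ℂ → ℂ} (hΦ : DifferentiableOn ℂ Φ disk) {C : ℝ} (hC0 : 0 ≤ C) {N : ℕ}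
    (hC : ∀ z ∈ disk, ‖Φ z‖ ≤ C * ((1 - ‖z‖) ^ N)⁻¹) (m : ℕ) :
    ‖((m.factorial : ℂ))⁻¹ * iteratedDeriv m Φ 0‖ ≤ C * Real.exp 1 * 2 ^ N * ((m : ℝ) + 1) ^ N := by
  set r : ℝ := ((m : ℝ) + 1) / (m + 2) with hr
  have hm0 : (0 : ℝ) ≤ m := m.cast_nonneg
  have hr0 : 0 < r := by positivity
  have hr1 : r < 1 := by rw [hr, div_lt_one (by positivity)]; linarith
  have h1r : 1 - r = ((m : ℝ) + 2)⁻¹ := by rw [hr]; field_simp; ring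
  have h1 := Complex.norm_iteratedDeriv_le_of_forall_mem_sphere_norm_le (c := 0) (f := Φ)
    (C := C * ((m : ℝ) + 2) ^ N) m hr0
    ((hΦ.mono (Metric.closedBall_subset_ball hr1)).diffContOnCl_ball subset_rfl) fun z hz => by
      have hz' : ‖z‖ = r := by simpa using hz
      have h2 := hC z (by rw [mem_disk, hz']; exact hr1)
      rwa [hz', h1r, inv_pow, inv_inv] at h2
  have hfac : (0 : ℝ) < m.factorial := by exact_mod_cast m.factorial_pos
  have hrm : (r ^ m)⁻¹ ≤ Real.exp 1 := by
    have e : r⁻¹ = 1 / ((m : ℝ) + 1) + 1 := by rw [hr]; field_simp; ring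
    rw [← inv_pow, e]
    calc _ ≤ Real.exp (1 / ((m : ℝ) + 1)) ^ m := by
          gcongr
          exact Real.add_one_le_exp _
      _ = Real.exp (m * (1 / ((m : ℝ) + 1))) := (Real.exp_nat_mul _ _).symm
      _ ≤ _ := by
          rw [Real.exp_le_exp, mul_one_div, div_le_one (by positivity)]
          linarith
  rw [norm_mul, norm_inv, Complex.norm_natCast, inv_mul_le_iff₀ hfac]
  refine h1.trans ?_
  rw [div_eq_mul_inv, mul_assoc]
  refine mul_le_mul_of_nonneg_left ?_ hfac.le
  calc C * ((m : ℝ) + 2) ^ N * (r ^ m)⁻¹ ≤ C * (2 * ((m : ℝ) + 1)) ^ N * Real.exp 1 := by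
        gcongr
        linarith
    _ = _ := by rw [mul_pow]; ring

/-- Functions of the Hardy space have boundary values in the sense of distributions. -/
lemma exists_hasBoundaryValue_of_holoHardy {p : ℝ} (hp0 : 0 < p) (hp1 : p ≤ 1) {Φ : ℂ → ℂ}
    (hΦ : Φ ∈ holoHardy p) : ∃ L, HasBoundaryValue Φ L := by
  obtain ⟨C, hC0, hC⟩ := exists_growth_of_holoHardy hp0 hp1 hΦ
  have hd := hΦ.1
  have hC' : ∀ z ∈ disk, ‖Φ z‖ ≤ C * ((1 - ‖z‖) ^ ⌈1 / p⌉₊)⁻¹ := fun z hz => by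
    refine (hC z hz).trans ?_
    rw [mem_disk] at hz
    have h1 : 0 < 1 - ‖z‖ := by linarith
    rw [← Real.rpow_natCast, ← Real.rpow_neg h1.le]
    refine mul_le_mul_of_nonneg_left ?_ hC0
    exact Real.rpow_le_rpow_of_exponent_ge h1 (by linarith [norm_nonneg z])
      (neg_le_neg (Nat.le_ceil _))
  refine ⟨_, hasBoundaryValue_of_hasSum hd.continuousOn (by positivity)
    (norm_taylor_coeff_le hd hC0 hC') fun z hz => ?_⟩
  have := Complex.hasSum_taylorSeries_on_ball hd hz
  refine this.congr_fun fun m => ?_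
  simp only [sub_zero, smul_eq_mul]
  ring

/-! ### Means over small disks -/

lemma tendsto_setAverage_ball {f : ℂ → ℂ} {z : ℂ} (hf : ContinuousAt f z)
    (hm : StronglyMeasurableAtFilter f (𝓝 z)) :
    Tendsto (fun ε : ℝ => ⨍ ζ in Metric.ball z ε, f ζ) (𝓝[>] 0) (𝓝 (f z)) := by
  have hs : Tendsto (fun ε : ℝ => Metric.ball z ε) (𝓝[>] 0) (𝓝 z).smallSets := by
    rw [tendsto_smallSets_iff]
    intro t ht
    obtain ⟨δ, hδ, hδt⟩ := Metric.mem_nhds_iff.1 ht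
    filter_upwards [Ioo_mem_nhdsGT hδ] with ε hε
    exact (Metric.ball_subset_ball hε.2.le).trans hδt
  have h1 := hf.integral_sub_linear_isLittleO_ae hm hs
  have h2 := h1.tendsto_inv_smul_nhds_zero
  have h3 := h2.add_const (f z)
  rw [zero_add] at h3
  refine h3.congr' ?_
  filter_upwards [self_mem_nhdsWithin] with ε hε
  have hpos : (volume : Measure ℂ).real (Metric.ball z ε) ≠ 0 :=
    (ENNReal.toReal_pos (Metric.measure_ball_pos volume z hε).ne' measure_ball_lt_top.ne).ne'
  rw [setAverage_eq, smul_sub, inv_smul_smul₀ hpos, sub_add_cancel]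

/-- If `|ζ - z| ≥ 2ε`, then `|ζ - z'| ≥ |ζ - z|/2` on the ball. Otherwise the ball lies in `B(ζ,
3ε)`, and the mean is at most `6πε/(πε²) = 12/(2ε)`, which is at most `12/|ζ - z|`. -/
lemma average_inv_le {z ζ : ℂ} {ε : ℝ} (hε : 0 < ε) :
    (volume (Metric.ball z ε))⁻¹ * ∫⁻ z' in Metric.ball z ε, ‖ζ - z'‖ₑ⁻¹ ≤ 12 * ‖ζ - z‖ₑ⁻¹ := by
  have hv0 : volume (Metric.ball z ε) ≠ 0 := (Metric.measure_ball_pos volume z hε).ne'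
  have hvt : volume (Metric.ball z ε) ≠ ⊤ := measure_ball_lt_top.ne
  rcases le_or_gt (2 * ε) ‖ζ - z‖ with h | h
  · have h1 : ∀ z' ∈ Metric.ball z ε, ‖ζ - z'‖ₑ⁻¹ ≤ 12 * ‖ζ - z‖ₑ⁻¹ := fun z' hz' => by
      rw [Metric.mem_ball, dist_eq_norm] at hz'
      have h2 : ENNReal.ofReal (1 / 2) * ‖ζ - z‖ₑ ≤ ‖ζ - z'‖ₑ := by
        rw [← ofReal_norm, ← ofReal_norm, ← ENNReal.ofReal_mul (by norm_num)]
        refine ENNReal.ofReal_le_ofReal ?_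
        have := norm_sub_le (ζ - z') (z - z')
        rw [sub_sub_sub_cancel_right, norm_sub_rev z z'] at this
        linarith
      have h3 := ENNReal.inv_le_inv.2 h2
      rw [ENNReal.mul_inv (.inr enorm_ne_top) (.inl ENNReal.ofReal_ne_top),
        ← ENNReal.ofReal_inv_of_pos (by norm_num)] at h3
      refine h3.trans ?_
      gcongr
      rw [show (12 : ℝ≥0∞) = ENNReal.ofReal 12 by simp]
      exact ENNReal.ofReal_le_ofReal (by norm_num)
    calc _ ≤ (volume (Metric.ball z ε))⁻¹ * ∫⁻ z' in Metric.ball z ε, 12 * ‖ζ - z‖ₑ⁻¹ := by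
          refine mul_le_mul_right ?_ _
          exact setLIntegral_mono' measurableSet_ball h1
      _ = _ := by
          rw [setLIntegral_const, mul_left_comm, ENNReal.inv_mul_cancel hv0 hvt, mul_one]
  · have h1 : ∫⁻ z' in Metric.ball z ε, ‖ζ - z'‖ₑ⁻¹ ≤ ENNReal.ofReal (2 * Real.pi * (3 * ε)) := by
      refine (lintegral_mono_set fun z' hz' => ?_).trans (lintegral_ball_inv ζ (3 * ε))
      rw [Metric.mem_ball, dist_eq_norm] at hz' ⊢
      have := norm_sub_le (z' - z) (ζ - z)
      rw [sub_sub_sub_cancel_right] at this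
      linarith
    have h2 : volume (Metric.ball z ε) = ENNReal.ofReal (Real.pi * ε ^ 2) := by
      rw [Complex.volume_ball, ← ENNReal.ofReal_pow hε.le, mul_comm,
        ENNReal.ofReal_mul Real.pi_pos.le]
      congr 1
      exact (ENNReal.ofReal_coe_nnreal (p := NNReal.pi)).symm
    have h3 : (ENNReal.ofReal (2 * ε))⁻¹ ≤ ‖ζ - z‖ₑ⁻¹ := by
      refine ENNReal.inv_le_inv.2 ?_
      rw [← ofReal_norm]
      exact ENNReal.ofReal_le_ofReal h.le
    calc _ ≤ (ENNReal.ofReal (Real.pi * ε ^ 2))⁻¹ * ENNReal.ofReal (2 * Real.pi * (3 * ε)) := by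
          rw [h2]; gcongr
      _ = 12 * (ENNReal.ofReal (2 * ε))⁻¹ := by
          rw [← ENNReal.ofReal_inv_of_pos (by positivity), ← ENNReal.ofReal_inv_of_pos (by positivity),
            ← ENNReal.ofReal_mul (by positivity), show (12 : ℝ≥0∞) = ENNReal.ofReal 12 by simp,
            ← ENNReal.ofReal_mul (by positivity)]
          congr 1
          have := Real.pi_ne_zero
          field_simp
          norm_num
      _ ≤ _ := by gcongr

lemma integrable_kernelT_prod {g : ℂ → ℂ} (hg : IntegrableOn g disk) {S : Set ℂ} (hS : S ⊆ disk)
    (hSm : MeasurableSet S) :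
    Integrable (fun p : ℂ × ℂ => kernelT g p.1 p.2)
      ((volume.restrict S).prod (volume.restrict disk)) := by
  have hm : AEStronglyMeasurable (fun p : ℂ × ℂ => kernelT g p.1 p.2)
      ((volume.restrict S).prod (volume.restrict disk)) :=
    aestronglyMeasurable_kernelT_prod measurable_id hg.1
  refine ⟨hm, ?_⟩
  rw [HasFiniteIntegral, lintegral_prod _ hm.enorm]
  calc _ ≤ ∫⁻ z in S, 2 * absPotential g z := setLIntegral_mono' hSm fun z hz =>
        lintegral_enorm_kernelT_le g (mem_disk.1 (hS hz)).le
    _ ≤ ∫⁻ z in disk, 2 * absPotential g z := lintegral_mono_set hS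
    _ < ⊤ := by
        rw [lintegral_const_mul' _ _ (by simp)]
        exact ENNReal.mul_lt_top (by simp) (lintegral_absPotential_lt_top hg)

/-- The two halves of the kernel cannot cancel at an interior point, since the conjugated one is
integrable by itself. This provides the majorant for the means of `T̃ g`. -/
lemma absPotential_lt_top_of_definedT {g : ℂ → ℂ} (hg : IntegrableOn g disk) {z : ℂ} (hz : z ∈ disk)
    (hd : DefinedT g z) : absPotential g z < ⊤ := by
  have h2 : IntegrableOn (fun ζ => g ζ / (ζ - z)) disk := by
    refine (Integrable.sub hd (integrableOn_conj_part hg hz)).congr (.of_forall fun ζ => ?_)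
    simp [kernelT]
  refine lt_of_eq_of_lt (lintegral_congr_ae ?_) h2.2
  have : ∀ᵐ ζ ∂(volume.restrict disk), ζ ≠ z := ae_restrict_of_ae (by simp [ae_iff])
  filter_upwards [this] with ζ hζ
  rw [div_eq_mul_inv, enorm_mul, enorm_inv (sub_ne_zero.2 hζ)]

lemma continuousAt_kernelT (g : ℂ → ℂ) {z ζ : ℂ} (hz : z ∈ disk) (hζ : ζ ∈ disk) (h : ζ ≠ z) :
    ContinuousAt (fun z => kernelT g z ζ) z := by
  have h1 : ζ - z ≠ 0 := sub_ne_zero.2 h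
  have h2 : 1 - (starRingEnd ℂ) ζ * z ≠ 0 := by
    rw [mem_disk] at hz hζ
    exact norm_pos_iff.1 ((norm_pos_iff.2 h1).trans_le (norm_sub_le_norm_one_sub hz.le hζ.le))
  unfold kernelT
  exact (ContinuousAt.div (by fun_prop) (by fun_prop) h1).add
    (ContinuousAt.div (by fun_prop) (by fun_prop) h2)

lemma measurable_kernelT_left (g : ℂ → ℂ) (ζ : ℂ) : Measurable fun z => kernelT g z ζ := by
  unfold kernelT
  fun_prop

/-- At the points at which `T̃ g` is defined it is the limit of its means over small disks. -/
lemma tendsto_setAverage_opT {g : ℂ → ℂ} (hg : IntegrableOn g disk) {z : ℂ} (hz : z ∈ disk)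
    (hd : DefinedT g z) :
    Tendsto (fun ε : ℝ => ⨍ ζ in Metric.ball z ε, opT g ζ) (𝓝[>] 0) (𝓝 (opT g z)) := by
  have hev : ∀ᶠ ε in 𝓝[>] (0 : ℝ), 0 < ε ∧ Metric.ball z ε ⊆ disk := by
    have hz' := mem_disk.1 hz
    filter_upwards [Ioo_mem_nhdsGT (show (0 : ℝ) < 1 - ‖z‖ by linarith)] with ε hε
    refine ⟨hε.1, Metric.ball_subset_ball' ?_⟩
    rw [dist_zero_right]
    linarith [hε.2]
  have hpot := absPotential_lt_top_of_definedT hg hz hd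
  have hgm : AEMeasurable (fun ζ => ‖g ζ‖ₑ * ‖ζ - z‖ₑ⁻¹) (volume.restrict disk) :=
    hg.1.enorm.mul (by fun_prop)
  have hne : ∀ᵐ ζ ∂(volume.restrict disk), ζ ≠ z := ae_restrict_of_ae (by simp [ae_iff])
  have hlim : Tendsto (fun ε : ℝ => ∫ ζ in disk, ⨍ z' in Metric.ball z ε, kernelT g z' ζ) (𝓝[>] 0)
      (𝓝 (∫ ζ in disk, kernelT g z ζ)) := by
    -- The constant is `24 = 2 · 12`: the kernel bound times `average_inv_le`. The majorant does not
    -- depend on `ε`.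
    refine tendsto_integral_filter_of_dominated_convergence
      (fun ζ => (24 * (‖g ζ‖ₑ * ‖ζ - z‖ₑ⁻¹)).toReal) ?_ ?_ ?_ ?_
    · filter_upwards [hev] with ε hε
      simp_rw [setAverage_eq]
      exact ((integrable_kernelT_prod hg hε.2 measurableSet_ball).integral_prod_right).1.const_smul _
    · filter_upwards [hev] with ε hε
      filter_upwards [hne, ae_restrict_mem measurableSet_disk] with ζ hζ hζD
      have hfin : 24 * (‖g ζ‖ₑ * ‖ζ - z‖ₑ⁻¹) ≠ ⊤ :=
        ENNReal.mul_ne_top (by simp) (ENNReal.mul_ne_top enorm_ne_top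
          (ENNReal.inv_ne_top.2 (enorm_ne_zero.2 (sub_ne_zero.2 hζ))))
      rw [← toReal_enorm]
      refine ENNReal.toReal_mono hfin ?_
      rw [setAverage_eq, enorm_smul]
      have hv : ‖((volume : Measure ℂ).real (Metric.ball z ε))⁻¹‖ₑ =
          (volume (Metric.ball z ε))⁻¹ := by
        rw [enorm_inv, measureReal_def, ← ofReal_norm, Real.norm_of_nonneg ENNReal.toReal_nonneg,
          ENNReal.ofReal_toReal measure_ball_lt_top.ne]
        rw [measureReal_def]
        exact (ENNReal.toReal_pos (Metric.measure_ball_pos volume z hε.1).ne'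
          measure_ball_lt_top.ne).ne'
      rw [hv]
      calc _ ≤ (volume (Metric.ball z ε))⁻¹ *
            ∫⁻ z' in Metric.ball z ε, 2 * ‖g ζ‖ₑ * ‖ζ - z'‖ₑ⁻¹ := by
            refine mul_le_mul_right ?_ _
            refine (enorm_integral_le_lintegral_enorm _).trans ?_
            refine setLIntegral_mono' measurableSet_ball fun z' hz' => ?_
            rw [mul_assoc]
            exact enorm_kernelT_le g (mem_disk.1 (hε.2 hz')).le (mem_disk.1 hζD).le
        _ = 2 * ‖g ζ‖ₑ * ((volume (Metric.ball z ε))⁻¹ *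
            ∫⁻ z' in Metric.ball z ε, ‖ζ - z'‖ₑ⁻¹) := by
            rw [lintegral_const_mul' _ _ (by finiteness)]
            ring
        _ ≤ 2 * ‖g ζ‖ₑ * (12 * ‖ζ - z‖ₑ⁻¹) := by
            refine mul_le_mul_right ?_ _
            exact average_inv_le hε.1
        _ = _ := by ring
    · refine integrable_toReal_of_lintegral_ne_top (hgm.const_mul 24) ?_
      rw [lintegral_const_mul' _ _ (by simp)]
      exact (ENNReal.mul_lt_top (by simp) hpot).ne
    · filter_upwards [hne, ae_restrict_mem measurableSet_disk] with ζ hζ hζD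
      exact tendsto_setAverage_ball (continuousAt_kernelT g hz hζD hζ)
        (measurable_kernelT_left g ζ).stronglyMeasurable.stronglyMeasurableAtFilter
  have h2 := hlim.const_mul (-(1 / (Real.pi : ℂ)))
  refine h2.congr' ?_
  filter_upwards [hev] with ε hε
  have hint := integrable_kernelT_prod hg hε.2 (measurableSet_ball (x := z) (ε := ε))
  simp_rw [setAverage_eq, opT]
  rw [integral_smul, ← integral_integral_swap hint, integral_const_mul, mul_smul_comm]

/-- Means ignore null sets, so those of `w` are those of `Φ + T̃ g` and converge to its value;
precision then leaves no choice for `w z`. -/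
lemma isPrecise_eq {w Φ g : ℂ → ℂ} (hw : IsPrecise w) (hΦ : ContinuousOn Φ disk)
    (hg : IntegrableOn g disk)
    (h : ∀ᵐ z ∂(volume.restrict disk), w z = Φ z + opT g z) {z : ℂ} (hz : z ∈ disk)
    (hd : DefinedT g z) : w z = Φ z + opT g z := by
  refine hw z hz _ ?_
  have h1 := (tendsto_setAverage_ball (hΦ.continuousAt (isOpen_disk.mem_nhds hz))
    (hΦ.stronglyMeasurableAtFilter isOpen_disk z hz)).add (tendsto_setAverage_opT hg hz hd)
  refine h1.congr' ?_
  have hz' := mem_disk.1 hz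
  filter_upwards [Ioo_mem_nhdsGT (show (0 : ℝ) < (1 - ‖z‖) / 2 by linarith)] with ε hε
  have hsub : Metric.closedBall z ε ⊆ disk := by
    refine Metric.closedBall_subset_ball' ?_
    rw [dist_zero_right]
    linarith [hε.2]
  have hsub' := Metric.ball_subset_closedBall.trans hsub
  have i1 : IntegrableOn Φ (Metric.ball z ε) :=
    ((hΦ.mono hsub).integrableOn_compact (isCompact_closedBall z ε)).mono_set
      Metric.ball_subset_closedBall
  have i2 : IntegrableOn (opT g) (Metric.ball z ε) := by
    have := (integrable_kernelT_prod hg hsub' measurableSet_ball).integral_prod_left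
    exact this.const_mul (-(1 / (Real.pi : ℂ)))
  simp_rw [setAverage_eq]
  rw [← smul_add, ← integral_add i1 i2]
  congr 1
  refine integral_congr_ae ?_
  filter_upwards [ae_restrict_of_ae_restrict_of_subset hsub' h] with ζ hζ using hζ.symm

/-! ### Boundary values along filters -/

lemma HasBoundaryValueAlong.mono {l l' : Filter ℝ} {u : ℂ → ℂ} {L : circleDistribution}
    (h : HasBoundaryValueAlong l u L) (hl : l' ≤ l) : HasBoundaryValueAlong l' u L :=
  ⟨h.1.filter_mono hl, fun φ => (h.2 φ).mono_left hl⟩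

lemma HasBoundaryValueAlong.add {l : Filter ℝ} {u v : ℂ → ℂ} {L L' : circleDistribution}
    (h : HasBoundaryValueAlong l u L) (h' : HasBoundaryValueAlong l v L') :
    HasBoundaryValueAlong l (fun z => u z + v z) (L + L') := by
  refine ⟨?_, fun φ => ?_⟩
  · filter_upwards [h.1, h'.1] with r h1 h2 using h1.add h2
  · refine ((h.2 φ).add (h'.2 φ)).congr' ?_
    filter_upwards [h.1, h'.1] with r h1 h2
    have hφ := (circleTest_continuous φ).continuousOn (s := uIcc 0 (2 * Real.pi))
    rw [← intervalIntegral.integral_add (h1.mul_continuousOn hφ) (h2.mul_continuousOn hφ)]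
    simp only [add_mul]

lemma HasBoundaryValueAlong.congr {l : Filter ℝ} {u w : ℂ → ℂ} {L : circleDistribution}
    (h : HasBoundaryValueAlong l u L) (hw : ∀ᶠ r in l,
      ∀ᵐ θ ∂(volume.restrict (Ioc (0 : ℝ) (2 * Real.pi))), w (polarPt r θ) = u (polarPt r θ)) :
    HasBoundaryValueAlong l w L := by
  refine ⟨?_, fun φ => (h.2 φ).congr' ?_⟩
  · filter_upwards [h.1, hw] with r h1 h2
    rw [intervalIntegrable_iff_integrableOn_Ioc_of_le Real.two_pi_pos.le] at h1 ⊢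
    exact h1.congr (h2.mono fun _ h => h.symm)
  · filter_upwards [hw] with r h2
    simp_rw [intervalIntegral.integral_of_le Real.two_pi_pos.le]
    refine integral_congr_ae ?_
    filter_upwards [h2] with θ h
    rw [h]

/-! ### The chain of derivatives -/

lemma exists_exponent {q : ℝ≥0∞} (hq : 1 < q) {t : ℝ} (ht : 1 < t) :
    ∃ s : ℝ, 1 < s ∧ s < 2 ∧ s < t ∧ ENNReal.ofReal s ≤ q := by
  obtain ⟨r, -, h1, h2⟩ := ENNReal.lt_iff_exists_real_btwn.1 hq
  have hr : 1 < r := by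
    rw [← ENNReal.ofReal_one] at h1
    exact (ENNReal.ofReal_lt_ofReal_iff_of_nonneg zero_le_one).1 h1
  refine ⟨min r (min ((1 + t) / 2) (3 / 2)), ?_, ?_, ?_, ?_⟩
  · exact lt_min hr (lt_min (by linarith) (by norm_num))
  · exact (min_le_right _ _).trans_lt ((min_le_right _ _).trans_lt (by norm_num))
  · exact (min_le_right _ _).trans_lt ((min_le_left _ _).trans_lt (by linarith))
  · exact (ENNReal.ofReal_le_ofReal (min_le_left _ _)).trans h2.le

/-- `g ∈ L^s(D)`. -/
def InLs (s : ℝ) (g : ℂ → ℂ) : Prop :=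
  AEStronglyMeasurable g (volume.restrict disk) ∧ ∫⁻ z in disk, ‖g z‖ₑ ^ s < ⊤

lemma inLs_of_memLp {s : ℝ} (hs : 1 < s) {q : ℝ≥0∞} (hsq : ENNReal.ofReal s ≤ q) {f : ℂ → ℂ}
    (hf : MemLp f q (volume.restrict disk)) : InLs s f := by
  have h1 := hf.mono_exponent hsq
  have hs0 : 0 < s := by linarith
  refine ⟨h1.1, ?_⟩
  have h2 := (eLpNorm_lt_top_iff_lintegral_rpow_enorm_lt_top (by simpa using hs0)
    ENNReal.ofReal_ne_top).1 h1.2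
  rwa [ENNReal.toReal_ofReal hs0.le] at h2

lemma InLs.congr {s : ℝ} {g h : ℂ → ℂ} (hg : InLs s g)
    (e : ∀ᵐ z ∂(volume.restrict disk), h z = g z) : InLs s h := by
  refine ⟨hg.1.congr (e.mono fun _ h => h.symm), lt_of_eq_of_lt (lintegral_congr_ae ?_) hg.2⟩
  filter_upwards [e] with z hz
  rw [hz]

lemma InLs.add {s : ℝ} (hs : 1 < s) {g h : ℂ → ℂ} (hg : InLs s g) (hh : InLs s h) :
    InLs s (fun z => g z + h z) := by
  have hs0 : 0 < s := by linarith
  refine ⟨hg.1.add hh.1, ?_⟩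
  have h2 : (2 : ℝ≥0∞) ^ (s - 1) ≠ ⊤ :=
    (ENNReal.rpow_lt_top_of_nonneg (by linarith) (by simp)).ne
  calc _ ≤ ∫⁻ z in disk, 2 ^ (s - 1) * (‖g z‖ₑ ^ s + ‖h z‖ₑ ^ s) :=
        lintegral_mono fun z => (ENNReal.rpow_le_rpow (enorm_add_le _ _) hs0.le).trans
          (ENNReal.rpow_add_le_mul_rpow_add_rpow _ _ hs.le)
    _ = 2 ^ (s - 1) * ((∫⁻ z in disk, ‖g z‖ₑ ^ s) + ∫⁻ z in disk, ‖h z‖ₑ ^ s) := by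
        rw [lintegral_const_mul' _ _ h2, lintegral_add_left' (hg.1.enorm.pow_const s)]
    _ < ⊤ := ENNReal.mul_lt_top h2.lt_top (ENNReal.add_lt_top.2 ⟨hg.2, hh.2⟩)

lemma InLs.integrableOn {s : ℝ} (hs : 1 < s) {g : ℂ → ℂ} (hg : InLs s g) : IntegrableOn g disk :=
  integrableOn_disk_of_rpow hs.le hg.1 hg.2

lemma InLs.opT {s : ℝ} (hs1 : 1 < s) (hs2 : s < 2) {g : ℂ → ℂ} (hg : InLs s g) :
    InLs s (opT g) :=
  ⟨aestronglyMeasurable_opT_comp measurable_id hg.1, lintegral_opT_rpow_lt_top hs1 hs2 hg.1 hg.2⟩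

lemma inLs_of_holoHardy {p : ℝ} (hp0 : 0 < p) (hp1 : p ≤ 1) {s : ℝ} (hs1 : 1 < s)
    (hs : s < 2 * p) {Φ : ℂ → ℂ} (hΦ : Φ ∈ holoHardy p) : InLs s Φ :=
  ⟨hΦ.1.continuousOn.aestronglyMeasurable measurableSet_disk,
    lintegral_rpow_lt_top_of_holoHardy hp0 hp1 (by linarith) hs hΦ⟩

lemma exists_holoHardy_add_opT {p : ℝ} (hp0 : 0 < p) (hp1 : p ≤ 1) {s : ℝ} (hs1 : 1 < s)
    (hs2 : s < 2) {w g : ℂ → ℂ} (hwg : IsWeakDbar w g) (hw : hardyNorm p w < ⊤) (hg : InLs s g) :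
    ∃ Φ ∈ holoHardy p, ∀ᵐ z ∂(volume.restrict disk), w z = Φ z + opT g z := by
  obtain ⟨Φ, hΦ, h⟩ := exists_holomorphic_add_opT hwg (hg.integrableOn hs1)
  exact ⟨Φ, holomorphic_part_mem_holoHardy hp0 hp1 hs1 hs2 hw hg.1 hg.2 hΦ h, h⟩

/-- Descending induction: `T̃` preserves `L^s`, and `H^p ⊆ L^s` for `s < 2p`. A step occurs only for
`1 ≤ k < n`, which excludes `n = 1`, so `s < 2p` is then available. -/
lemma inLs_chain {n : ℕ} {p : ℝ} (hp0 : 0 < p) (hp1 : p ≤ 1) {s : ℝ} (hs1 : 1 < s) (hs2 : s < 2)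
    (hs : n = 1 ∨ s < 2 * p) {g : ℕ → ℂ → ℂ} (hgn : InLs s (g n))
    (hg : ∀ k < n, IsWeakDbar (g k) (g (k + 1)) ∧ hardyNorm p (g k) < ⊤) {k : ℕ} (hk1 : 1 ≤ k)
    (hkn : k ≤ n) : InLs s (g k) := by
  induction hkn using Nat.decreasingInduction with
  | self => exact hgn
  | of_succ k hk ih =>
    have hsp : s < 2 * p := hs.resolve_left (by omega)
    obtain ⟨Φ, hΦ, h⟩ := exists_holoHardy_add_opT hp0 hp1 hs1 hs2 (hg k hk).1 (hg k hk).2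
      (ih (by omega))
    exact ((inLs_of_holoHardy hp0 hp1 hs1 hsp hΦ).add hs1 ((ih (by omega)).opT hs1 hs2)).congr h

/-- Exceptional null sets do not accumulate through the nesting: `T̃` takes functions equal almost
everywhere to the same function. -/
lemma nest_ae_eq {n : ℕ} {f : ℂ → ℂ} {Φ g : ℕ → ℂ → ℂ} (hgn : g n = f)
    (h : ∀ k < n, ∀ᵐ z ∂(volume.restrict disk), g k z = Φ k z + opT (g (k + 1)) z) (m : ℕ) :
    ∀ k, k + m = n → ∀ᵐ z ∂(volume.restrict disk), nest f Φ k m z = g k z := by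
  induction m with
  | zero =>
    intro k hk
    rw [add_zero] at hk
    rw [hk, hgn]
    exact .of_forall fun _ => rfl
  | succ m ih =>
    intro k hk
    filter_upwards [h k (by omega)] with z hz
    rw [hz, nest, opT_congr (ih (k + 1) (by omega))]

end HardyDbar

/-! ### Assembly of the theorem. -/

open HardyDbar in
theorem mainTheorem8 (n : ℕ) (hn : 1 ≤ n) (p : ℝ) (hp0 : 0 < p) (hp1 : p ≤ 1)
    (hnp : n = 1 ∨ 1 / 2 < p) (q : ℝ≥0∞) (hq : 1 < q) (f w : ℂ → ℂ)
    (hw : w ∈ HardyDbar.hardyClassLq n p q f) :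
    ∃ Φ : ℕ → ℂ → ℂ,
      (∀ k < n, Φ k ∈ HardyDbar.holoHardy p) ∧
      -- each application of the operator is to an integrable function and is defined a.e.
      (∀ k, 1 ≤ k → k ≤ n →
        IntegrableOn (HardyDbar.nest f Φ k (n - k)) HardyDbar.disk ∧
        ∀ᵐ z ∂(volume.restrict HardyDbar.disk),
          HardyDbar.DefinedT (HardyDbar.nest f Φ k (n - k)) z) ∧
      -- the representation, almost everywhere in the disk
      (∀ᵐ z ∂(volume.restrict HardyDbar.disk), w z = Φ 0 z + HardyDbar.psiT f Φ n z) ∧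
      -- for a precise representative it holds at each point at which the outer integral converges
      (HardyDbar.IsPrecise w → ∀ z ∈ HardyDbar.disk,
        HardyDbar.DefinedT (HardyDbar.nest f Φ 1 (n - 1)) z →
          w z = Φ 0 z + HardyDbar.psiT f Φ n z) ∧
      -- the boundary values
      ∃ Φb Ψb : HardyDbar.circleDistribution,
        HardyDbar.HasBoundaryValue (Φ 0) Φb ∧
        HardyDbar.HasBoundaryValue (HardyDbar.psiT f Φ n) Ψb ∧
        HardyDbar.HasEssBoundaryValue w (Φb + Ψb) ∧
        (HardyDbar.IsPrecise w → HardyDbar.HasBoundaryValue w (Φb + Ψb)) := by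
  obtain ⟨hf, g, hg0, hgn, hg⟩ := hw
  -- One exponent for the whole chain. The hypothesis `p > 1/2` enters here: it leaves room for `1 <
  -- s < 2p`.
  obtain ⟨s, hs1, hs2, hsp, hsq⟩ : ∃ s : ℝ, 1 < s ∧ s < 2 ∧ (n = 1 ∨ s < 2 * p) ∧
      ENNReal.ofReal s ≤ q := by
    rcases hnp with h | h
    · obtain ⟨s, h1, h2, -, h4⟩ := exists_exponent hq one_lt_two
      exact ⟨s, h1, h2, .inl h, h4⟩
    · obtain ⟨s, h1, h2, h3, h4⟩ := exists_exponent hq (t := 2 * p) (by linarith)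
      exact ⟨s, h1, h2, .inr h3, h4⟩
  have hL : ∀ k, 1 ≤ k → k ≤ n → InLs s (g k) := fun k hk1 hkn =>
    inLs_chain hp0 hp1 hs1 hs2 hsp (by rw [hgn]; exact inLs_of_memLp hs1 hsq hf) hg hk1 hkn
  have hex : ∀ k, ∃ Φ : ℂ → ℂ, k < n → Φ ∈ holoHardy p ∧
      ∀ᵐ z ∂(volume.restrict disk), g k z = Φ z + opT (g (k + 1)) z := fun k => by
    by_cases hk : k < n
    · obtain ⟨Φ, h1, h2⟩ := exists_holoHardy_add_opT hp0 hp1 hs1 hs2 (hg k hk).1 (hg k hk).2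
        (hL (k + 1) (by omega) (by omega))
      exact ⟨Φ, fun _ => ⟨h1, h2⟩⟩
    -- The functions with index at least `n` occur nowhere in the nested expression.
    · exact ⟨0, fun h => absurd h hk⟩
  choose Φ hΦ using hex
  have hnest : ∀ k ≤ n, ∀ᵐ z ∂(volume.restrict disk), nest f Φ k (n - k) z = g k z := fun k hk =>
    nest_ae_eq hgn (fun k hk => (hΦ k hk).2) (n - k) k (by omega)
  have hN : ∀ k, 1 ≤ k → k ≤ n → InLs s (nest f Φ k (n - k)) := fun k hk1 hkn =>
    (hL k hk1 hkn).congr (hnest k hkn)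
  have hG := hN 1 le_rfl hn
  have hrep : ∀ᵐ z ∂(volume.restrict disk), w z = Φ 0 z + opT (nest f Φ 1 (n - 1)) z := by
    rw [opT_congr (hnest 1 hn), ← hg0]
    exact (hΦ 0 (by omega)).2
  have hΦ0 := (hΦ 0 (by omega)).1
  have hprec : IsPrecise w → ∀ z ∈ disk, DefinedT (nest f Φ 1 (n - 1)) z →
      w z = Φ 0 z + opT (nest f Φ 1 (n - 1)) z := fun hp z hz hd =>
    isPrecise_eq hp hΦ0.1.continuousOn (hG.integrableOn hs1) hrep hz hd
  obtain ⟨Φb, hΦb⟩ := exists_hasBoundaryValue_of_holoHardy hp0 hp1 hΦ0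
  obtain ⟨Ψb, hΨb⟩ := exists_hasBoundaryValue_opT hs1 hs2 hG.1 hG.2
  have hsum : HasBoundaryValueAlong (𝓝[<] 1) (fun z => Φ 0 z + opT (nest f Φ 1 (n - 1)) z)
    (Φb + Ψb) := HasBoundaryValueAlong.add hΦb hΨb
  refine ⟨Φ, fun k hk => (hΦ k hk).1, fun k hk1 hkn => ?_, hrep, hprec, Φb, Ψb, hΦb, hΨb, ?_,
    fun hp => ?_⟩
  · have := (hN k hk1 hkn).integrableOn hs1
    exact ⟨this, ae_definedT this⟩
  -- An identity almost everywhere in the disk holds, by Fubini, on almost every circle only; hence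
  -- the essential limit.
  · refine (hsum.mono inf_le_left).congr ?_
    have h1 : ∀ᶠ r in 𝓝[<] (1 : ℝ) ⊓ ae volume, r ∈ Ioo (0 : ℝ) 1 :=
      (show ∀ᶠ r in 𝓝[<] (1 : ℝ), r ∈ Ioo (0 : ℝ) 1 from Ioo_mem_nhdsLT zero_lt_one).filter_mono
        inf_le_left
    filter_upwards [h1, (ae_polar hrep).filter_mono inf_le_right] with r hr h using h hr
  -- For precise `w` the identity holds wherever the outer integral converges, that is, almost
  -- everywhere on every circle of radius in `(1/2, 1)`.
  · refine hsum.congr ?_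
    have h1 : Ioo (1 / 2 : ℝ) 1 ∈ 𝓝[<] (1 : ℝ) := Ioo_mem_nhdsLT (by norm_num)
    filter_upwards [h1] with r hr
    filter_upwards [ae_circle_definedT hs1 hs2 hG.1 hG.2 (Ioo_subset_Icc_self hr)] with θ hθ
    exact hprec hp _ (polarPt_mem_disk ⟨by linarith [hr.1], hr.2⟩ θ) hθ
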